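/- Let $N\ge 1$, $\Omega=\mathbb T^{N-1}\times(0,1)$ with $\mathbb T^{N-1}=\mathbb R^{N-1}/\mathbb Z^{N-1}$, so that $\partial\Omega=\mathbb T^{N-1}\times\{0,1\}$; let $d(x)=\operatorname{dist}(x,\partial\Omega)=\min(x_N,1-x_N)$ and $\Omega_\varepsilon=\{x\in\Omega: d(x)\ge\varepsilon\}$. Let $\varphi(\varepsilon)>0$ for $\varepsilon\in(0,\frac12)$, with $\lim_{\varepsilon\downarrow0}\varepsilon\varphi(\varepsilon)=\kappa\in(0,\infty)$, and put $b_\varepsilon=\chi_{\Omega_\varepsilon}+\varphi(\varepsilon)\chi_{\Omega\setminus\Omega_\varepsilon}$. Let $X_\varepsilon=L^2_\varepsilon(\Omega)$ be the space $L^2(\Omega)$ with the inner product $\int_\Omega b_\varepsilon uv\,dx$, and let $X_0^\kappa$ be $L^2(\Omega)\times L^2(\partial\Omega)$ with the inner product $\int_\Omega u_1u_2\,dx+\kappa\int_{\partial\Omega}\xi_1\xi_2\,d\mathcal H^{N-1}$. For $\varepsilon\in(0,\frac12)$ let $a_\varepsilon$ be a continuous function on $\overline\Omega$ of the form $a_\varepsilon(x)=a_\varepsilon(d(x))$,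 without zeros in $\Omega$, such that $a_\varepsilon\to1$ locally uniformly in $\Omega$ as $\varepsilon\downarrow0$; $a_\varepsilon\ge\underline a$ on $\Omega_\varepsilon$ for some constant $\underline a>0$ independent of $\varepsilon$; for $p=1$ or $p=\frac12$, $$\frac1\varepsilon\int_0^\varepsilon\Big(\int_s^\varepsilon\frac{d\sigma}{a_\varepsilon(\sigma)}\Big)^p ds\to0\qquad(\varepsilon\downarrow0);$$ and $\sup_{\varepsilon\in(0,1/2)}\sup_{\Omega}a_\varepsilon<\infty$. Define, for $u\in X_\varepsilon$ and $(u,v)\in X_0^\kappa$, $$E_\varepsilon(u)=\begin{cases}\frac12\int_\Omega a_\varepsilon|\nabla u|^2dx,&u\in H^1_{loc}(\Omega),\\+\infty,&\text{otherwise,}\end{cases}\qquad E_0(u,v)=\begin{cases}\frac12\int_\Omega|\nabla u|^2dx,&u\in H^1(\Omega),\ \gamma u=v,\\+\infty,&\text{otherwise,}\end{cases}$$ where $\gamma:H^1(\Omega)\to L^2(\partial\Omega)$ is the trace operator. Let $\iota_\varepsilon:X_\varepsilon\to X_0^\kappa$, $\iota_\varepsilon(u)=(u,m_\varepsilon u)$,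 where $(m_\varepsilon u)(x',0)=\frac1\varepsilon\int_0^\varepsilon u(x',s)\,ds$ and $(m_\varepsilon u)(x',1)=\frac1\varepsilon\int_{1-\varepsilon}^1u(x',s)\,ds$. Then $E_\varepsilon$ $\Gamma$-converges to $E_0$ with respect to $\iota_\varepsilon$ as $\varepsilon\downarrow0$, that is: (i) if $u^\varepsilon\in X_\varepsilon$ and $\iota_\varepsilon(u^\varepsilon)\to w$ in $X_0^\kappa$, then $E_0(w)\le\liminf_{\varepsilon\downarrow0}E_\varepsilon(u^\varepsilon)$; (ii) for every $w\in X_0^\kappa$ there are $u^\varepsilon\in X_\varepsilon$ with $\iota_\varepsilon(u^\varepsilon)\to w$ in $X_0^\kappa$ and $\lim_{\varepsilon\downarrow0}E_\varepsilon(u^\varepsilon)=E_0(w)$. In particular this holds for $a_\varepsilon(x)=\min\{d(x)/\varepsilon,1\}$. -/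

import Mathlib

open MeasureTheory Set Filter Topology
open scoped ENNReal ContDiff

noncomputable section

namespace ThinLayer

/-! ### The flat cylinder `Ω = 𝕋ⁿ × (0, 1)`, of dimension `N = n + 1` -/

/-- The ambient space `𝕋ⁿ × ℝ`, where `𝕋ⁿ = ℝⁿ / ℤⁿ`. -/
abbrev Cyl (n : ℕ) : Type := UnitAddTorus (Fin n) × ℝ

/-- The open cylinder `Ω = 𝕋ⁿ × (0, 1)`. -/
def Omega (n : ℕ) : Set (Cyl n) := univ ×ˢ Ioo (0 : ℝ) 1

/-- Lebesgue measure on `Ω`. -/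
def volOmega (n : ℕ) : Measure (Cyl n) :=
  (volume : Measure (UnitAddTorus (Fin n))).prod (volume.restrict (Ioo (0 : ℝ) 1))

/-- The surface measure `ℋⁿ` on `∂Ω = 𝕋ⁿ × {0, 1}`. -/
def surf (n : ℕ) : Measure (Cyl n) :=
  (volume : Measure (UnitAddTorus (Fin n))).prod (Measure.dirac (0 : ℝ) + Measure.dirac (1 : ℝ))

/-- The distance `d(x)` of a point `x` of `Ω` to `∂Ω`. -/
def bdryDist {n : ℕ} (x : Cyl n) : ℝ := min x.2 (1 - x.2)

/-- `Ω_δ = {x ∈ Ω : d(x) ≥ δ}`. For `δ > 0` these sets are compact and they exhaust `Ω`. -/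
def innerDomain (n : ℕ) (δ : ℝ) : Set (Cyl n) := {x | x ∈ Omega n ∧ δ ≤ bdryDist x}

/-- The covering map `ℝⁿ⁺¹ → 𝕋ⁿ × ℝ`; the last coordinate is `x_N`. -/
def cover (n : ℕ) (y : EuclideanSpace ℝ (Fin (n + 1))) : Cyl n :=
  (fun i => ((y i.castSucc : ℝ) : UnitAddCircle), y (Fin.last n))

/-- The classical partial derivative `∂_i ψ` of a function on `𝕋ⁿ × ℝ`. -/
def pderiv {n : ℕ} (i : Fin (n + 1)) (ψ : Cyl n → ℝ) (x : Cyl n) : ℝ :=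
  deriv (fun t : ℝ => ψ (x + cover n (EuclideanSpace.single i t))) 0

/-- The classical gradient of a function on `𝕋ⁿ × ℝ`. -/
def grad {n : ℕ} (ψ : Cyl n → ℝ) (x : Cyl n) : EuclideanSpace ℝ (Fin (n + 1)) :=
  WithLp.toLp 2 fun i => pderiv i ψ x

/-! ### Sobolev functions and traces -/

/-- Test functions: the members of `C_c^∞(Ω)`. -/
def IsTest {n : ℕ} (φ : Cyl n → ℝ) : Prop :=
  ContDiff ℝ ∞ (φ ∘ cover n) ∧ HasCompactSupport φ ∧ tsupport φ ⊆ Omega n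

/-- `G ∈ L¹_loc(Ω)` is a weak gradient of `u` in `Ω`. -/
def IsWeakGrad {n : ℕ} (u : Cyl n → ℝ) (G : Cyl n → EuclideanSpace ℝ (Fin (n + 1))) : Prop :=
  (∀ δ : ℝ, 0 < δ → Integrable G ((volOmega n).restrict (innerDomain n δ))) ∧
  ∀ (i : Fin (n + 1)) (φ : Cyl n → ℝ), IsTest φ →
    ∫ x, u x * pderiv i φ x ∂(volOmega n) = - ∫ x, G x i * φ x ∂(volOmega n)

/-- `u ∈ H¹_loc(Ω)`. -/
def MemH1loc {n : ℕ} (u : Cyl n → ℝ) : Prop :=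
  (∀ δ : ℝ, 0 < δ → MemLp u 2 ((volOmega n).restrict (innerDomain n δ))) ∧
  ∃ G, IsWeakGrad u G ∧ ∀ δ : ℝ, 0 < δ → MemLp G 2 ((volOmega n).restrict (innerDomain n δ))

/-- `u ∈ H¹(Ω)`. -/
def MemH1 {n : ℕ} (u : Cyl n → ℝ) : Prop :=
  MemLp u 2 (volOmega n) ∧ ∃ G, IsWeakGrad u G ∧ MemLp G 2 (volOmega n)

/-- `γ u = v`, where `γ : H¹(Ω) → L²(∂Ω)` is the trace operator, i.e. the continuous extension
of `ψ ↦ ψ|_∂Ω`, `ψ ∈ C¹(closure Ω)`: there are such `ψ_k` with `ψ_k → u` in `H¹(Ω)` and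
`ψ_k|_∂Ω → v` in `L²(∂Ω)`. -/
def IsTrace {n : ℕ} (u v : Cyl n → ℝ) : Prop :=
  ∃ (G : Cyl n → EuclideanSpace ℝ (Fin (n + 1))) (ψ : ℕ → Cyl n → ℝ),
    IsWeakGrad u G ∧ (∀ k, ContDiff ℝ 1 (ψ k ∘ cover n)) ∧
    Tendsto (fun k => eLpNorm (fun x => ψ k x - u x) 2 (volOmega n)) atTop (𝓝 0) ∧
    Tendsto (fun k => eLpNorm (fun x => grad (ψ k) x - G x) 2 (volOmega n)) atTop (𝓝 0) ∧
    Tendsto (fun k => eLpNorm (fun x => ψ k x - v x) 2 (surf n)) atTop (𝓝 0)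

/-- `½ ∫_Ω w |∇u|² dx` for a weight `w ≥ 0`. The weak gradient is unique up to null sets, so the
infimum runs over equal numbers. -/
def dirichlet {n : ℕ} (w : Cyl n → ℝ) (u : Cyl n → ℝ) : ℝ≥0∞ :=
  ⨅ (G : Cyl n → EuclideanSpace ℝ (Fin (n + 1))) (_ : IsWeakGrad u G),
    2⁻¹ * ∫⁻ x, ENNReal.ofReal (w x) * ‖G x‖ₑ ^ 2 ∂(volOmega n)

/-! ### The energies -/

open Classical in
/-- The energy `E_ε(u)` with the conductivity `a_ε(x) = a ε (d(x))`. -/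
def energy {n : ℕ} (a : ℝ → ℝ → ℝ) (ε : ℝ) (u : Cyl n → ℝ) : ℝ≥0∞ :=
  if MemH1loc u then dirichlet (fun x => a ε (bdryDist x)) u else ⊤

open Classical in
/-- The limit energy `E₀(u, v)`. -/
def energy₀ {n : ℕ} (u v : Cyl n → ℝ) : ℝ≥0∞ :=
  if MemH1 u ∧ IsTrace u v then dirichlet (fun _ => 1) u else ⊤

/-- The standing assumptions on `a_ε`, `0 < ε < 1/2`, as functions of the distance
`d ∈ [0, 1/2]` to the boundary: continuity, no zero inside `Ω`, `a_ε → 1` locally uniformly in `Ω`,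
non-degeneracy with exponent `p`, and a uniform upper bound. -/
structure Admissible (p : ℝ) (a : ℝ → ℝ → ℝ) : Prop where
  continuousOn : ∀ ε ∈ Ioo (0 : ℝ) (1 / 2), ContinuousOn (a ε) (Icc 0 (1 / 2))
  ne_zero : ∀ ε ∈ Ioo (0 : ℝ) (1 / 2), ∀ d ∈ Ioc (0 : ℝ) (1 / 2), a ε d ≠ 0
  tendsto_one : TendstoLocallyUniformlyOn a (fun _ => 1) (𝓝[>] 0) (Ioc 0 (1 / 2))
  lower : ∃ c : ℝ, 0 < c ∧ ∀ ε ∈ Ioo (0 : ℝ) (1 / 2), ∀ d ∈ Icc ε (1 / 2), c ≤ a ε d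
  nondegenerate : Tendsto (fun ε : ℝ => (ENNReal.ofReal ε)⁻¹ *
    ∫⁻ s in Ioo 0 ε, (∫⁻ σ in Ioo s ε, ENNReal.ofReal (1 / a ε σ)) ^ p) (𝓝[>] 0) (𝓝 0)
  upper : ∃ C : ℝ, ∀ ε ∈ Ioo (0 : ℝ) (1 / 2), ∀ d ∈ Icc (0 : ℝ) (1 / 2), a ε d ≤ C

/-! ### The spaces `L²_ε(Ω)` and `X₀^κ`, and the immersions -/

open Classical in
/-- The capacity `b_ε`, equal to `1` on `Ω_ε` and to `φ(ε)` on `Ω ∖ Ω_ε`. -/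
def capacity {n : ℕ} (φ : ℝ → ℝ) (ε : ℝ) (x : Cyl n) : ℝ :=
  if ε ≤ bdryDist x then 1 else φ ε

/-- The measure `b_ε dx` on `Ω`. -/
def capMeasure (n : ℕ) (φ : ℝ → ℝ) (ε : ℝ) : Measure (Cyl n) :=
  (volOmega n).withDensity fun x => ENNReal.ofReal (capacity φ ε x)

/-- `L²_ε(Ω)`, with the inner product `∫_Ω b_ε u v dx`. -/
abbrev L2cap (n : ℕ) (φ : ℝ → ℝ) (ε : ℝ) : Type := Lp ℝ 2 (capMeasure n φ ε)

/-- `X₀^κ = L²(Ω) × L²(∂Ω)`, with the inner product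
`∫_Ω u₁ u₂ dx + κ ∫_∂Ω ξ₁ ξ₂ dℋⁿ`. -/
abbrev X₀ (n : ℕ) (κ : ℝ) : Type :=
  WithLp 2 (Lp ℝ 2 (volOmega n) × Lp ℝ 2 (ENNReal.ofReal κ • surf n))

/-- The boundary average `m_ε u` on `∂Ω = 𝕋ⁿ × {0, 1}`. -/
def bdryAvg {n : ℕ} (ε : ℝ) (u : Cyl n → ℝ) (x : Cyl n) : ℝ :=
  if x.2 = 0 then ε⁻¹ * ∫ s in (0 : ℝ)..ε, u (x.1, s)
  else if x.2 = 1 then ε⁻¹ * ∫ s in (1 - ε)..(1 : ℝ), u (x.1, s)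
  else 0

instance (n : ℕ) : IsFiniteMeasure (volOmega n) := by
  unfold volOmega; infer_instance

theorem measurable_bdryDist {n : ℕ} : Measurable (bdryDist (n := n)) :=
  measurable_snd.min (measurable_const.sub measurable_snd)

theorem measurable_capacity {n : ℕ} (φ : ℝ → ℝ) (ε : ℝ) :
    Measurable (capacity (n := n) φ ε) :=
  Measurable.ite (measurableSet_le measurable_const measurable_bdryDist)
    measurable_const measurable_const

/-- As a vector space, `L²_ε(Ω)` is `L²(Ω)`. -/
theorem memLp_capMeasure_iff {n : ℕ} {φ : ℝ → ℝ} {ε : ℝ} (hφ : 0 < φ ε) (u : Cyl n → ℝ) :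
    MemLp u 2 (capMeasure n φ ε) ↔ MemLp u 2 (volOmega n) := by
  have hm : Measurable fun x : Cyl n => ENNReal.ofReal (capacity φ ε x) :=
    (measurable_capacity φ ε).ennreal_ofReal
  have hup : ∀ x : Cyl n, ENNReal.ofReal (capacity φ ε x) ≤ ENNReal.ofReal (max 1 (φ ε)) := by
    intro x
    apply ENNReal.ofReal_le_ofReal
    unfold capacity
    split_ifs
    · exact le_max_left _ _
    · exact le_max_right _ _
  have hlow : ∀ x : Cyl n, ENNReal.ofReal (min 1 (φ ε)) ≤ ENNReal.ofReal (capacity φ ε x) := by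
    intro x
    apply ENNReal.ofReal_le_ofReal
    unfold capacity
    split_ifs
    · exact min_le_left _ _
    · exact min_le_right _ _
  have hpos : ENNReal.ofReal (min 1 (φ ε)) ≠ 0 := by
    simp [hφ]
  constructor
  · intro h
    refine h.of_measure_le_smul (c := (ENNReal.ofReal (min 1 (φ ε)))⁻¹)
      (ENNReal.inv_ne_top.2 hpos) ?_
    have h1 : ENNReal.ofReal (min 1 (φ ε)) • volOmega n ≤ capMeasure n φ ε := by
      rw [← withDensity_const]
      exact withDensity_mono (Eventually.of_forall hlow)
    calc volOmega n
        = (ENNReal.ofReal (min 1 (φ ε)))⁻¹ • (ENNReal.ofReal (min 1 (φ ε)) • volOmega n) := by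
          rw [smul_smul, ENNReal.inv_mul_cancel hpos ENNReal.ofReal_ne_top, one_smul]
      _ ≤ _ := by gcongr
  · intro h
    refine h.of_measure_le_smul (c := ENNReal.ofReal (max 1 (φ ε))) ENNReal.ofReal_ne_top ?_
    rw [← withDensity_const]
    exact withDensity_mono (Eventually.of_forall hup)

theorem memLp_integral_snd {n : ℕ} {ν : Measure ℝ} [IsFiniteMeasure ν] {u : Cyl n → ℝ}
    (hu : MemLp u 2 ((volume : Measure (UnitAddTorus (Fin n))).prod ν)) :
    MemLp (fun y => ∫ s, u (y, s) ∂ν) 2 (volume : Measure (UnitAddTorus (Fin n))) := by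
  have hmeas : AEStronglyMeasurable (fun y => ∫ s, u (y, s) ∂ν)
      (volume : Measure (UnitAddTorus (Fin n))) := hu.1.integral_prod_right'
  refine ⟨hmeas, ?_⟩
  have hsq : ∀ {α : Type} [MeasurableSpace α] (μ : Measure α) (f : α → ℝ),
      eLpNorm f 2 μ ^ 2 = ∫⁻ x, ‖f x‖ₑ ^ 2 ∂μ := by
    intro α _ μ f
    have := eLpNorm_nnreal_pow_eq_lintegral (f := f) (μ := μ) (p := 2) two_ne_zero
    simpa using this
  have hfin : ∫⁻ x, ‖u x‖ₑ ^ 2 ∂((volume : Measure (UnitAddTorus (Fin n))).prod ν) < ⊤ := by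
    rw [← hsq]
    exact ENNReal.pow_lt_top hu.2
  rw [lintegral_prod _ (hu.1.enorm.pow_const 2)] at hfin
  have key : ∫⁻ y, ‖∫ s, u (y, s) ∂ν‖ₑ ^ 2 ∂(volume : Measure (UnitAddTorus (Fin n))) < ⊤ := by
    have hle : ∫⁻ y, ‖∫ s, u (y, s) ∂ν‖ₑ ^ 2 ∂(volume : Measure (UnitAddTorus (Fin n))) ≤
        ∫⁻ y, ν univ * ∫⁻ s, ‖u (y, s)‖ₑ ^ 2 ∂ν ∂(volume : Measure (UnitAddTorus (Fin n))) := by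
      apply lintegral_mono_ae
      filter_upwards [hu.1.prodMk_left] with y hy
      have h1 : ‖∫ s, u (y, s) ∂ν‖ₑ ≤ eLpNorm (fun s => u (y, s)) 1 ν := by
        rw [eLpNorm_one_eq_lintegral_enorm]
        exact enorm_integral_le_lintegral_enorm _
      have h2 := eLpNorm_le_eLpNorm_mul_rpow_measure_univ (p := 1) (q := 2) (by norm_num) hy
      calc ‖∫ s, u (y, s) ∂ν‖ₑ ^ 2
          ≤ (eLpNorm (fun s => u (y, s)) 2 ν *
              ν univ ^ (1 / (1 : ℝ≥0∞).toReal - 1 / (2 : ℝ≥0∞).toReal)) ^ 2 := by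
            gcongr
            exact h1.trans h2
        _ = ν univ * ∫⁻ s, ‖u (y, s)‖ₑ ^ 2 ∂ν := by
            rw [mul_pow, hsq, mul_comm, ← ENNReal.rpow_mul_natCast]
            norm_num
    refine hle.trans_lt ?_
    rw [lintegral_const_mul' _ _ (measure_ne_top ν univ)]
    exact ENNReal.mul_lt_top (measure_lt_top ν univ) hfin
  rw [← hsq] at key
  by_contra hcon
  rw [not_lt, top_le_iff] at hcon
  simp [hcon] at key

theorem memLp_slab {n : ℕ} {u : Cyl n → ℝ} (hu : MemLp u 2 (volOmega n)) {s t : ℝ}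
    (hs : 0 ≤ s) (hst : s ≤ t) (ht : t ≤ 1) :
    MemLp (fun y => ∫ r in s..t, u (y, r)) 2 (volume : Measure (UnitAddTorus (Fin n))) := by
  have h : volume.restrict (Ioo s t) ≤ volume.restrict (Ioo (0 : ℝ) 1) :=
    Measure.restrict_mono (Ioo_subset_Ioo hs ht) le_rfl
  have h' : MemLp u 2 ((volume : Measure (UnitAddTorus (Fin n))).prod
      (volume.restrict (Ioo s t))) := hu.mono_measure (Measure.prod_mono le_rfl h)
  have := memLp_integral_snd h'
  simpa only [intervalIntegral.integral_of_le hst, integral_Ioc_eq_integral_Ioo] using this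

/-- `m_ε` maps `L²(Ω)` to `L²(∂Ω)`. -/
theorem memLp_bdryAvg {n : ℕ} {ε : ℝ} (h0 : 0 < ε) (h1 : ε < 1) {u : Cyl n → ℝ}
    (hu : MemLp u 2 (volOmega n)) (κ : ℝ) :
    MemLp (bdryAvg ε u) 2 (ENNReal.ofReal κ • surf n) := by
  refine MemLp.smul_measure ?_ ENNReal.ofReal_ne_top
  have e : ∀ c : ℝ, MeasurableEmbedding (fun y : UnitAddTorus (Fin n) => (y, c)) :=
    fun c => measurableEmbedding_prod_mk_right c
  have hA : MemLp (bdryAvg ε u) 2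
      ((volume : Measure (UnitAddTorus (Fin n))).prod (Measure.dirac (0 : ℝ))) := by
    rw [Measure.prod_dirac, (e 0).memLp_map_measure_iff]
    have := (memLp_slab hu le_rfl h0.le h1.le).const_mul ε⁻¹
    refine this.congr_norm ?_ ?_
    · refine this.1.congr (Eventually.of_forall fun y => ?_)
      simp [bdryAvg]
    · exact Eventually.of_forall fun y => by simp [bdryAvg]
  have hB : MemLp (bdryAvg ε u) 2
      ((volume : Measure (UnitAddTorus (Fin n))).prod (Measure.dirac (1 : ℝ))) := by
    rw [Measure.prod_dirac, (e 1).memLp_map_measure_iff]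
    have := (memLp_slab hu (s := 1 - ε) (t := 1) (by linarith) (by linarith)
      le_rfl).const_mul ε⁻¹
    refine this.congr_norm ?_ ?_
    · refine this.1.congr (Eventually.of_forall fun y => ?_)
      simp [bdryAvg]
    · exact Eventually.of_forall fun y => by simp [bdryAvg]
  unfold surf
  rw [Measure.prod_add]
  refine ⟨hA.1.add_measure hB.1, ?_⟩
  have hsq : ∀ (μ : Measure (Cyl n)) (f : Cyl n → ℝ),
      eLpNorm f 2 μ ^ 2 = ∫⁻ x, ‖f x‖ₑ ^ 2 ∂μ := by
    intro μ f
    have := eLpNorm_nnreal_pow_eq_lintegral (f := f) (μ := μ) (p := 2) two_ne_zero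
    simpa using this
  have key : eLpNorm (bdryAvg ε u) 2 ((volume : Measure (UnitAddTorus (Fin n))).prod
      (Measure.dirac (0 : ℝ)) + (volume : Measure (UnitAddTorus (Fin n))).prod
      (Measure.dirac (1 : ℝ))) ^ 2 < ⊤ := by
    rw [hsq, lintegral_add_measure, ← hsq, ← hsq]
    exact ENNReal.add_lt_top.2 ⟨ENNReal.pow_lt_top hA.2, ENNReal.pow_lt_top hB.2⟩
  by_contra hcon
  rw [not_lt, top_le_iff] at hcon
  simp [hcon] at key

/-- The range `(0, 1/2)` of the parameter `ε`. -/
abbrev Param : Type := Ioo (0 : ℝ) (1 / 2)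

/-- The limit `ε ↓ 0`. -/
def toZero : Filter Param := comap Subtype.val (𝓝[>] (0 : ℝ))

/-- The immersion `ι_ε u = (u, m_ε u)` of `L²_ε(Ω)` into `X₀^κ`. -/
def immersion (n : ℕ) (κ : ℝ) (φ : ℝ → ℝ) (hφ : ∀ ε ∈ Ioo (0 : ℝ) (1 / 2), 0 < φ ε)
    (ε : Param) (u : L2cap n φ ε) : X₀ n κ :=
  have hu : MemLp u 2 (volOmega n) := (memLp_capMeasure_iff (hφ ε ε.2) _).1 (Lp.memLp u)
  WithLp.toLp 2 (hu.toLp u,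
    (memLp_bdryAvg ε.2.1 (ε.2.2.trans (by norm_num)) hu κ).toLp (bdryAvg ε u))

/-- `E_ε` Γ-converges to `E₀` with respect to the maps `ι_ε : X_ε → X₀`, as `ε ↓ 0`. -/
structure GammaConverges {X : Param → Type*} {Y : Type*} [TopologicalSpace Y]
    (E : ∀ ε, X ε → ℝ≥0∞) (E₀ : Y → ℝ≥0∞) (ι : ∀ ε, X ε → Y) : Prop where
  le_liminf : ∀ (u : ∀ ε, X ε) (w : Y), Tendsto (fun ε => ι ε (u ε)) toZero (𝓝 w) →
    E₀ w ≤ liminf (fun ε => E ε (u ε)) toZero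
  recovery : ∀ w : Y, ∃ u : ∀ ε, X ε,
    Tendsto (fun ε => E ε (u ε)) toZero (𝓝 (E₀ w)) ∧ Tendsto (fun ε => ι ε (u ε)) toZero (𝓝 w)

end ThinLayer

end

noncomputable section

namespace ThinLayer

/-! ### Inequalities for `L²` norms -/

/-! The only real issue is the boundary value of the limit: the conductivity may degenerate at `∂Ω`,
and yet the layer averages `m_ε u^ε` must converge to the trace of the limit. On a vertical line,
the fundamental theorem of calculus and Cauchy–Schwarz give `|f s - f ε| ≤ (∫_s^ε 1/a_ε)^(1/2) (∫
a_ε |f'|²)^(1/2)` (`enorm_sub_le_resist`). Averaging over `s ∈ (0, ε)` produces exactly the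
nondegeneracy quantity with `p = 1/2`, and `p = 1` reduces to it by Cauchy–Schwarz
(`Admissible.tendsto_resist`). So under bounded energy `m_ε u^ε` differs from the value at height
`ε` by `o(1)` in `L²`. Above height `ε` the conductivity is at least `c`, so that value differs from
the average over `(ε, δ)` by `O(δ^(1/2))`. In the limit, the average of `u₀` over `(0, δ)` is within
`M δ^(1/2)` of `v` (`Admissible.exists_trace_bound`). This forces the boundary values of any `C¹`
sequence converging to `u₀` in `H¹` to converge to `v` (`tendsto_trace`).

For the lower bound on the energy, `√a_ε ∇u^ε` is bounded in `L²(Ω)` and has a weak limit `H` along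
an ultrafilter. Test functions live where `a_ε → 1` uniformly, so `H` is the weak gradient of `u₀`,
and the norm is weakly lower semicontinuous (`Admissible.exists_weakGrad_limit`).

For the recovery sequence, if `E₀(u₀, v) < ∞` or merely `(u₀, v)` is in the domain, the constant
sequence `u₀` works, by dominated convergence and the bound on `a_ε`. Outside the domain the limit
energy is infinite, and the lower bound already makes the energies diverge along any sequence whose
images converge; one is obtained by overwriting `u₀` by `v` in the layer (`exists_tendsto_bdryAvg`).

Pointwise arguments are made for `C¹` functions and transferred by mollification on the cylinder
(`normalApprox_of_isWeakGrad`, `exists_contDiff_approx`). The component `x_N = 1` is reduced to `x_N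
= 0` by reflection. -/

theorem lintegral_mul_sq_le {α : Type*} [MeasurableSpace α] {μ : Measure α} {f g : α → ℝ≥0∞}
    (hf : AEMeasurable f μ) (hg : AEMeasurable g μ) :
    (∫⁻ x, f x * g x ∂μ) ^ 2 ≤ (∫⁻ x, f x ^ 2 ∂μ) * ∫⁻ x, g x ^ 2 ∂μ := by
  have h := ENNReal.lintegral_mul_le_Lp_mul_Lq μ Real.HolderConjugate.two_two hf hg
  simp only [Pi.mul_apply, ENNReal.rpow_two] at h
  calc _ ≤ ((∫⁻ x, f x ^ 2 ∂μ) ^ (1 / 2 : ℝ) * (∫⁻ x, g x ^ 2 ∂μ) ^ (1 / 2 : ℝ)) ^ 2 := by gcongr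
    _ = _ := by
      rw [mul_pow, ← ENNReal.rpow_mul_natCast, ← ENNReal.rpow_mul_natCast]; norm_num

theorem sqrt_sq (x : ℝ≥0∞) : (x ^ (1 / 2 : ℝ)) ^ 2 = x := by
  rw [← ENNReal.rpow_mul_natCast]; norm_num

theorem le_of_sq_le_sq {x y : ℝ≥0∞} (h : x ^ 2 ≤ y ^ 2) : x ≤ y :=
  (ENNReal.pow_le_pow_left_iff two_ne_zero).1 h

theorem eLpNorm_two_sq {α F : Type*} [MeasurableSpace α] [NormedAddCommGroup F]
    (μ : Measure α) (f : α → F) : eLpNorm f 2 μ ^ 2 = ∫⁻ x, ‖f x‖ₑ ^ 2 ∂μ := by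
  have := eLpNorm_nnreal_pow_eq_lintegral (f := f) (μ := μ) (p := 2) two_ne_zero
  simpa using this

theorem eLpNorm_two_le {α F : Type*} [MeasurableSpace α] [NormedAddCommGroup F]
    {μ : Measure α} {f : α → F} {C : ℝ≥0∞} (h : ∫⁻ x, ‖f x‖ₑ ^ 2 ∂μ ≤ C ^ 2) :
    eLpNorm f 2 μ ≤ C :=
  le_of_sq_le_sq ((eLpNorm_two_sq μ f).trans_le h)

/-! ### The covering map -/

instance (n : ℕ) : IsProbabilityMeasure (volume : Measure (UnitAddTorus (Fin n))) :=
  ⟨by rw [volume_pi, Measure.pi_univ]; simp⟩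

instance (n : ℕ) : (volume : Measure (Cyl n)).IsAddHaarMeasure :=
  Measure.prod.instIsAddHaarMeasure (volume : Measure (Fin n → UnitAddCircle))
    (volume : Measure ℝ)

instance (n : ℕ) : SFinite (volume : Measure (Cyl n)) :=
  inferInstanceAs (SFinite ((volume : Measure (UnitAddTorus (Fin n))).prod (volume : Measure ℝ)))

theorem volOmega_eq_restrict (n : ℕ) :
    volOmega n = (volume : Measure (Cyl n)).restrict (Omega n) := by
  rw [volOmega, Omega, Measure.volume_eq_prod, ← Measure.prod_restrict, Measure.restrict_univ]

theorem isOpen_Omega (n : ℕ) : IsOpen (Omega n) := isOpen_univ.prod isOpen_Ioo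

theorem ae_mem_Omega (n : ℕ) : ∀ᵐ x ∂(volOmega n), x ∈ Omega n := by
  rw [volOmega_eq_restrict]
  exact ae_restrict_mem (isOpen_Omega n).measurableSet

theorem measurableSet_innerDomain (n : ℕ) (δ : ℝ) : MeasurableSet (innerDomain n δ) :=
  (isOpen_Omega n).measurableSet.inter (measurableSet_le measurable_const measurable_bdryDist)

theorem cover_add {n : ℕ} (x y : EuclideanSpace ℝ (Fin (n + 1))) :
    cover n (x + y) = cover n x + cover n y := by
  refine Prod.ext (funext fun i => ?_) rfl
  simp [cover]

theorem cover_zero (n : ℕ) : cover n 0 = 0 := by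
  refine Prod.ext (funext fun i => ?_) rfl
  simp [cover]

theorem cover_neg {n : ℕ} (x : EuclideanSpace ℝ (Fin (n + 1))) :
    cover n (-x) = -cover n x := by
  refine Prod.ext (funext fun i => ?_) rfl
  simp [cover]

/-- After splitting off the last coordinate, this is a product of the quotient maps `ℝ → ℝ/ℤ` and
the identity. It lets continuity be checked on the covering space and every point be lifted. -/
theorem isOpenQuotientMap_cover (n : ℕ) : IsOpenQuotientMap (cover n) := by
  have h1 : IsOpenQuotientMap
      (Prod.map (Pi.map fun (_ : Fin n) (t : ℝ) => (t : UnitAddCircle)) (id : ℝ → ℝ)) :=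
    (IsOpenQuotientMap.piMap fun _ => QuotientAddGroup.isOpenQuotientMap_mk).prodMap .id
  let e : EuclideanSpace ℝ (Fin (n + 1)) ≃ₜ (Fin n → ℝ) × ℝ :=
    { toFun := fun y => (fun i => y i.castSucc, y (Fin.last n))
      invFun := fun z => WithLp.toLp 2 (Fin.snoc z.1 z.2)
      left_inv := fun y => by
        ext i
        refine Fin.lastCases ?_ (fun i => ?_) i <;> simp
      right_inv := fun z => by simp
      continuous_toFun := by fun_prop
      continuous_invFun := by
        refine (PiLp.continuous_toLp 2 _).comp (continuous_pi fun i => ?_)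
        refine Fin.lastCases ?_ (fun i => ?_) i
        · simpa using continuous_snd
        · simpa [Function.comp_def] using (continuous_apply i).comp continuous_fst }
  exact h1.comp e.isOpenQuotientMap

theorem continuous_of_comp_cover {n : ℕ} {Y : Type*} [TopologicalSpace Y] {f : Cyl n → Y}
    (h : Continuous (f ∘ cover n)) : Continuous f :=
  (isOpenQuotientMap_cover n).isQuotientMap.continuous_iff.2 h

theorem cover_smul_last {n : ℕ} (t : ℝ) :
    cover n (EuclideanSpace.single (Fin.last n) t) = (0, t) := by
  refine Prod.ext (funext fun i => ?_) ?_
  · simp [cover, Fin.castSucc_ne_last]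
  · simp [cover]

/-! ### Functions of class `C¹` on the cylinder -/

section ContDiffOne

variable {n : ℕ} {ψ : Cyl n → ℝ}

theorem hasDerivAt_cover (h : ContDiff ℝ 1 (ψ ∘ cover n)) (i : Fin (n + 1))
    (y : EuclideanSpace ℝ (Fin (n + 1))) (t : ℝ) :
    HasDerivAt (fun t : ℝ => ψ (cover n y + cover n (EuclideanSpace.single i t)))
      (fderiv ℝ (ψ ∘ cover n) (y + EuclideanSpace.single i t) (EuclideanSpace.single i 1)) t := by
  have h1 : HasFDerivAt (ψ ∘ cover n)
      (fderiv ℝ (ψ ∘ cover n) (y + EuclideanSpace.single i t)) (y + EuclideanSpace.single i t) :=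
    ((h.differentiable (by norm_num)) _).hasFDerivAt
  have h2 : HasDerivAt (fun t : ℝ => y + EuclideanSpace.single i t)
      (EuclideanSpace.single i (1 : ℝ)) t := by
    have : (fun t : ℝ => y + EuclideanSpace.single i t) =
        fun t : ℝ => y + t • EuclideanSpace.single i (1 : ℝ) := by
      funext t
      ext j
      by_cases hj : j = i <;> simp [hj]
    rw [this]
    simpa using ((hasDerivAt_id t).smul_const (EuclideanSpace.single i (1 : ℝ))).const_add y
  have := h1.comp_hasDerivAt t h2
  refine this.congr_of_eventuallyEq (Eventually.of_forall fun s => ?_)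
  simp [cover_add]

theorem pderiv_cover (h : ContDiff ℝ 1 (ψ ∘ cover n)) (i : Fin (n + 1))
    (y : EuclideanSpace ℝ (Fin (n + 1))) :
    pderiv i ψ (cover n y) = fderiv ℝ (ψ ∘ cover n) y (EuclideanSpace.single i 1) := by
  have := (hasDerivAt_cover h i y 0).deriv
  rw [pderiv, this]
  congr 2
  ext j
  simp

theorem continuous_of_contDiff (h : ContDiff ℝ 1 (ψ ∘ cover n)) : Continuous ψ :=
  continuous_of_comp_cover h.continuous

theorem continuous_pderiv (h : ContDiff ℝ 1 (ψ ∘ cover n)) (i : Fin (n + 1)) :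
    Continuous (pderiv i ψ) := by
  apply continuous_of_comp_cover
  have : pderiv i ψ ∘ cover n =
      fun y => fderiv ℝ (ψ ∘ cover n) y (EuclideanSpace.single i 1) := by
    funext y
    exact pderiv_cover h i y
  rw [this]
  exact (h.continuous_fderiv (by norm_num)).clm_apply continuous_const

theorem continuous_grad (h : ContDiff ℝ 1 (ψ ∘ cover n)) : Continuous (grad ψ) :=
  (PiLp.continuous_toLp 2 _).comp (continuous_pi fun i => continuous_pderiv h i)

/-- Differentiability along vertical lines is all the calculus that the layer estimates need; it
follows by lifting the base point and shifting the parameter by `s`. -/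
theorem hasDerivAt_snd (h : ContDiff ℝ 1 (ψ ∘ cover n)) (y : UnitAddTorus (Fin n)) (s : ℝ) :
    HasDerivAt (fun s => ψ (y, s)) (pderiv (Fin.last n) ψ (y, s)) s := by
  obtain ⟨ξ, hξ⟩ := (isOpenQuotientMap_cover n).surjective (y, s)
  have h1 := hasDerivAt_cover h (Fin.last n) ξ 0
  have e0 : ξ + EuclideanSpace.single (Fin.last n) 0 = ξ := by ext j; simp
  rw [e0, ← pderiv_cover h, hξ] at h1
  have h2 := HasDerivAt.scomp_of_eq s h1 ((hasDerivAt_id s).sub_const s) (by simp)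
  simp only [one_smul] at h2
  refine h2.congr_of_eventuallyEq (Eventually.of_forall fun t => ?_)
  simp [cover_smul_last]

end ContDiffOne

/-! ### Averages over layers -/

/-- The average of `f (y, ·)` over `(c, d)`. -/
def avg {n : ℕ} (c d : ℝ) (f : Cyl n → ℝ) (y : UnitAddTorus (Fin n)) : ℝ :=
  (d - c)⁻¹ * ∫ s in c..d, f (y, s)

/-- The slab `𝕋ⁿ × (c, d)` with the measure `W(s) dx' ds`. -/
def slab (n : ℕ) (c d : ℝ) (W : ℝ → ℝ≥0∞) : Measure (Cyl n) :=
  (volume : Measure (UnitAddTorus (Fin n))).prod ((volume.restrict (Ioo c d)).withDensity W)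

theorem slab_one (n : ℕ) (c d : ℝ) : slab n c d 1 =
    (volume : Measure (UnitAddTorus (Fin n))).prod (volume.restrict (Ioo c d)) := by
  rw [slab, withDensity_one]

/-- The resistance `∫ W⁻¹` of the interval between `s` and `p`. -/
def resist (W : ℝ → ℝ≥0∞) (p s : ℝ) : ℝ≥0∞ :=
  ∫⁻ σ in Ioo (min s p) (max s p), (W σ)⁻¹

/-- Cauchy–Schwarz for `|f'| = W^(-1/2) · W^(1/2) |f'|`. The points `s` and `p` may come in either
order, which explains the `min` and `max` in `resist`. -/
theorem enorm_sub_le_resist {f f' : ℝ → ℝ} (hf : ∀ s, HasDerivAt f (f' s) s)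
    (hc : Continuous f') {c d s p : ℝ} (hs : s ∈ Icc c d) (hp : p ∈ Icc c d) {W : ℝ → ℝ≥0∞}
    (hW : AEMeasurable W (volume.restrict (Ioo c d))) (hW0 : ∀ σ ∈ Ioo c d, W σ ≠ 0)
    (hWt : ∀ σ ∈ Ioo c d, W σ ≠ ⊤) :
    ‖f s - f p‖ₑ ≤ resist W p s ^ (1 / 2 : ℝ) *
      (∫⁻ σ in Ioo c d, W σ * ‖f' σ‖ₑ ^ 2) ^ (1 / 2 : ℝ) := by
  have hsub : Ioo (min s p) (max s p) ⊆ Ioo c d :=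
    Ioo_subset_Ioo (le_min hs.1 hp.1) (max_le hs.2 hp.2)
  have h1 : ‖f s - f p‖ₑ ≤ ∫⁻ σ in Ioo (min s p) (max s p), ‖f' σ‖ₑ := by
    rw [← intervalIntegral.integral_eq_sub_of_hasDerivAt (fun x _ => hf x)
      (hc.intervalIntegrable _ _)]
    rw [← ofReal_norm, intervalIntegral.norm_intervalIntegral_eq, ofReal_norm]
    refine (enorm_integral_le_lintegral_enorm _).trans ?_
    rw [uIoc, min_comm, max_comm, restrict_Ioo_eq_restrict_Ioc]
  have hW' := hW.mono_measure (Measure.restrict_mono hsub le_rfl)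
  have h2 : ∫⁻ σ in Ioo (min s p) (max s p), ‖f' σ‖ₑ =
      ∫⁻ σ in Ioo (min s p) (max s p),
        ((W σ)⁻¹ ^ (1 / 2 : ℝ)) * ((W σ ^ (1 / 2 : ℝ)) * ‖f' σ‖ₑ) := by
    refine setLIntegral_congr_fun measurableSet_Ioo fun σ hσ => ?_
    rw [← mul_assoc, ENNReal.inv_rpow, ENNReal.inv_mul_cancel, one_mul]
    · simp [hW0 σ (hsub hσ)]
    · simp [hWt σ (hsub hσ)]
  apply le_of_sq_le_sq
  rw [mul_pow, sqrt_sq, sqrt_sq]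
  calc ‖f s - f p‖ₑ ^ 2 ≤ (∫⁻ σ in Ioo (min s p) (max s p),
        ((W σ)⁻¹ ^ (1 / 2 : ℝ)) * ((W σ ^ (1 / 2 : ℝ)) * ‖f' σ‖ₑ)) ^ 2 := by
        rw [← h2]; gcongr
    _ ≤ _ := lintegral_mul_sq_le (hW'.inv.pow_const _)
        ((hW'.pow_const _).mul hc.enorm.measurable.aemeasurable)
    _ ≤ _ := by
        simp only [mul_pow, sqrt_sq]
        unfold resist
        gcongr

/-- The average of a `C¹` function over `(c, d)` is close to its value at `p`, with a weight. -/
theorem eLpNorm_avg_sub_le {n : ℕ} {ψ : Cyl n → ℝ} (hψ : ContDiff ℝ 1 (ψ ∘ cover n))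
    {c d p : ℝ} (hcd : c < d) (hp : p ∈ Icc c d) {W : ℝ → ℝ≥0∞}
    (hW : AEMeasurable W (volume.restrict (Ioo c d))) (hW0 : ∀ σ ∈ Ioo c d, W σ ≠ 0)
    {C : ℝ≥0∞} (hC : C ≠ ⊤) (hWC : ∀ σ ∈ Ioo c d, W σ ≤ C) :
    eLpNorm (fun y => avg c d ψ y - ψ (y, p)) 2 (volume : Measure (UnitAddTorus (Fin n))) ≤
      (ENNReal.ofReal (d - c))⁻¹ * (∫⁻ s in Ioo c d, resist W p s ^ (1 / 2 : ℝ)) *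
        eLpNorm (pderiv (Fin.last n) ψ) 2 (slab n c d W) := by
  have hcont := continuous_of_contDiff hψ
  have hpd := continuous_pderiv hψ (Fin.last n)
  set B := (ENNReal.ofReal (d - c))⁻¹ * (∫⁻ s in Ioo c d, resist W p s ^ (1 / 2 : ℝ)) with hB
  have hdc : 0 < d - c := sub_pos.2 hcd
  have key : ∀ y, ‖avg c d ψ y - ψ (y, p)‖ₑ ^ 2 ≤
      B ^ 2 * ∫⁻ σ in Ioo c d, W σ * ‖pderiv (Fin.last n) ψ (y, σ)‖ₑ ^ 2 := by
    intro y
    set D := ∫⁻ σ in Ioo c d, W σ * ‖pderiv (Fin.last n) ψ (y, σ)‖ₑ ^ 2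
    have hi : ∀ {a b : ℝ}, IntervalIntegrable (fun s => ψ (y, s)) volume a b :=
      (hcont.comp (by fun_prop : Continuous fun s : ℝ => (y, s))).intervalIntegrable _ _
    have e1 : avg c d ψ y - ψ (y, p) = (d - c)⁻¹ * ∫ s in c..d, (ψ (y, s) - ψ (y, p)) := by
      rw [intervalIntegral.integral_sub hi intervalIntegrable_const, mul_sub, avg]
      simp [hdc.ne']
    have e2 : ‖avg c d ψ y - ψ (y, p)‖ₑ ≤ B * D ^ (1 / 2 : ℝ) := by
      rw [e1, enorm_mul, enorm_inv hdc.ne', Real.enorm_eq_ofReal hdc.le, hB, mul_assoc]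
      gcongr
      rw [intervalIntegral.integral_of_le hcd.le, integral_Ioc_eq_integral_Ioo]
      refine (enorm_integral_le_lintegral_enorm _).trans ?_
      -- Boundedness of `W` makes the energy of each fibre finite, so that its square root can be
      -- taken out of the integral in `s`.
      have hD : D ≠ ⊤ := by
        obtain ⟨K, hK⟩ := (isCompact_Icc (a := c) (b := d)).exists_bound_of_continuousOn
          (hpd.comp (by fun_prop : Continuous fun s : ℝ => (y, s))).continuousOn
        refine ne_top_of_le_ne_top (b := C * ENNReal.ofReal K ^ 2 * volume (Ioo c d)) ?_ ?_
        · simp [ENNReal.mul_eq_top, hC]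
        · rw [← setLIntegral_const]
          refine setLIntegral_mono' measurableSet_Ioo fun s hs => ?_
          gcongr
          · exact hWC s hs
          · rw [← ofReal_norm]
            exact ENNReal.ofReal_le_ofReal (hK s (Ioo_subset_Icc_self hs))
      rw [← lintegral_mul_const' _ _ (by simp [hD])]
      refine setLIntegral_mono' measurableSet_Ioo fun s hs => ?_
      exact enorm_sub_le_resist (hasDerivAt_snd hψ y)
        (hpd.comp (by fun_prop : Continuous fun s : ℝ => (y, s))) (Ioo_subset_Icc_self hs) hp
        hW hW0 fun σ hσ => ne_top_of_le_ne_top hC (hWC σ hσ)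
    calc _ ≤ (B * D ^ (1 / 2 : ℝ)) ^ 2 := by gcongr
      _ = _ := by rw [mul_pow, sqrt_sq]
  apply eLpNorm_two_le
  rw [mul_pow, eLpNorm_two_sq]
  have hm : Measurable fun x : Cyl n => ‖pderiv (Fin.last n) ψ x‖ₑ ^ 2 :=
    hpd.enorm.measurable.pow_const 2
  rw [slab, lintegral_prod _ hm.aemeasurable,
    ← lintegral_const_mul _ hm.lintegral_prod_right']
  refine lintegral_mono fun y => (key y).trans_eq ?_
  rw [lintegral_withDensity_eq_lintegral_mul₀ hW
    (g := fun σ => ‖pderiv (Fin.last n) ψ (y, σ)‖ₑ ^ 2)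
    (hm.comp measurable_prodMk_left).aemeasurable]
  rfl

/-- For `W = 1` the resistance between two points of `[c, d]` is at most `d - c`. -/
theorem eLpNorm_avg_sub_le_one {n : ℕ} {ψ : Cyl n → ℝ} (hψ : ContDiff ℝ 1 (ψ ∘ cover n))
    {c d p : ℝ} (hcd : c < d) (hp : p ∈ Icc c d) :
    eLpNorm (fun y => avg c d ψ y - ψ (y, p)) 2 (volume : Measure (UnitAddTorus (Fin n))) ≤
      ENNReal.ofReal (d - c) ^ (1 / 2 : ℝ) *
        eLpNorm (pderiv (Fin.last n) ψ) 2 (slab n c d 1) := by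
  refine (eLpNorm_avg_sub_le hψ hcd hp (W := 1) aemeasurable_const (by simp)
    ENNReal.one_ne_top (by simp)).trans ?_
  gcongr
  have h0 : ENNReal.ofReal (d - c) ≠ 0 := by simpa using hcd
  rw [ENNReal.inv_mul_le_iff h0 ENNReal.ofReal_ne_top, mul_comm, ← Real.volume_Ioo,
    ← setLIntegral_const]
  refine setLIntegral_mono' measurableSet_Ioo fun s hs => ?_
  gcongr
  simp only [resist, Pi.one_apply, inv_one, setLIntegral_one]
  exact measure_mono (Ioo_subset_Ioo (le_min hs.1.le hp.1) (max_le hs.2.le hp.2))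

section avg

variable {n : ℕ} {c d : ℝ} {f g : Cyl n → ℝ}

theorem slab_one_le {c' d' : ℝ} (hc : c' ≤ c) (hd : d ≤ d') :
    slab n c d 1 ≤ slab n c' d' 1 := by
  rw [slab_one, slab_one]
  exact Measure.prod_mono le_rfl (Measure.restrict_mono (Ioo_subset_Ioo hc hd) le_rfl)

theorem volOmega_eq_slab (n : ℕ) : volOmega n = slab n 0 1 1 := by rw [slab_one, volOmega]

theorem slab_one_le_volOmega (hc : 0 ≤ c) (hd : d ≤ 1) : slab n c d 1 ≤ volOmega n := by
  rw [volOmega_eq_slab]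
  exact slab_one_le hc hd

instance : IsFiniteMeasure (slab n c d 1) := by rw [slab_one]; infer_instance

theorem avg_eq (hcd : c ≤ d) (y : UnitAddTorus (Fin n)) :
    avg c d f y = (d - c)⁻¹ * ∫ s in Ioo c d, f (y, s) := by
  rw [avg, intervalIntegral.integral_of_le hcd, integral_Ioc_eq_integral_Ioo]

theorem aestronglyMeasurable_avg (hcd : c ≤ d) (hf : AEStronglyMeasurable f (slab n c d 1)) :
    AEStronglyMeasurable (avg c d f) (volume : Measure (UnitAddTorus (Fin n))) := by
  rw [slab_one] at hf
  rw [show avg c d f = fun y => (d - c)⁻¹ * ∫ s in Ioo c d, f (y, s) from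
    funext fun y => avg_eq hcd y]
  exact hf.integral_prod_right'.const_mul _

/-- Cauchy–Schwarz on each fibre. The factor blows up as the slab gets thin, so `L²` convergence
alone controls averages only over slabs of fixed width. -/
theorem eLpNorm_avg_le (hcd : c < d) (hf : AEStronglyMeasurable f (slab n c d 1)) :
    eLpNorm (avg c d f) 2 (volume : Measure (UnitAddTorus (Fin n))) ≤
      (ENNReal.ofReal (d - c))⁻¹ ^ (1 / 2 : ℝ) * eLpNorm f 2 (slab n c d 1) := by
  have hdc : 0 < d - c := sub_pos.2 hcd
  have h0 : ENNReal.ofReal (d - c) ≠ 0 := by simpa using hcd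
  rw [slab_one] at *
  apply eLpNorm_two_le
  rw [mul_pow, eLpNorm_two_sq, sqrt_sq, lintegral_prod _ (hf.enorm.pow_const 2),
    ← lintegral_const_mul'' _ (hf.enorm.pow_const 2).lintegral_prod_right']
  refine lintegral_mono_ae ?_
  filter_upwards [hf.prodMk_left] with y hy
  rw [avg_eq hcd.le, enorm_mul, enorm_inv hdc.ne', Real.enorm_eq_ofReal hdc.le, mul_pow, sq,
    mul_assoc]
  gcongr
  rw [ENNReal.inv_mul_le_iff h0 ENNReal.ofReal_ne_top]
  have := lintegral_mul_sq_le (μ := volume.restrict (Ioo c d)) (f := 1)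
    (g := fun s => ‖f (y, s)‖ₑ) aemeasurable_const hy.enorm
  simp only [Pi.one_apply, one_mul, one_pow, lintegral_one, Measure.restrict_apply_univ,
    Real.volume_Ioo] at this
  refine le_trans ?_ this
  gcongr
  exact enorm_integral_le_lintegral_enorm _

theorem avg_sub_ae (hcd : c ≤ d) (hf : Integrable f (slab n c d 1))
    (hg : Integrable g (slab n c d 1)) :
    avg c d (fun x => f x - g x) =ᵐ[volume] fun y => avg c d f y - avg c d g y := by
  rw [slab_one] at hf hg
  filter_upwards [hf.prod_right_ae, hg.prod_right_ae] with y h1 h2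
  rw [avg_eq hcd, avg_eq hcd, avg_eq hcd, integral_sub h1 h2, mul_sub]

end avg

/-! ### Reflection -/

/-- The reflection `(x', s) ↦ (x', 1 - s)`. -/
def reflect {n : ℕ} (x : Cyl n) : Cyl n := (x.1, 1 - x.2)

theorem bdryDist_reflect {n : ℕ} (x : Cyl n) : bdryDist (reflect x) = bdryDist x := by
  simp [reflect, bdryDist, min_comm]

theorem measurePreserving_one_sub :
    MeasurePreserving (fun s : ℝ => 1 - s) (volume.restrict (Ioo 0 1))
      (volume.restrict (Ioo 0 1)) := by
  have h := (Measure.measurePreserving_sub_left (volume : Measure ℝ) 1).restrict_preimage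
    (measurableSet_Ioo (a := (0 : ℝ)) (b := 1))
  have e : (fun s : ℝ => 1 - s) ⁻¹' Ioo 0 1 = Ioo 0 1 := by
    ext s
    simp
  rwa [e] at h

theorem measurePreserving_reflect (n : ℕ) :
    MeasurePreserving (reflect (n := n)) (volOmega n) (volOmega n) :=
  (MeasurePreserving.id _).prod measurePreserving_one_sub

theorem contDiff_reflect {n : ℕ} {ψ : Cyl n → ℝ} (hψ : ContDiff ℝ 1 (ψ ∘ cover n)) :
    ContDiff ℝ 1 ((ψ ∘ reflect) ∘ cover n) := by
  have : (ψ ∘ reflect) ∘ cover n = (ψ ∘ cover n) ∘ fun y =>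
      y + EuclideanSpace.single (Fin.last n) (1 - 2 * y (Fin.last n)) := by
    funext y
    simp only [Function.comp_apply, cover_add, cover_smul_last, reflect]
    congr 1
    refine Prod.ext (by simp) ?_
    simp [cover]
    ring
  rw [this]
  have h2 : (fun y : EuclideanSpace ℝ (Fin (n + 1)) =>
      y + EuclideanSpace.single (Fin.last n) (1 - 2 * y (Fin.last n))) =
      fun y => y + (1 - 2 * y (Fin.last n)) • EuclideanSpace.single (Fin.last n) (1 : ℝ) := by
    funext y
    ext j
    by_cases hj : j = Fin.last n <;> simp [hj]
  rw [h2]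
  exact hψ.comp (by fun_prop)

theorem pderiv_last_reflect {n : ℕ} {ψ : Cyl n → ℝ} (hψ : ContDiff ℝ 1 (ψ ∘ cover n))
    (x : Cyl n) :
    pderiv (Fin.last n) (ψ ∘ reflect) x = -pderiv (Fin.last n) ψ (reflect x) := by
  have h1 := hasDerivAt_snd (contDiff_reflect hψ) x.1 x.2
  have h2 := (hasDerivAt_snd hψ x.1 (1 - x.2)).scomp x.2 ((hasDerivAt_id x.2).const_sub 1)
  simpa [reflect] using h1.unique h2

variable {n : ℕ}

/-! ### Derivatives on the cylinder -/

/-- The derivative of a function on the cylinder. -/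
def cderiv (ψ : Cyl n → ℝ) (x : Cyl n) : EuclideanSpace ℝ (Fin (n + 1)) →L[ℝ] ℝ :=
  fderiv ℝ (fun h => ψ (x + cover n h)) 0

theorem cderiv_cover (ψ : Cyl n → ℝ) (y : EuclideanSpace ℝ (Fin (n + 1))) :
    cderiv ψ (cover n y) = fderiv ℝ (ψ ∘ cover n) y := by
  have : (fun h => ψ (cover n y + cover n h)) = fun h => (ψ ∘ cover n) (y + h) := by
    funext h
    simp [cover_add]
  rw [cderiv, this, fderiv_comp_add_left, add_zero]

theorem pderiv_eq_cderiv {ψ : Cyl n → ℝ} (h : ContDiff ℝ 1 (ψ ∘ cover n)) (i : Fin (n + 1))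
    (x : Cyl n) : pderiv i ψ x = cderiv ψ x (EuclideanSpace.single i 1) := by
  obtain ⟨y, rfl⟩ := (isOpenQuotientMap_cover n).surjective x
  rw [pderiv_cover h, cderiv_cover]

theorem continuous_cderiv {ψ : Cyl n → ℝ} (h : ContDiff ℝ 1 (ψ ∘ cover n)) :
    Continuous (cderiv ψ) := by
  apply continuous_of_comp_cover
  rw [show cderiv ψ ∘ cover n = fderiv ℝ (ψ ∘ cover n) from funext (cderiv_cover ψ)]
  exact h.continuous_fderiv (by norm_num)

theorem continuous_cover (n : ℕ) : Continuous (cover n) := (isOpenQuotientMap_cover n).continuous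

theorem hasCompactSupport_cderiv {ψ : Cyl n → ℝ} (h : HasCompactSupport ψ) :
    HasCompactSupport (cderiv ψ) := by
  refine HasCompactSupport.of_support_subset_isCompact h fun x hx => ?_
  by_contra hxs
  refine hx ?_
  have h1 : ψ =ᶠ[𝓝 x] 0 := notMem_tsupport_iff_eventuallyEq.1 hxs
  have h2 : Tendsto (fun h => x + cover n h) (𝓝 0) (𝓝 x) := by
    have := ((continuous_cover n).const_add x).tendsto 0
    simpa [cover_zero] using this
  have h3 : (fun h => ψ (x + cover n h)) =ᶠ[𝓝 0] fun _ => (0 : ℝ) := h2.eventually h1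
  rw [cderiv, h3.fderiv_eq]
  simp

/-- A lift of `z` turns the translation into one upstairs; the derivative is written with `cderiv`
on the cylinder, so the choice of the lift drops out. -/
theorem hasFDerivAt_translate {ψ : Cyl n → ℝ} (h : ContDiff ℝ 1 (ψ ∘ cover n)) (z : Cyl n)
    (y : EuclideanSpace ℝ (Fin (n + 1))) :
    HasFDerivAt (fun y => ψ (cover n y - z)) (cderiv ψ (cover n y - z)) y := by
  obtain ⟨ζ, rfl⟩ := (isOpenQuotientMap_cover n).surjective z
  have e : ∀ y, cover n y - cover n ζ = cover n (y - ζ) := fun y => by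
    rw [sub_eq_add_neg, sub_eq_add_neg, cover_add, cover_neg]
  simp only [e, cderiv_cover]
  have := ((h.differentiable (by norm_num)) (y - ζ)).hasFDerivAt.comp y
    ((hasFDerivAt_id y).sub_const ζ)
  rw [ContinuousLinearMap.comp_id] at this
  exact this

/-! ### Convolution -/

/-- The convolution of `ρ` and `f`. -/
def conv (ρ f : Cyl n → ℝ) (x : Cyl n) : ℝ := ∫ z, ρ (x - z) * f z

section conv

variable {ρ f : Cyl n → ℝ}

theorem exists_bound_of_compact {F : Type*} [NormedAddCommGroup F] {g : Cyl n → F}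
    (hg : Continuous g) (hs : HasCompactSupport g) : ∃ C, ∀ x, ‖g x‖ ≤ C :=
  hg.bounded_above_of_compact_support hs

theorem integrable_bounded_mul {F : Type*} [NormedAddCommGroup F] [NormedSpace ℝ F]
    {g : Cyl n → F} (hg : Continuous g) (hs : HasCompactSupport g) (hf : Integrable f) (x : Cyl n) :
    Integrable fun z => f z • g (x - z) := by
  obtain ⟨C, hC⟩ := exists_bound_of_compact hg hs
  refine (hf.norm.mul_const C).mono
    (hf.1.smul (hg.comp (continuous_const.sub continuous_id)).aestronglyMeasurable)
    (Eventually.of_forall fun z => ?_)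
  rw [norm_smul, norm_mul, norm_norm]
  gcongr
  exact (hC _).trans (le_abs_self _)

theorem hasFDerivAt_conv (hρ : ContDiff ℝ 1 (ρ ∘ cover n)) (hs : HasCompactSupport ρ)
    (hf : Integrable f) (y : EuclideanSpace ℝ (Fin (n + 1))) :
    HasFDerivAt (conv ρ f ∘ cover n) (∫ z, f z • cderiv ρ (cover n y - z)) y := by
  have hc := continuous_cderiv hρ
  obtain ⟨C, hC⟩ := exists_bound_of_compact hc (hasCompactSupport_cderiv hs)
  have hρc := continuous_of_contDiff hρ
  have := hasFDerivAt_integral_of_dominated_of_fderiv_le (𝕜 := ℝ) (μ := (volume : Measure (Cyl n)))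
    (F := fun y z => f z * ρ (cover n y - z)) (F' := fun y z => f z • cderiv ρ (cover n y - z))
    (x₀ := y) (s := univ) (bound := fun z => ‖f z‖ * C) univ_mem
    (Eventually.of_forall fun y => (integrable_bounded_mul hρc hs hf _).1)
    (integrable_bounded_mul hρc hs hf _) (integrable_bounded_mul hc (hasCompactSupport_cderiv hs) hf _).1
    (Eventually.of_forall fun z y _ => by
      rw [norm_smul]
      gcongr
      exact hC _)
    (hf.norm.mul_const C)
    (Eventually.of_forall fun z y _ => (hasFDerivAt_translate hρ z y).const_mul (f z))
  refine this.congr_of_eventuallyEq (Eventually.of_forall fun y => ?_)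
  simp [conv, mul_comm]

theorem contDiff_conv (hρ : ContDiff ℝ 1 (ρ ∘ cover n)) (hs : HasCompactSupport ρ)
    (hf : Integrable f) : ContDiff ℝ 1 (conv ρ f ∘ cover n) := by
  have hc := continuous_cderiv hρ
  obtain ⟨C, hC⟩ := exists_bound_of_compact hc (hasCompactSupport_cderiv hs)
  rw [contDiff_one_iff_fderiv]
  refine ⟨fun y => (hasFDerivAt_conv hρ hs hf y).differentiableAt, ?_⟩
  rw [show fderiv ℝ (conv ρ f ∘ cover n) = fun y => ∫ z, f z • cderiv ρ (cover n y - z) from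
    funext fun y => (hasFDerivAt_conv hρ hs hf y).fderiv]
  refine continuous_of_dominated (bound := fun z => ‖f z‖ * C)
    (fun y => (integrable_bounded_mul hc (hasCompactSupport_cderiv hs) hf _).1)
    (fun y => Eventually.of_forall fun z => ?_) (hf.norm.mul_const C)
    (Eventually.of_forall fun z => ?_)
  · rw [norm_smul]
    gcongr
    exact hC _
  · have := continuous_cover n
    fun_prop

theorem pderiv_conv (hρ : ContDiff ℝ 1 (ρ ∘ cover n)) (hs : HasCompactSupport ρ)
    (hf : Integrable f) (i : Fin (n + 1)) (x : Cyl n) :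
    pderiv i (conv ρ f) x = ∫ z, pderiv i ρ (x - z) * f z := by
  obtain ⟨y, rfl⟩ := (isOpenQuotientMap_cover n).surjective x
  rw [pderiv_cover (contDiff_conv hρ hs hf), (hasFDerivAt_conv hρ hs hf y).fderiv,
    ContinuousLinearMap.integral_apply
      (integrable_bounded_mul (continuous_cderiv hρ) (hasCompactSupport_cderiv hs) hf _)]
  refine integral_congr_ae (Eventually.of_forall fun z => ?_)
  simp [pderiv_eq_cderiv hρ, mul_comm]

theorem pderiv_sub_left (i : Fin (n + 1)) (x z : Cyl n) :
    pderiv i (fun z => ρ (x - z)) z = -pderiv i ρ (x - z) := by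
  have h := deriv_comp_neg (f := fun t : ℝ =>
    ρ (x - z + cover n (EuclideanSpace.single i t))) 0
  rw [neg_zero] at h
  rw [pderiv, pderiv, ← h]
  congr 1
  funext t
  congr 1
  have : EuclideanSpace.single i (-t) = -(EuclideanSpace.single i t : EuclideanSpace ℝ (Fin (n + 1))) := by
    ext j
    by_cases hj : j = i <;> simp [hj]
  rw [this, cover_neg]
  abel

/-- The support lies between the heights `x.2 - r` and `x.2 + r`. This closed slab is compact
because the torus is, and it stays inside `Ω` when `d(x) > r`. -/
theorem isTest_sub_left (hρ : ContDiff ℝ ∞ (ρ ∘ cover n)) {r : ℝ}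
    (hr : ∀ z, ρ z ≠ 0 → |z.2| ≤ r) {x : Cyl n} (hx : r < bdryDist x) :
    IsTest fun z => ρ (x - z) := by
  have hsub : tsupport (fun z => ρ (x - z)) ⊆ univ ×ˢ Icc (x.2 - r) (x.2 + r) := by
    refine closure_minimal (fun z hz => ?_) (isClosed_univ.prod isClosed_Icc)
    have := abs_le.1 (hr _ hz)
    simp only [Prod.snd_sub] at this
    exact ⟨mem_univ _, by linarith, by linarith⟩
  rw [bdryDist, lt_min_iff] at hx
  refine ⟨?_, ?_, ?_⟩
  · obtain ⟨y, rfl⟩ := (isOpenQuotientMap_cover n).surjective x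
    have e : (fun z => ρ (cover n y - z)) ∘ cover n = (ρ ∘ cover n) ∘ fun ζ => y - ζ := by
      funext ζ
      simp only [Function.comp_apply, sub_eq_add_neg, cover_add, cover_neg]
    rw [e]
    exact hρ.comp (by fun_prop)
  · exact (isCompact_univ.prod isCompact_Icc).of_isClosed_subset (isClosed_tsupport _) hsub
  · refine hsub.trans (prod_mono_right fun s hs => ⟨?_, ?_⟩)
    · linarith [hs.1]
    · linarith [hs.2]

/-- The weak gradient is tested with `z ↦ ρ (x - z)`; the minus sign from the inner derivative
cancels the one in the definition. `G` need be integrable only away from the boundary, so it is cut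
off to `innerDomain n δ`. At depth more than `r + δ` the kernel does not see the cut. -/
theorem pderiv_conv_indicator {u : Cyl n → ℝ} {G : Cyl n → EuclideanSpace ℝ (Fin (n + 1))}
    (hG : IsWeakGrad u G) (hu : Integrable u (volOmega n)) (hρ : ContDiff ℝ ∞ (ρ ∘ cover n))
    (hs : HasCompactSupport ρ) {r δ : ℝ} (hr : ∀ z, ρ z ≠ 0 → |z.2| ≤ r) {x : Cyl n}
    (hδ : 0 ≤ δ) (hx : r + δ < bdryDist x) (i : Fin (n + 1)) :
    pderiv i (conv ρ ((Omega n).indicator u)) x =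
      conv ρ ((innerDomain n δ).indicator fun z => G z i) x := by
  have hO := (isOpen_Omega n).measurableSet
  rw [volOmega_eq_restrict] at hu
  rw [pderiv_conv (hρ.of_le (by simp)) hs ((integrable_indicator_iff hO).2 hu)]
  have h := hG.2 i _ (isTest_sub_left hρ hr (by linarith : r < bdryDist x))
  simp only [pderiv_sub_left, mul_neg, integral_neg, neg_inj, volOmega_eq_restrict] at h
  rw [← integral_indicator hO, ← integral_indicator hO] at h
  have e1 : ∀ z, (Omega n).indicator (fun z => u z * pderiv i ρ (x - z)) z =
      pderiv i ρ (x - z) * (Omega n).indicator u z := by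
    intro z
    by_cases hz : z ∈ Omega n <;> simp [hz, mul_comm]
  have e2 : ∀ z, (Omega n).indicator (fun z => G z i * ρ (x - z)) z =
      ρ (x - z) * (innerDomain n δ).indicator (fun z => G z i) z := by
    intro z
    by_cases h0 : ρ (x - z) = 0
    · by_cases hz : z ∈ Omega n <;> simp [hz, h0]
    · have h1 := abs_le.1 (hr _ h0)
      simp only [Prod.snd_sub] at h1
      have h2 : δ < bdryDist z := by
        rw [bdryDist, lt_min_iff] at hx ⊢
        constructor <;> linarith
      have h3 : z ∈ Omega n := by
        rw [bdryDist, lt_min_iff] at h2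
        exact ⟨mem_univ _, by linarith, by linarith⟩
      rw [indicator_of_mem h3, indicator_of_mem (show z ∈ innerDomain n δ from ⟨h3, h2.le⟩),
        mul_comm]
  rw [integral_congr_ae (Eventually.of_forall e1), integral_congr_ae (Eventually.of_forall e2)] at h
  exact h

end conv

/-! ### Approximate identities -/

theorem regular_of_isFiniteMeasureOnCompacts (μ : Measure (Cyl n)) [IsFiniteMeasureOnCompacts μ] :
    μ.Regular := inferInstance

instance : (volume : Measure (Cyl n)).Regular := regular_of_isFiniteMeasureOnCompacts _

/-- A regular Haar measure on a commutative group is invariant under `z ↦ -z`; this serves the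
substitution `z ↦ x - z` in convolutions. -/
theorem isNegInvariant_of_regular (μ : Measure (Cyl n)) [μ.Regular] [μ.IsAddLeftInvariant]
    [μ.IsOpenPosMeasure] : μ.IsNegInvariant :=
  have : μ.IsAddHaarMeasure := {}
  inferInstance

instance : (volume : Measure (Cyl n)).IsNegInvariant := isNegInvariant_of_regular _

/-- The function `cos (2π t)` on the circle. -/
def circleCos (y : UnitAddCircle) : ℝ := (fourier 1 y : ℂ).re

theorem circleCos_coe (t : ℝ) : circleCos (t : UnitAddCircle) = Real.cos (2 * Real.pi * t) := by
  rw [circleCos, fourier_coe_apply, ← Complex.exp_ofReal_mul_I_re]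
  congr 2
  push_cast
  ring

theorem continuous_circleCos : Continuous circleCos :=
  Complex.continuous_re.comp (map_continuous (fourier 1))

theorem circleCos_le_one (y : UnitAddCircle) : circleCos y ≤ 1 := by
  induction y using QuotientAddGroup.induction_on with
  | H t => exact (circleCos_coe t).trans_le (Real.cos_le_one _)

theorem eq_zero_of_circleCos {y : UnitAddCircle} (h : circleCos y = 1) : y = 0 := by
  induction y using QuotientAddGroup.induction_on with
  | H t =>
    rw [show circleCos (QuotientAddGroup.mk t) = _ from circleCos_coe t, Real.cos_eq_one_iff] at h
    obtain ⟨k, hk⟩ := h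
    have : t = k := by
      have := Real.pi_pos
      have h2 : (2 * Real.pi) * (k - t) = 0 := by linarith
      rcases mul_eq_zero.1 h2 with h3 | h3 <;> linarith
    rw [show (QuotientAddGroup.mk t : UnitAddCircle) = ((t : ℝ) : UnitAddCircle) from rfl,
      AddCircle.coe_eq_zero_iff]
    exact ⟨k, by simp [this]⟩

/-- A smooth function vanishing only at the origin. -/
def well (x : Cyl n) : ℝ := ∑ i, (1 - circleCos (x.1 i)) + x.2 ^ 2

theorem continuous_well : Continuous (well (n := n)) := by
  unfold well
  have := continuous_circleCos
  fun_prop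

theorem sum_circleCos_nonneg (x : Cyl n) : 0 ≤ ∑ i, (1 - circleCos (x.1 i)) :=
  Finset.sum_nonneg fun _ _ => sub_nonneg.2 (circleCos_le_one _)

theorem sq_le_well (x : Cyl n) : x.2 ^ 2 ≤ well x :=
  le_add_of_nonneg_left (sum_circleCos_nonneg x)

theorem eq_zero_of_well_le {x : Cyl n} (h : well x ≤ 0) : x = 0 := by
  have h1 := sum_circleCos_nonneg x
  have h2 := sq_nonneg x.2
  unfold well at h
  have h3 : ∑ i, (1 - circleCos (x.1 i)) = 0 := by linarith
  have h4 : x.2 ^ 2 = 0 := by linarith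
  refine Prod.ext (funext fun i => eq_zero_of_circleCos ?_) (by simpa using h4)
  have := (Finset.sum_eq_zero_iff_of_nonneg
    (fun _ _ => sub_nonneg.2 (circleCos_le_one _))).1 h3 i (Finset.mem_univ i)
  linarith

theorem contDiff_well : ContDiff ℝ ∞ (well ∘ cover n) := by
  have : well ∘ cover n = fun y => ∑ i : Fin n, (1 - Real.cos (2 * Real.pi * y i.castSucc)) +
      y (Fin.last n) ^ 2 := by
    funext y
    simp [well, cover, circleCos_coe]
  rw [this]
  fun_prop

/-- Points with `well x < 1` have `|x.2| ≤ 1`; among these, the points with `‖x‖ ≥ δ` form a compact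
set, on which `well` has a positive minimum. -/
theorem exists_well_lt {δ : ℝ} (hδ : 0 < δ) :
    ∃ η > 0, ∀ x : Cyl n, well x < η → ‖x‖ < δ := by
  let K : Set (Cyl n) := (univ ×ˢ Icc (-1) 1) ∩ {x | δ ≤ ‖x‖}
  have hK : IsCompact K := (isCompact_univ.prod isCompact_Icc).inter_right
    (isClosed_le continuous_const continuous_norm)
  have hin : ∀ x : Cyl n, well x < 1 → δ ≤ ‖x‖ → x ∈ K := fun x h1 h2 =>
    ⟨⟨mem_univ _, abs_le.1 ((sq_le_one_iff_abs_le_one _).1 ((sq_le_well x).trans h1.le))⟩, h2⟩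
  rcases K.eq_empty_or_nonempty with h0 | h0
  · refine ⟨1, one_pos, fun x hx => ?_⟩
    by_contra! h
    exact (h0 ▸ hin x hx h : x ∈ (∅ : Set (Cyl n)))
  · obtain ⟨x₀, hx₀, hmin⟩ := hK.exists_isMinOn h0 continuous_well.continuousOn
    have hpos : 0 < well x₀ := by
      by_contra! h
      have h1 : δ ≤ ‖x₀‖ := hx₀.2
      rw [eq_zero_of_well_le h, norm_zero] at h1
      linarith
    refine ⟨min 1 (well x₀), lt_min one_pos hpos, fun x hx => ?_⟩
    by_contra! h
    have := hmin (hin x (hx.trans_le (min_le_left _ _)) h)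
    exact absurd (hx.trans_le (min_le_right _ _)) (not_lt.2 this)

/-- A smooth probability density supported near the origin. -/
structure IsKernel (ρ : Cyl n → ℝ) (r : ℝ) : Prop where
  contDiff : ContDiff ℝ ∞ (ρ ∘ cover n)
  hasCompactSupport : HasCompactSupport ρ
  nonneg : ∀ x, 0 ≤ ρ x
  integral_eq_one : ∫ x, ρ x = 1
  norm_le : ∀ x, ρ x ≠ 0 → ‖x‖ ≤ r

/-- The bump is a smooth cutoff of `η - well`. As `well` is a trigonometric polynomial in the torus
variables plus `x_N²`, it is smooth upstairs and periodic by construction, and no charts are needed.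
-/
theorem exists_isKernel {r : ℝ} (hr : 0 < r) : ∃ ρ : Cyl n → ℝ, IsKernel ρ r := by
  obtain ⟨η, hη, h⟩ := exists_well_lt (n := n) hr
  let b : Cyl n → ℝ := fun x => Real.smoothTransition (η - well x)
  have hbs : ContDiff ℝ ∞ (b ∘ cover n) :=
    Real.smoothTransition.contDiff.comp (contDiff_const.sub contDiff_well)
  have hbc : Continuous b := continuous_of_comp_cover hbs.continuous
  have hnorm : ∀ x, b x ≠ 0 → ‖x‖ ≤ r := fun x hx => by
    refine (h x ?_).le
    by_contra! hc
    exact hx (Real.smoothTransition.zero_of_nonpos (by linarith))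
  have hsupp : HasCompactSupport b := by
    refine HasCompactSupport.of_support_subset_isCompact
      ((isCompact_univ (X := UnitAddTorus (Fin n))).prod (isCompact_Icc (a := -r) (b := r)))
      fun x hx => ⟨mem_univ _, ?_⟩
    have := (norm_snd_le x).trans (hnorm x hx)
    exact abs_le.1 this
  have hpos : 0 < ∫ x, b x := by
    refine hbc.integral_pos_of_hasCompactSupport_nonneg_nonzero hsupp
      (fun x => Real.smoothTransition.nonneg _) (x := 0) ?_
    have : well (0 : Cyl n) = 0 := by
      have : circleCos 0 = 1 := by simpa using circleCos_coe 0
      simp [well, this]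
    simp only [b, this, sub_zero]
    exact (Real.smoothTransition.pos_of_pos hη).ne'
  refine ⟨fun x => (∫ x, b x)⁻¹ * b x, ?_, ?_, ?_, ?_, ?_⟩
  · exact contDiff_const.mul hbs
  · exact hsupp.mul_left
  · exact fun x => mul_nonneg (inv_nonneg.2 hpos.le) (Real.smoothTransition.nonneg _)
  · rw [integral_const_mul, inv_mul_cancel₀ hpos.ne']
  · exact fun x hx => hnorm x (right_ne_zero_of_mul hx)

/-! ### Mollification followed by an affine squeezing of the cylinder -/

section IsKernel

variable {ρ : Cyl n → ℝ} {r : ℝ}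

theorem IsKernel.contDiff_one (h : IsKernel ρ r) : ContDiff ℝ 1 (ρ ∘ cover n) :=
  h.contDiff.of_le (by simp)

theorem IsKernel.continuous (h : IsKernel ρ r) : Continuous ρ := continuous_of_contDiff h.contDiff_one

theorem IsKernel.integrable (h : IsKernel ρ r) : Integrable ρ :=
  h.continuous.integrable_of_hasCompactSupport h.hasCompactSupport

theorem IsKernel.integral_translate (h : IsKernel ρ r) (x : Cyl n) : ∫ z, ρ (x - z) = 1 := by
  rw [integral_sub_left_eq_self, h.integral_eq_one]

theorem IsKernel.lintegral (h : IsKernel ρ r) : ∫⁻ z, ENNReal.ofReal (ρ z) = 1 := by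
  rw [← ofReal_integral_eq_lintegral_ofReal h.integrable (Eventually.of_forall h.nonneg),
    h.integral_eq_one, ENNReal.ofReal_one]

theorem IsKernel.lintegral_translate (h : IsKernel ρ r) (x : Cyl n) :
    ∫⁻ z, ENNReal.ofReal (ρ (x - z)) = 1 := by
  rw [lintegral_sub_left_eq_self (fun z => ENNReal.ofReal (ρ z)), h.lintegral]

/-- Jensen's inequality for the probability density `z ↦ ρ (x - z)`, as Cauchy–Schwarz applied to
`√ρ · (√ρ |f|)`. -/
theorem IsKernel.enorm_conv_sq_le (h : IsKernel ρ r) {f : Cyl n → ℝ}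
    (hf : AEStronglyMeasurable f) (x : Cyl n) :
    ‖conv ρ f x‖ₑ ^ 2 ≤ ∫⁻ z, ENNReal.ofReal (ρ (x - z)) * ‖f z‖ₑ ^ 2 := by
  have hm : Measurable fun z => ENNReal.ofReal (ρ (x - z)) :=
    (h.continuous.comp (continuous_const.sub continuous_id)).measurable.ennreal_ofReal
  have h1 := lintegral_mul_sq_le (μ := (volume : Measure (Cyl n)))
    (f := fun z => ENNReal.ofReal (ρ (x - z)) ^ (1 / 2 : ℝ))
    (g := fun z => ENNReal.ofReal (ρ (x - z)) ^ (1 / 2 : ℝ) * ‖f z‖ₑ)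
    (hm.pow_const _).aemeasurable ((hm.pow_const _).aemeasurable.mul hf.enorm)
  simp only [mul_pow, sqrt_sq, ← mul_assoc, h.lintegral_translate, one_mul] at h1
  simp only [← sq, sqrt_sq] at h1
  refine le_trans ?_ h1
  gcongr
  refine (enorm_integral_le_lintegral_enorm _).trans_eq (lintegral_congr fun z => ?_)
  rw [enorm_mul, Real.enorm_eq_ofReal (h.nonneg _)]

/-- The affine map of `Ω` into `{x : r ≤ d(x)}`. -/
def squeeze (r : ℝ) (x : Cyl n) : Cyl n := (x.1, r + (1 - 2 * r) * x.2)

theorem continuous_squeeze (r : ℝ) : Continuous (squeeze (n := n) r) := by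
  unfold squeeze; fun_prop

/-- The change of variables in the last coordinate has Jacobian `1 / (1 - 2t)`, at most `2` for `t ≤
1/4`; the height integral is first enlarged to the whole line. -/
theorem lintegral_squeeze_le {t : ℝ} (ht : t ≤ 1 / 4) {g : Cyl n → ℝ≥0∞} (hg : Measurable g) :
    ∫⁻ x, g (squeeze t x) ∂(volOmega n) ≤ 2 * ∫⁻ x, g x := by
  have h0 : 1 - 2 * t ≠ 0 := by linarith
  have hgs : Measurable fun x => g (squeeze t x) := hg.comp (continuous_squeeze t).measurable
  rw [volOmega, lintegral_prod _ hgs.aemeasurable,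
    Measure.volume_eq_prod, lintegral_prod _ hg.aemeasurable,
    ← lintegral_const_mul _ hg.lintegral_prod_right']
  refine lintegral_mono fun y => ?_
  simp only [squeeze]
  refine (setLIntegral_le_lintegral _ _).trans ?_
  have hm : Measurable fun s => g (y, t + s) := hg.comp (by fun_prop)
  have h1 : ∫⁻ s, g (y, t + (1 - 2 * t) * s) =
      ENNReal.ofReal |(1 - 2 * t)⁻¹| * ∫⁻ s, g (y, s) := by
    rw [← lintegral_map (f := fun s => g (y, t + s)) hm (by fun_prop : Measurable fun s => (1 - 2 * t) * s),
      Real.map_volume_mul_left h0, lintegral_smul_measure,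
      lintegral_add_left_eq_self (fun s => g (y, s)) t]
    rfl
  rw [h1]
  gcongr
  rw [← ENNReal.ofReal_ofNat]
  apply ENNReal.ofReal_le_ofReal
  rw [abs_of_pos (inv_pos.2 (by linarith))]
  rw [inv_le_comm₀ (by linarith) (by norm_num)]
  linarith

/-- Jensen and Tonelli. The bound is uniform in the kernel and in `t`, which reduces convergence of
the mollifications to continuous compactly supported functions. -/
theorem IsKernel.eLpNorm_conv_squeeze_le (h : IsKernel ρ r) {t : ℝ} (ht : t ≤ 1 / 4)
    {f : Cyl n → ℝ} (hf : AEStronglyMeasurable f) :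
    eLpNorm (fun x => conv ρ f (squeeze t x)) 2 (volOmega n) ≤ 2 * eLpNorm f 2 volume := by
  apply eLpNorm_two_le
  rw [mul_pow, eLpNorm_two_sq]
  have hm : AEMeasurable (Function.uncurry fun (x z : Cyl n) =>
      ENNReal.ofReal (ρ (squeeze t x - z)) * ‖f z‖ₑ ^ 2) ((volOmega n).prod volume) := by
    have hc : Continuous fun p : Cyl n × Cyl n => ρ (squeeze t p.1 - p.2) :=
      h.continuous.comp (((continuous_squeeze t).comp continuous_fst).sub continuous_snd)
    exact hc.measurable.ennreal_ofReal.aemeasurable.mul (hf.comp_snd.enorm.pow_const 2)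
  calc ∫⁻ x : Cyl n, ‖conv ρ f (squeeze t x)‖ₑ ^ 2 ∂(volOmega n)
      ≤ ∫⁻ x : Cyl n, ∫⁻ z : Cyl n, ENNReal.ofReal (ρ (squeeze t x - z)) * ‖f z‖ₑ ^ 2 ∂volume ∂(volOmega n) :=
        lintegral_mono fun x => h.enorm_conv_sq_le hf _
    _ = ∫⁻ z : Cyl n, ∫⁻ x : Cyl n, ENNReal.ofReal (ρ (squeeze t x - z)) * ‖f z‖ₑ ^ 2 ∂(volOmega n) :=
        lintegral_lintegral_swap hm
    _ ≤ ∫⁻ z, 2 * ‖f z‖ₑ ^ 2 := by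
        refine lintegral_mono fun z => ?_
        have hmz : Measurable fun x => ENNReal.ofReal (ρ (x - z)) :=
          (h.continuous.comp (continuous_id.sub continuous_const)).measurable.ennreal_ofReal
        have hms : Measurable fun x => ENNReal.ofReal (ρ (squeeze t x - z)) :=
          hmz.comp (continuous_squeeze t).measurable
        rw [lintegral_mul_const _ hms]
        gcongr
        refine (lintegral_squeeze_le ht hmz).trans_eq ?_
        rw [lintegral_sub_right_eq_self (fun x => ENNReal.ofReal (ρ x)), h.lintegral, mul_one]
    _ ≤ 2 ^ 2 * ∫⁻ z, ‖f z‖ₑ ^ 2 := by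
        rw [lintegral_const_mul' _ _ (by simp)]
        gcongr
        norm_num

/-- `conv ρ g x` averages `g` over points within `r` of `x`, hence within `δ` of `x'`. -/
theorem IsKernel.abs_conv_sub_le (h : IsKernel ρ r) {g : Cyl n → ℝ} (hg : Continuous g)
    (hgs : HasCompactSupport g) {ε δ : ℝ} (hε : ∀ x y, dist x y < δ → |g x - g y| ≤ ε)
    {x x' : Cyl n} (hx : r + dist x x' < δ) : |conv ρ g x - g x'| ≤ ε := by
  have hi : Integrable fun z => ρ (x - z) :=
    h.integrable.comp_sub_left x
  have hi2 : Integrable fun z => ρ (x - z) * g z :=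
    hi.mul_bdd hg.aestronglyMeasurable
      (Eventually.of_forall (exists_bound_of_compact hg hgs).choose_spec)
  have e1 : conv ρ g x - g x' = ∫ z, ρ (x - z) * (g z - g x') := by
    simp only [mul_sub]
    rw [integral_sub hi2 (hi.mul_const _), integral_mul_const, h.integral_translate, one_mul, conv]
  rw [e1, ← Real.norm_eq_abs]
  calc _ ≤ ∫ z, ρ (x - z) * ε := by
        refine norm_integral_le_of_norm_le (hi.mul_const _) (Eventually.of_forall fun z => ?_)
        rw [norm_mul, Real.norm_of_nonneg (h.nonneg _)]
        by_cases h0 : ρ (x - z) = 0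
        · simp [h0]
        · refine mul_le_mul_of_nonneg_left (hε _ _ ?_) (h.nonneg _)
          have h1 := h.norm_le _ h0
          rw [← dist_eq_norm, dist_comm] at h1
          linarith [dist_triangle z x x']
    _ = ε := by rw [integral_mul_const, h.integral_translate, one_mul]

end IsKernel

instance : IsProbabilityMeasure (volOmega n) :=
  ⟨by rw [volOmega, Measure.prod_apply MeasurableSet.univ]; simp⟩

theorem tendsto_conv_squeeze {ρ : ℕ → Cyl n → ℝ} {r t : ℕ → ℝ} (h : ∀ k, IsKernel (ρ k) (r k))
    (hr : Tendsto r atTop (𝓝 0)) (ht : Tendsto t atTop (𝓝 0)) (ht4 : ∀ k, t k ≤ 1 / 4)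
    {f : Cyl n → ℝ} (hf : MemLp f 2)
    (hfi : Integrable f) :
    Tendsto (fun k => eLpNorm (fun x => conv (ρ k) f (squeeze (t k) x) - f x) 2 (volOmega n))
      atTop (𝓝 0) := by
  rw [ENNReal.tendsto_nhds_zero]
  intro ε hε
  rcases eq_or_ne ε ⊤ with rfl | hεt
  · simp
  -- With `‖f - g‖ ≤ ε/6` the three errors add up to `2 · ε/6 + ε/3 + ε/6 ≤ ε`.
  obtain ⟨g, hgs, hfg, hg, hg2⟩ := hf.exists_hasCompactSupport_eLpNorm_sub_le (by simp)
    (ε := ε / 6) (by simpa using hε.ne')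
  have hε0 : 0 < (ε / 3).toReal :=
    ENNReal.toReal_pos (by simpa using hε.ne') (ENNReal.div_ne_top hεt (by simp))
  obtain ⟨δ, hδ, hgδ⟩ := Metric.uniformContinuous_iff.1
    (hgs.uniformContinuous_of_continuous hg) _ hε0
  have hsmall : ∀ᶠ k in atTop, r k + |t k| < δ := by
    have : Tendsto (fun k => r k + |t k|) atTop (𝓝 (0 + |0|)) := hr.add ht.abs
    rw [abs_zero, add_zero] at this
    exact this.eventually_lt_const hδ
  filter_upwards [hsmall] with k hk
  have hfm := hf.1
  have hres : ∀ {f : Cyl n → ℝ}, eLpNorm f 2 (volOmega n) ≤ eLpNorm f 2 volume := fun {f} => by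
    rw [volOmega_eq_restrict]
    exact eLpNorm_mono_measure _ Measure.restrict_le_self
  have h1 := (h k).eLpNorm_conv_squeeze_le (ht4 k) (hf.1.sub hg2.1)
  have h2 : eLpNorm (fun x => conv (ρ k) g (squeeze (t k) x) - g x) 2 (volOmega n) ≤ ε / 3 := by
    have : ∀ᵐ x ∂(volOmega n), ‖conv (ρ k) g (squeeze (t k) x) - g x‖ₑ ≤ ε / 3 := by
      filter_upwards [ae_mem_Omega n] with x hx
      rw [← ofReal_norm, ← ENNReal.ofReal_toReal (ENNReal.div_ne_top hεt (by simp) : ε / 3 ≠ ⊤)]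
      refine ENNReal.ofReal_le_ofReal ((h k).abs_conv_sub_le hg hgs
        (fun x y hxy => (Real.dist_eq _ _ ▸ hgδ hxy).le) (lt_of_le_of_lt ?_ hk))
      gcongr
      simp only [squeeze, Prod.dist_eq, dist_self, Real.dist_eq]
      refine max_le (abs_nonneg _) ?_
      -- Squeezing moves a point of `Ω` vertically by `t (1 - 2 x_N)`, that is by at most `|t|`.
      rw [show t k + (1 - 2 * t k) * x.2 - x.2 = t k * (1 - 2 * x.2) by ring, abs_mul]
      refine mul_le_of_le_one_right (abs_nonneg _) (abs_le.2 ?_)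
      have := hx.2
      constructor <;> linarith [this.1, this.2]
    refine (eLpNorm_le_of_ae_enorm_bound this).trans ?_
    rw [measure_univ, ENNReal.one_rpow, smul_eq_mul, mul_one]
  have hgi : Integrable g := hg.integrable_of_hasCompactSupport hgs
  have hcont : ∀ {f : Cyl n → ℝ}, Integrable f → Continuous (conv (ρ k) f) := fun hf =>
    continuous_of_contDiff (contDiff_conv (h k).contDiff_one (h k).hasCompactSupport hf)
  have hint : ∀ {f : Cyl n → ℝ}, Integrable f → ∀ x, Integrable fun z => ρ k (x - z) * f z :=
    fun hf x => by
      simpa [mul_comm] using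
        integrable_bounded_mul (h k).continuous (h k).hasCompactSupport hf x
  have e : (fun x => conv (ρ k) f (squeeze (t k) x) - f x) =
      (fun x => conv (ρ k) (f - g) (squeeze (t k) x)) +
      ((fun x => conv (ρ k) g (squeeze (t k) x) - g x) + (g - f)) := by
    funext x
    have : conv (ρ k) (f - g) (squeeze (t k) x) =
        conv (ρ k) f (squeeze (t k) x) - conv (ρ k) g (squeeze (t k) x) := by
      simp only [conv, Pi.sub_apply, mul_sub]
      exact integral_sub (hint hfi _) (hint hgi _)
    simp only [Pi.add_apply, Pi.sub_apply, this]
    ring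
  have hac : volOmega n ≪ volume := by
    rw [volOmega_eq_restrict]
    exact Measure.restrict_le_self.absolutelyContinuous
  have m1 : AEStronglyMeasurable (fun x => conv (ρ k) (f - g) (squeeze (t k) x)) (volOmega n) :=
    ((hcont (hfi.sub hgi)).comp (continuous_squeeze _)).aestronglyMeasurable
  have m2 : AEStronglyMeasurable (fun x => conv (ρ k) g (squeeze (t k) x) - g x) (volOmega n) :=
    (((hcont hgi).comp (continuous_squeeze _)).sub hg).aestronglyMeasurable
  have m3 : AEStronglyMeasurable (g - f) (volOmega n) := (hg2.1.sub hf.1).mono_ac hac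
  rw [e]
  calc _ ≤ _ := eLpNorm_add_le m1 (m2.add m3) (by norm_num)
    _ ≤ _ := add_le_add_right (eLpNorm_add_le m2 m3 (by norm_num)) _
    _ ≤ 2 * (ε / 6) + (ε / 3 + ε / 6) := by
        rw [eLpNorm_sub_comm g f]
        gcongr
        · exact h1.trans (by gcongr)
        · exact hres.trans hfg
    _ ≤ ε := by
        lift ε to NNReal using hεt
        rw [show ((6 : ℝ≥0∞)) = ((6 : NNReal) : ℝ≥0∞) by simp,
          show ((3 : ℝ≥0∞)) = ((3 : NNReal) : ℝ≥0∞) by simp,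
          show ((2 : ℝ≥0∞)) = ((2 : NNReal) : ℝ≥0∞) by simp,
          ← ENNReal.coe_div (by norm_num), ← ENNReal.coe_div (by norm_num)]
        norm_cast
        rw [← NNReal.coe_le_coe]
        push_cast
        have := ε.coe_nonneg
        linarith

/-! ### Approximation by functions of class `C¹` -/

theorem eLpNorm_euclidean_sq {μ : Measure (Cyl n)} {m : ℕ} {F : Cyl n → EuclideanSpace ℝ (Fin m)}
    (hF : AEStronglyMeasurable F μ) :
    eLpNorm F 2 μ ^ 2 = ∑ i, eLpNorm (fun x => F x i) 2 μ ^ 2 := by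
  have hi : ∀ i, AEMeasurable (fun x => ‖F x i‖ₑ ^ 2) μ := fun i =>
    ((EuclideanSpace.proj i : EuclideanSpace ℝ (Fin m) →L[ℝ] ℝ).continuous.comp_aestronglyMeasurable
      hF).enorm.pow_const 2
  simp only [eLpNorm_two_sq]
  rw [← lintegral_finsetSum' _ fun i _ => hi i]
  refine lintegral_congr fun x => ?_
  simp only [← ofReal_norm, ← ENNReal.ofReal_pow (norm_nonneg _)]
  rw [EuclideanSpace.norm_sq_eq, ENNReal.ofReal_sum_of_nonneg fun i _ => by positivity]

theorem tendsto_zero_of_sq {ι : Type*} {l : Filter ι} {f : ι → ℝ≥0∞}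
    (h : Tendsto (fun k => f k ^ 2) l (𝓝 0)) : Tendsto f l (𝓝 0) := by
  have h2 := (ENNReal.continuous_rpow_const (y := 1 / 2)).tendsto 0 |>.comp h
  simp only [Function.comp_def] at h2
  rw [ENNReal.zero_rpow_of_pos (by norm_num)] at h2
  refine h2.congr fun k => ?_
  rw [← ENNReal.rpow_natCast_mul]
  norm_num

theorem eLpNorm_coord_le {μ : Measure (Cyl n)} {m : ℕ} (F : Cyl n → EuclideanSpace ℝ (Fin m))
    (i : Fin m) : eLpNorm (fun x => F x i) 2 μ ≤ eLpNorm F 2 μ :=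
  eLpNorm_mono fun x => PiLp.norm_apply_le (F x) i

theorem memLp_coord {μ : Measure (Cyl n)} {m : ℕ} {F : Cyl n → EuclideanSpace ℝ (Fin m)}
    (hF : MemLp F 2 μ) (i : Fin m) : MemLp (fun x => F x i) 2 μ :=
  ⟨(EuclideanSpace.proj i : EuclideanSpace ℝ (Fin m) →L[ℝ] ℝ).continuous.comp_aestronglyMeasurable hF.1,
    (eLpNorm_coord_le F i).trans_lt hF.2⟩

theorem mem_innerDomain_of_lt {δ : ℝ} (hδ : 0 ≤ δ) {x : Cyl n} (h : δ < bdryDist x) :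
    x ∈ innerDomain n δ := by
  have h' := h
  rw [bdryDist, lt_min_iff] at h'
  exact ⟨⟨mem_univ _, by linarith, by linarith⟩, h.le⟩

theorem innerDomain_zero : innerDomain n 0 = Omega n := by
  refine Subset.antisymm (fun x hx => hx.1) fun x hx => ⟨hx, le_min hx.2.1.le ?_⟩
  linarith [hx.2.2]

theorem volOmega_restrict_innerDomain (δ : ℝ) :
    (volOmega n).restrict (innerDomain n δ) = volume.restrict (innerDomain n δ) := by
  rw [volOmega_eq_restrict, Measure.restrict_restrict (measurableSet_innerDomain n δ),
    inter_eq_left.2 fun x hx => hx.1]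

/-- `u` and `g` are limits of `C¹` functions and of their normal derivatives. -/
def NormalApprox (u g : Cyl n → ℝ) : Prop :=
  ∃ ψ : ℕ → Cyl n → ℝ, (∀ k, ContDiff ℝ 1 (ψ k ∘ cover n)) ∧
    Tendsto (fun k => eLpNorm (fun x => ψ k x - u x) 2 (volOmega n)) atTop (𝓝 0) ∧
    ∀ δ : ℝ, 0 < δ → Tendsto (fun k => eLpNorm (fun x => pderiv (Fin.last n) (ψ k) x - g x) 2
      ((volOmega n).restrict (innerDomain n δ))) atTop (𝓝 0)

/-- The radii of the kernels. The shift by `16` keeps the squeezing parameter, twice the radius,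
below the `1/4` required above. -/
theorem tendsto_radius : Tendsto (fun k : ℕ => 1 / ((k : ℝ) + 16)) atTop (𝓝 0) :=
  tendsto_const_nhds.div_atTop (tendsto_atTop_add_const_right _ _ tendsto_natCast_atTop_atTop)

theorem IsKernel.abs_snd_le {ρ : Cyl n → ℝ} {r : ℝ} (h : IsKernel ρ r) (z : Cyl n)
    (hz : ρ z ≠ 0) : |z.2| ≤ r := (norm_snd_le z).trans (h.norm_le z hz)

theorem squeeze_zero_eq (x : Cyl n) : squeeze 0 x = x := by simp [squeeze]

theorem memLp_indicator_innerDomain {δ : ℝ} {f : Cyl n → ℝ}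
    (hf : MemLp f 2 ((volOmega n).restrict (innerDomain n δ))) :
    MemLp ((innerDomain n δ).indicator f) 2 volume ∧
      Integrable ((innerDomain n δ).indicator f) := by
  have hi := hf.integrable (by norm_num)
  rw [volOmega_restrict_innerDomain] at hf hi
  exact ⟨(memLp_indicator_iff_restrict (measurableSet_innerDomain n δ)).2 hf,
    (integrable_indicator_iff (measurableSet_innerDomain n δ)).2 hi⟩

theorem memLp_indicator_Omega {f : Cyl n → ℝ} (hf : MemLp f 2 (volOmega n)) :
    MemLp ((Omega n).indicator f) 2 volume ∧ Integrable ((Omega n).indicator f) := by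
  rw [← innerDomain_zero]
  exact memLp_indicator_innerDomain (hf.mono_measure Measure.restrict_le_self)

/-- Plain mollification of the extension of `u` by zero. It converges to `u` in all of `L²(Ω)`; its
normal derivative is controlled at depth `δ` once the radius is below `δ/2`, with `G` cut off at
depth `δ/2`. Nothing is asserted about derivatives up to the boundary, where `G` need not be square
integrable. -/
theorem normalApprox_of_isWeakGrad {u : Cyl n → ℝ} {G : Cyl n → EuclideanSpace ℝ (Fin (n + 1))}
    (hu : MemLp u 2 (volOmega n)) (hG : IsWeakGrad u G)
    (hG2 : ∀ δ : ℝ, 0 < δ → MemLp G 2 ((volOmega n).restrict (innerDomain n δ))) :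
    NormalApprox u fun x => G x (Fin.last n) := by
  have hrp : ∀ k : ℕ, 0 < 1 / ((k : ℝ) + 16) := fun k => by positivity
  choose ρ hρ using fun k : ℕ => exists_isKernel (n := n) (hrp k)
  have hu' := memLp_indicator_Omega hu
  refine ⟨fun k => conv (ρ k) ((Omega n).indicator u), fun k =>
    contDiff_conv (hρ k).contDiff_one (hρ k).hasCompactSupport hu'.2, ?_, fun δ hδ => ?_⟩
  · have := tendsto_conv_squeeze hρ tendsto_radius tendsto_const_nhds (t := fun _ => 0)
      (by norm_num) hu'.1 hu'.2
    refine this.congr fun k => eLpNorm_congr_ae ?_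
    filter_upwards [ae_mem_Omega n] with x hx
    rw [squeeze_zero_eq, indicator_of_mem hx]
  · have hg := memLp_indicator_innerDomain (memLp_coord (hG2 (δ / 2) (by linarith)) (Fin.last n))
    have := tendsto_conv_squeeze hρ tendsto_radius tendsto_const_nhds (t := fun _ => 0)
      (by norm_num) hg.1 hg.2
    refine tendsto_of_tendsto_of_tendsto_of_le_of_le' tendsto_const_nhds this
      (Eventually.of_forall fun _ => zero_le) ?_
    filter_upwards [tendsto_radius.eventually_lt_const (show (0 : ℝ) < δ / 2 by linarith)] with k hk
    refine le_trans (le_of_eq (eLpNorm_congr_ae ?_)) (eLpNorm_mono_measure _ Measure.restrict_le_self)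
    filter_upwards [ae_restrict_mem (measurableSet_innerDomain n δ)] with x hx
    have hx2 := hx.2
    rw [squeeze_zero_eq, pderiv_conv_indicator hG (hu.integrable (by norm_num)) (hρ k).contDiff
      (hρ k).hasCompactSupport (hρ k).abs_snd_le (δ := δ / 2) (by linarith) (by linarith),
      indicator_of_mem (mem_innerDomain_of_lt (by linarith) (by linarith))]

theorem NormalApprox.reflect {u g : Cyl n → ℝ} (h : NormalApprox u g)
    (hu : AEStronglyMeasurable u (volOmega n))
    (hg : ∀ δ : ℝ, 0 < δ → AEStronglyMeasurable g ((volOmega n).restrict (innerDomain n δ))) :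
    NormalApprox (u ∘ reflect) fun x => -g (reflect x) := by
  obtain ⟨ψ, h1, h2, h3⟩ := h
  refine ⟨fun k => ψ k ∘ ThinLayer.reflect, fun k => contDiff_reflect (h1 k), ?_, fun δ hδ => ?_⟩
  · refine h2.congr fun k => ?_
    exact (eLpNorm_comp_measurePreserving
      ((continuous_of_contDiff (h1 k)).aestronglyMeasurable.sub hu)
      (measurePreserving_reflect n)).symm
  · refine (h3 δ hδ).congr fun k => ?_
    have hp : MeasurePreserving ThinLayer.reflect ((volOmega n).restrict (innerDomain n δ))
        ((volOmega n).restrict (innerDomain n δ)) := by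
      have := (measurePreserving_reflect n).restrict_preimage (measurableSet_innerDomain n δ)
      have e : ThinLayer.reflect ⁻¹' innerDomain n δ = innerDomain n δ := by
        ext x
        simp only [innerDomain, mem_preimage, mem_ofPred_eq, bdryDist_reflect, Omega]
        simp [ThinLayer.reflect, and_comm]
      rwa [e] at this
    refine (eLpNorm_comp_measurePreserving
      ((continuous_pderiv (h1 k) _).aestronglyMeasurable.sub (hg δ hδ)) hp).symm.trans ?_
    rw [← eLpNorm_neg]
    congr 1
    funext x
    simp only [Pi.neg_apply, Pi.sub_apply, Function.comp_apply, pderiv_last_reflect (h1 k)]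
    ring

theorem contDiff_squeeze {ψ : Cyl n → ℝ} (hψ : ContDiff ℝ 1 (ψ ∘ cover n)) (t : ℝ) :
    ContDiff ℝ 1 ((fun x => ψ (squeeze t x)) ∘ cover n) := by
  have : (fun x => ψ (squeeze t x)) ∘ cover n = (ψ ∘ cover n) ∘ fun y =>
      y + (t - 2 * t * y (Fin.last n)) • EuclideanSpace.single (Fin.last n) (1 : ℝ) := by
    funext y
    have e : (t - 2 * t * y (Fin.last n)) • EuclideanSpace.single (Fin.last n) (1 : ℝ) =
        EuclideanSpace.single (Fin.last n) (t - 2 * t * y (Fin.last n)) := by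
      ext j
      by_cases hj : j = Fin.last n <;> simp [hj]
    simp only [Function.comp_apply, e, cover_add, cover_smul_last, squeeze]
    congr 1
    refine Prod.ext (by simp) ?_
    simp [cover]
    ring
  rw [this]
  exact hψ.comp (by fun_prop)

/-- The factors by which `squeeze t` scales the directions. -/
def squeezeFactor (t : ℝ) (i : Fin (n + 1)) : ℝ := if i = Fin.last n then 1 - 2 * t else 1

theorem pderiv_squeeze (ψ : Cyl n → ℝ) (t : ℝ) (i : Fin (n + 1)) (x : Cyl n) :
    pderiv i (fun x => ψ (squeeze t x)) x = squeezeFactor t i * pderiv i ψ (squeeze t x) := by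
  have h := deriv_comp_mul_left (squeezeFactor t i)
    (fun s => ψ (squeeze t x + cover n (EuclideanSpace.single i s))) 0
  rw [mul_zero, smul_eq_mul] at h
  rw [pderiv, pderiv, ← h]
  congr 1
  funext s
  congr 1
  unfold squeezeFactor
  split_ifs with hi
  · subst hi
    rw [cover_smul_last, cover_smul_last]
    refine Prod.ext (by simp [squeeze]) ?_
    simp [squeeze]
    ring
  · refine Prod.ext ?_ ?_
    · funext j
      simp [squeeze, cover]
    · simp [squeeze, cover, Ne.symm hi]

/-- Density of `C¹` functions up to the boundary. The mollification with radius `r` is composed with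
`squeeze (2 * r)`, which moves `Ω` to depth greater than `r`. There the kernel stays inside `Ω`, and
the derivative of the mollification is the mollified weak gradient. -/
theorem exists_contDiff_approx {u : Cyl n → ℝ} {G : Cyl n → EuclideanSpace ℝ (Fin (n + 1))}
    (hu : MemLp u 2 (volOmega n)) (hG : IsWeakGrad u G) (hG2 : MemLp G 2 (volOmega n)) :
    ∃ ψ : ℕ → Cyl n → ℝ, (∀ k, ContDiff ℝ 1 (ψ k ∘ cover n)) ∧
      Tendsto (fun k => eLpNorm (fun x => ψ k x - u x) 2 (volOmega n)) atTop (𝓝 0) ∧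
      Tendsto (fun k => eLpNorm (fun x => grad (ψ k) x - G x) 2 (volOmega n)) atTop (𝓝 0) := by
  have hrp : ∀ k : ℕ, 0 < 1 / ((k : ℝ) + 16) := fun k => by positivity
  choose ρ hρ using fun k : ℕ => exists_isKernel (n := n) (hrp k)
  have hu' := memLp_indicator_Omega hu
  have ht : Tendsto (fun k : ℕ => 2 * (1 / ((k : ℝ) + 16))) atTop (𝓝 0) := by
    simpa using tendsto_radius.const_mul 2
  have ht4 : ∀ k : ℕ, 2 * (1 / ((k : ℝ) + 16)) ≤ 1 / 4 := fun k => by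
    have : 1 / ((k : ℝ) + 16) ≤ 1 / 16 := by
      apply one_div_le_one_div_of_le (by norm_num)
      have : (0 : ℝ) ≤ k := k.cast_nonneg
      linarith
    linarith
  have hC := fun k => contDiff_squeeze (contDiff_conv (hρ k).contDiff_one
    (hρ k).hasCompactSupport hu'.2) (2 * (1 / ((k : ℝ) + 16)))
  refine ⟨_, hC, ?_, tendsto_zero_of_sq ?_⟩
  · have := tendsto_conv_squeeze hρ tendsto_radius ht ht4 hu'.1 hu'.2
    refine this.congr fun k => eLpNorm_congr_ae ?_
    filter_upwards [ae_mem_Omega n] with x hx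
    rw [indicator_of_mem hx]
  · refine Tendsto.congr (fun k => (eLpNorm_euclidean_sq
      ((continuous_grad (hC k)).aestronglyMeasurable.sub hG2.1)).symm) ?_
    rw [show (0 : ℝ≥0∞) = ∑ i : Fin (n + 1), 0 ^ 2 by simp]
    refine tendsto_finsetSum _ fun i _ => ?_
    refine ENNReal.Tendsto.pow ?_
    have hGi := memLp_coord hG2 i
    have hgi := memLp_indicator_Omega hGi
    have h1 := tendsto_conv_squeeze hρ tendsto_radius ht ht4 hgi.1 hgi.2
    -- This term absorbs the factor `1 - 2t` by which squeezing multiplies the normal derivative.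
    have h2 : Tendsto (fun k : ℕ => ENNReal.ofReal (2 * (2 * (1 / ((k : ℝ) + 16)))) *
        eLpNorm (fun x => G x i) 2 (volOmega n)) atTop (𝓝 0) := by
      have := ENNReal.Tendsto.mul_const (ENNReal.tendsto_ofReal (ht.const_mul 2))
        (Or.inr hGi.2.ne)
      simpa using this
    have h3 := h1.add h2
    rw [add_zero] at h3
    refine tendsto_of_tendsto_of_tendsto_of_le_of_le tendsto_const_nhds h3
      (fun _ => zero_le) fun k => ?_
    set t := 2 * (1 / ((k : ℝ) + 16)) with htk
    have htp : 0 < t := by positivity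
    have hf1 : |squeezeFactor t i| ≤ 1 := by
      have := ht4 k
      unfold squeezeFactor
      split_ifs
      · exact abs_le.2 ⟨by linarith, by linarith⟩
      · simp
    have hf2 : |squeezeFactor t i - 1| ≤ 2 * t := by
      unfold squeezeFactor
      split_ifs
      · rw [abs_le]; constructor <;> linarith
      · simp [htp.le]
    set f : Cyl n → ℝ := (Omega n).indicator fun z => G z i with hf
    have hm : AEStronglyMeasurable (fun x => conv (ρ k) f (squeeze t x)) (volOmega n) :=
      ((continuous_of_contDiff (contDiff_conv (hρ k).contDiff_one (hρ k).hasCompactSupport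
        hgi.2)).comp (continuous_squeeze t)).aestronglyMeasurable
    have hfm : AEStronglyMeasurable f (volOmega n) := by
      refine hGi.1.congr ?_
      filter_upwards [ae_mem_Omega n] with x hx
      rw [hf, indicator_of_mem hx]
    calc _ = eLpNorm ((fun x => squeezeFactor t i * (conv (ρ k) f (squeeze t x) - f x)) +
          fun x => (squeezeFactor t i - 1) * G x i) 2 (volOmega n) := by
          refine eLpNorm_congr_ae ?_
          filter_upwards [ae_mem_Omega n] with x hx
          have hd : 1 / ((k : ℝ) + 16) + 0 < bdryDist (squeeze t x) := by
            have hx1 := hx.2.1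
            have hx2 := hx.2.2
            have := ht4 k
            rw [bdryDist, lt_min_iff]
            simp only [squeeze]
            constructor <;> nlinarith
          have := pderiv_conv_indicator hG (hu.integrable (by norm_num)) (hρ k).contDiff
            (hρ k).hasCompactSupport (hρ k).abs_snd_le le_rfl hd i
          simp only [Pi.add_apply, Pi.sub_apply, PiLp.sub_apply, grad]
          rw [pderiv_squeeze, this, innerDomain_zero]
          simp only [f, indicator_of_mem hx]
          ring
      _ ≤ _ := eLpNorm_add_le ((hm.sub hfm).const_mul _) (hGi.1.const_mul _) (by norm_num)
      _ ≤ _ := by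
          refine add_le_add ?_ ?_
          · refine eLpNorm_mono fun x => ?_
            rw [norm_mul]
            exact mul_le_of_le_one_left (norm_nonneg _) hf1
          · have := eLpNorm_const_smul (squeezeFactor t i - 1) (fun x => G x i) 2 (volOmega n)
            simp only [smul_eq_mul, Pi.smul_def] at this
            rw [this]
            gcongr
            rw [← ofReal_norm]
            exact ENNReal.ofReal_le_ofReal hf2

/-! ### Comparison of averages -/

theorem inv_sqrt_eq {x : ℝ} (hx : 0 < x) :
    (ENNReal.ofReal x)⁻¹ ^ (1 / 2 : ℝ) = ENNReal.ofReal (1 / √x) := by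
  rw [← ENNReal.ofReal_inv_of_pos hx, ENNReal.ofReal_rpow_of_nonneg (by positivity) (by norm_num),
    ← Real.sqrt_eq_rpow, Real.sqrt_inv, one_div]

theorem eLpNorm_sub_triangle {α F : Type*} [MeasurableSpace α] [NormedAddCommGroup F]
    {μ : Measure α} {f g h : α → F} (hf : AEStronglyMeasurable f μ)
    (hg : AEStronglyMeasurable g μ) (hh : AEStronglyMeasurable h μ) :
    eLpNorm (fun x => f x - h x) 2 μ ≤
      eLpNorm (fun x => f x - g x) 2 μ + eLpNorm (fun x => g x - h x) 2 μ := by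
  refine le_trans (le_of_eq ?_) (eLpNorm_add_le (hf.sub hg) (hg.sub hh) (by norm_num))
  congr 1
  funext x
  simp

section Averages
variable {c d : ℝ} {f g u : Cyl n → ℝ}

theorem MemLp.slab_one (hu : MemLp u 2 (volOmega n)) (hc : 0 ≤ c) (hd : d ≤ 1) :
    MemLp u 2 (slab n c d 1) := hu.mono_measure (slab_one_le_volOmega hc hd)

theorem aestronglyMeasurable_avg_of_memLp (hu : MemLp u 2 (volOmega n)) (hc : 0 ≤ c)
    (hcd : c < d) (hd : d ≤ 1) :
    AEStronglyMeasurable (avg c d u) (volume : Measure (UnitAddTorus (Fin n))) :=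
  aestronglyMeasurable_avg hcd.le (MemLp.slab_one hu hc hd).1

theorem eLpNorm_avg_sub_avg_le (hf : MemLp f 2 (volOmega n)) (hg : MemLp g 2 (volOmega n))
    (hc : 0 ≤ c) (hcd : c < d) (hd : d ≤ 1) :
    eLpNorm (fun y => avg c d f y - avg c d g y) 2 (volume : Measure (UnitAddTorus (Fin n))) ≤
      ENNReal.ofReal (1 / √(d - c)) * eLpNorm (fun x => f x - g x) 2 (volOmega n) := by
  have h1 := MemLp.slab_one hf hc hd
  have h2 := MemLp.slab_one hg hc hd
  rw [← eLpNorm_congr_ae (avg_sub_ae hcd.le (h1.integrable (by norm_num))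
    (h2.integrable (by norm_num))), ← inv_sqrt_eq (sub_pos.2 hcd)]
  refine (eLpNorm_avg_le hcd (h1.1.sub h2.1)).trans ?_
  gcongr
  exact eLpNorm_mono_measure _ (slab_one_le_volOmega hc hd)

/-- Averages over `(r, d)` and `(0, d)` are close for small `r`. -/
theorem eLpNorm_avg_shift_le (hu : MemLp u 2 (volOmega n)) {r : ℝ} (hr : 0 < r) (hrd : r < d)
    (hd : d ≤ 1) :
    eLpNorm (fun y => avg r d u y - avg 0 d u y) 2 (volume : Measure (UnitAddTorus (Fin n))) ≤
      ENNReal.ofReal (r / (d - r) * (1 / √d) + √r / (d - r)) * eLpNorm u 2 (volOmega n) := by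
  have hd0 : 0 < d := hr.trans hrd
  -- From `d · avg 0 d = r · avg 0 r + (d - r) · avg r d`. The average over `(0, r)` costs
  -- `r^(-1/2)`, which the factor `r / (d - r)` outweighs.
  have e : (fun y => avg r d u y - avg 0 d u y) =ᵐ[(volume : Measure (UnitAddTorus (Fin n)))]
      (r / (d - r)) • (avg 0 d u - avg 0 r u) := by
    have hi := (MemLp.slab_one hu le_rfl hd).integrable (by norm_num)
    rw [ThinLayer.slab_one] at hi
    filter_upwards [hi.prod_right_ae] with y hy
    have h1 : ∀ a b, 0 ≤ a → a ≤ b → b ≤ d → IntervalIntegrable (fun s => u (y, s)) volume a b := by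
      intro a b ha hab hb
      rw [intervalIntegrable_iff_integrableOn_Ioo_of_le hab]
      exact IntegrableOn.mono_set hy (Ioo_subset_Ioo ha hb)
    have h2 := intervalIntegral.integral_add_adjacent_intervals
      (h1 0 r le_rfl hr.le hrd.le) (h1 r d hr.le hrd.le le_rfl)
    simp only [Pi.smul_apply, Pi.sub_apply, avg, ← h2, smul_eq_mul, sub_zero]
    have : d - r ≠ 0 := (sub_pos.2 hrd).ne'
    field_simp
    ring
  have hm1 := MemLp.slab_one hu le_rfl hd
  have hm2 := MemLp.slab_one hu le_rfl (hrd.le.trans hd)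
  have hq : 0 ≤ r / (d - r) := div_nonneg hr.le (sub_pos.2 hrd).le
  rw [eLpNorm_congr_ae e, eLpNorm_const_smul, Real.enorm_eq_ofReal hq]
  have h3 : eLpNorm (avg 0 d u - avg 0 r u) 2 (volume : Measure (UnitAddTorus (Fin n))) ≤
      ENNReal.ofReal (1 / √d + 1 / √r) * eLpNorm u 2 (volOmega n) := by
    refine (eLpNorm_sub_le (aestronglyMeasurable_avg hd0.le hm1.1)
      (aestronglyMeasurable_avg hr.le hm2.1) (by norm_num)).trans ?_
    rw [ENNReal.ofReal_add (by positivity) (by positivity), add_mul]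
    have h4 := eLpNorm_avg_le hd0 hm1.1
    have h5 := eLpNorm_avg_le hr hm2.1
    rw [sub_zero, inv_sqrt_eq hd0] at h4
    rw [sub_zero, inv_sqrt_eq hr] at h5
    refine add_le_add (h4.trans ?_) (h5.trans ?_)
    · gcongr
      exact slab_one_le_volOmega le_rfl hd
    · gcongr
      exact slab_one_le_volOmega le_rfl (hrd.le.trans hd)
  calc _ ≤ ENNReal.ofReal (r / (d - r)) *
        (ENNReal.ofReal (1 / √d + 1 / √r) * eLpNorm u 2 (volOmega n)) := by gcongr
    _ = _ := by
      rw [← mul_assoc, ← ENNReal.ofReal_mul hq]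
      congr 2
      have : r = √r * √r := (Real.mul_self_sqrt hr.le).symm
      have hs : √r ≠ 0 := (Real.sqrt_pos.2 hr).ne'
      have : r / (d - r) * (1 / √r) = √r / (d - r) := by
        field_simp
        rw [Real.sq_sqrt hr.le]
      rw [mul_add, this]

theorem tendsto_eLpNorm_avg_shift (hu : MemLp u 2 (volOmega n)) (hd0 : 0 < d) (hd : d ≤ 1) :
    Tendsto (fun r => eLpNorm (fun y => avg r d u y - avg 0 d u y) 2
      (volume : Measure (UnitAddTorus (Fin n)))) (𝓝[>] 0) (𝓝 0) := by
  have hc : ContinuousAt (fun r => r / (d - r) * (1 / √d) + √r / (d - r)) 0 := by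
    have : d - 0 ≠ 0 := by simpa using hd0.ne'
    fun_prop (disch := assumption)
  have h1 : Tendsto (fun r => ENNReal.ofReal (r / (d - r) * (1 / √d) + √r / (d - r)) *
      eLpNorm u 2 (volOmega n)) (𝓝[>] 0) (𝓝 0) := by
    have h2 : Tendsto (fun r => r / (d - r) * (1 / √d) + √r / (d - r)) (𝓝[>] 0) (𝓝 0) := by
      have := hc.tendsto.mono_left (nhdsWithin_le_nhds (s := Ioi 0))
      simpa using this
    simpa using ENNReal.Tendsto.mul_const (ENNReal.tendsto_ofReal h2) (Or.inr hu.2.ne)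
  refine tendsto_of_tendsto_of_tendsto_of_le_of_le' tendsto_const_nhds h1
    (Eventually.of_forall fun _ => zero_le) ?_
  filter_upwards [Ioo_mem_nhdsGT hd0] with r hr
  exact eLpNorm_avg_shift_le hu hr.1 hr.2 hd

theorem slab_le_smul {c d δ : ℝ} (hδ : 0 ≤ δ) (hcδ : δ ≤ c) (hd : d ≤ 1 / 2) {W : ℝ → ℝ≥0∞} {C : ℝ≥0∞}
    (hW : ∀ σ ∈ Ioo c d, W σ ≤ C) :
    slab n c d W ≤ C • (volOmega n).restrict (innerDomain n δ) := by
  have h1 : (volume.restrict (Ioo c d)).withDensity W ≤ C • volume.restrict (Ioo c d) := by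
    rw [← withDensity_const]
    refine withDensity_mono ?_
    filter_upwards [ae_restrict_mem measurableSet_Ioo] with σ hσ
    exact hW σ hσ
  have h2 : (volume : Measure (UnitAddTorus (Fin n))).prod (volume.restrict (Ioo c d)) ≤
      (volOmega n).restrict (innerDomain n δ) := by
    rw [volOmega_restrict_innerDomain, Measure.volume_eq_prod, ← Measure.restrict_univ
      (μ := (volume : Measure (UnitAddTorus (Fin n)))), Measure.prod_restrict, Measure.restrict_univ]
    refine Measure.restrict_mono (fun x hx => ?_) le_rfl
    have := hx.2
    rw [mem_Ioo] at this
    refine ⟨⟨mem_univ _, by linarith, by linarith⟩, le_min (by linarith) (by linarith)⟩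
  calc slab n c d W ≤ (volume : Measure (UnitAddTorus (Fin n))).prod
        (C • volume.restrict (Ioo c d)) := Measure.prod_mono le_rfl h1
    _ = C • (volume : Measure (UnitAddTorus (Fin n))).prod (volume.restrict (Ioo c d)) :=
        Measure.prod_smul_right C
    _ ≤ _ := by gcongr

theorem memLp_of_continuous {F : Type*} [NormedAddCommGroup F]
    [SecondCountableTopologyEither (Cyl n) F] {f : Cyl n → F} (hc : Continuous f) :
    MemLp f 2 (volOmega n) := by
  obtain ⟨C, hC⟩ := ((isCompact_univ (X := UnitAddTorus (Fin n))).prod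
    (isCompact_Icc (a := (0 : ℝ)) (b := 1))).exists_bound_of_continuousOn hc.continuousOn
  refine MemLp.of_bound hc.aestronglyMeasurable C ?_
  filter_upwards [ae_mem_Omega n] with x hx
  exact hC x ⟨mem_univ _, Ioo_subset_Icc_self hx.2⟩

theorem memLp_of_contDiff {ψ : Cyl n → ℝ} (h : ContDiff ℝ 1 (ψ ∘ cover n)) :
    MemLp ψ 2 (volOmega n) := memLp_of_continuous (continuous_of_contDiff h)

theorem tendsto_slab_of_inner {ψ : ℕ → Cyl n → ℝ} {g : Cyl n → ℝ} {c d : ℝ} (hc : 0 < c)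
    (hd : d ≤ 1 / 2) {W : ℝ → ℝ≥0∞} {C : ℝ≥0∞} (hC : C ≠ ⊤) (hW : ∀ σ ∈ Ioo c d, W σ ≤ C)
    (h : Tendsto (fun k => eLpNorm (fun x => ψ k x - g x) 2
      ((volOmega n).restrict (innerDomain n c))) atTop (𝓝 0)) :
    Tendsto (fun k => eLpNorm (fun x => ψ k x - g x) 2 (slab n c d W)) atTop (𝓝 0) := by
  have h1 : Tendsto (fun k => C ^ (1 / (2 : ℝ≥0∞)).toReal * eLpNorm (fun x => ψ k x - g x) 2
      ((volOmega n).restrict (innerDomain n c))) atTop (𝓝 0) := by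
    have := ENNReal.Tendsto.const_mul (a := C ^ (1 / (2 : ℝ≥0∞)).toReal) h
      (Or.inr (ENNReal.rpow_ne_top_of_nonneg ENNReal.toReal_nonneg hC))
    simpa using this
  exact tendsto_of_tendsto_of_tendsto_of_le_of_le tendsto_const_nhds h1 (fun _ => zero_le)
    fun k => eLpNorm_le_of_measure_le_smul (slab_le_smul hc.le le_rfl hd hW)

/-- Comparison of the averages over `(r, ε)` and `(ε, δ)`. -/
theorem NormalApprox.eLpNorm_avg_sub_avg_le (h : NormalApprox u g) (hu : MemLp u 2 (volOmega n))
    {r ε δ : ℝ} (hr : 0 < r) (hrε : r < ε) (hεδ : ε < δ) (hδ : δ ≤ 1 / 2)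
    (hg : AEStronglyMeasurable g ((volOmega n).restrict (innerDomain n r)))
    {W : ℝ → ℝ≥0∞} (hWm : AEMeasurable W (volume.restrict (Ioo r ε)))
    (hW0 : ∀ σ ∈ Ioo r ε, W σ ≠ 0) {C : ℝ≥0∞} (hC : C ≠ ⊤) (hW : ∀ σ ∈ Ioo r ε, W σ ≤ C)
    (hB : ∫⁻ s in Ioo r ε, resist W ε s ^ (1 / 2 : ℝ) ≠ ⊤) :
    eLpNorm (fun y => avg r ε u y - avg ε δ u y) 2 (volume : Measure (UnitAddTorus (Fin n))) ≤
      (ENNReal.ofReal (ε - r))⁻¹ * (∫⁻ s in Ioo r ε, resist W ε s ^ (1 / 2 : ℝ)) *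
        eLpNorm g 2 (slab n r ε W) +
      ENNReal.ofReal (δ - ε) ^ (1 / 2 : ℝ) * eLpNorm g 2 (slab n ε δ 1) := by
  obtain ⟨ψ, h1, h2, h3⟩ := h
  set B := (ENNReal.ofReal (ε - r))⁻¹ * (∫⁻ s in Ioo r ε, resist W ε s ^ (1 / 2 : ℝ)) with hBdef
  have hBt : B ≠ ⊤ := ENNReal.mul_ne_top
    (ENNReal.inv_ne_top.2 (by simpa using hrε)) hB
  set D := ENNReal.ofReal (δ - ε) ^ (1 / 2 : ℝ)
  have hDt : D ≠ ⊤ := ENNReal.rpow_ne_top_of_nonneg (by norm_num) ENNReal.ofReal_ne_top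
  have hε : 0 < ε := hr.trans hrε
  have t1 := tendsto_slab_of_inner hr (by linarith) hC hW (h3 r hr)
  have t2 := tendsto_slab_of_inner (W := 1) hε hδ ENNReal.one_ne_top (fun _ _ => le_rfl) (h3 ε hε)
  have gm1 : AEStronglyMeasurable g (slab n r ε W) :=
    hg.mono_ac ((Measure.absolutelyContinuous_of_le
      (slab_le_smul hr.le le_rfl (by linarith) hW)).trans Measure.smul_absolutelyContinuous)
  have gm2 : AEStronglyMeasurable g (slab n ε δ 1) :=
    hg.mono_ac ((Measure.absolutelyContinuous_of_le
      (slab_le_smul (C := 1) hr.le hrε.le hδ fun _ _ => le_rfl)).trans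
        Measure.smul_absolutelyContinuous)
  -- The chain is: average of `u` over `(r, ε)`, the same for `ψ k`, the value of `ψ k` at the
  -- common height `ε`, the average of `ψ k` over `(ε, δ)`, the same for `u`. The outer errors
  -- vanish as `k → ∞`, since `r`, `ε` and `δ` are fixed.
  have key : ∀ k, eLpNorm (fun y => avg r ε u y - avg ε δ u y) 2
        (volume : Measure (UnitAddTorus (Fin n))) ≤
      ENNReal.ofReal (1 / √(ε - r)) * eLpNorm (fun x => ψ k x - u x) 2 (volOmega n) +
      (B * (eLpNorm (fun x => pderiv (Fin.last n) (ψ k) x - g x) 2 (slab n r ε W) +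
        eLpNorm g 2 (slab n r ε W)) +
      (D * (eLpNorm (fun x => pderiv (Fin.last n) (ψ k) x - g x) 2 (slab n ε δ 1) +
        eLpNorm g 2 (slab n ε δ 1)) +
      ENNReal.ofReal (1 / √(δ - ε)) * eLpNorm (fun x => ψ k x - u x) 2 (volOmega n))) := by
    intro k
    have hψ := memLp_of_contDiff (h1 k)
    have hε1 : ε ≤ 1 := by linarith
    have hδ1 : δ ≤ 1 := by linarith
    have m1 := aestronglyMeasurable_avg_of_memLp hu hr.le hrε hε1
    have m2 := aestronglyMeasurable_avg_of_memLp hψ hr.le hrε hε1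
    have m3 : AEStronglyMeasurable (fun y => ψ k (y, ε))
        (volume : Measure (UnitAddTorus (Fin n))) :=
      ((continuous_of_contDiff (h1 k)).comp (by fun_prop :
        Continuous fun y : UnitAddTorus (Fin n) => (y, ε))).aestronglyMeasurable
    have m4 := aestronglyMeasurable_avg_of_memLp hψ hε.le hεδ hδ1
    have m5 := aestronglyMeasurable_avg_of_memLp hu hε.le hεδ hδ1
    have dm : ∀ μ : Measure (Cyl n), AEStronglyMeasurable (pderiv (Fin.last n) (ψ k)) μ := fun _ =>
      (continuous_pderiv (h1 k) (Fin.last n)).aestronglyMeasurable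
    refine (eLpNorm_sub_triangle m1 m2 m5).trans (add_le_add ?_
      ((eLpNorm_sub_triangle m2 m3 m5).trans (add_le_add ?_
      ((eLpNorm_sub_triangle m3 m4 m5).trans (add_le_add ?_ ?_)))))
    · refine (ThinLayer.eLpNorm_avg_sub_avg_le hu hψ hr.le hrε hε1).trans_eq ?_
      rw [← eLpNorm_neg]
      congr 2
      funext x
      simp
    · refine (eLpNorm_avg_sub_le (h1 k) hrε ⟨hrε.le, le_rfl⟩ hWm hW0 hC hW).trans ?_
      rw [← hBdef]
      gcongr
      refine le_trans (le_of_eq ?_) (eLpNorm_add_le ((dm _).sub gm1) gm1 (by norm_num))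
      congr 1
      funext x
      simp
    · rw [← eLpNorm_neg]
      have := eLpNorm_avg_sub_le_one (h1 k) hεδ (p := ε) ⟨le_rfl, hεδ.le⟩
      refine le_trans (le_of_eq ?_) (this.trans ?_)
      · congr 1
        funext x
        simp
      · gcongr
        refine le_trans (le_of_eq ?_) (eLpNorm_add_le ((dm _).sub gm2) gm2 (by norm_num))
        congr 1
        funext x
        simp
    · exact ThinLayer.eLpNorm_avg_sub_avg_le hψ hu hε.le hεδ hδ1
  have hlim := (ENNReal.Tendsto.const_mul (a := ENNReal.ofReal (1 / √(ε - r))) h2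
      (Or.inr ENNReal.ofReal_ne_top)).add
    ((ENNReal.Tendsto.const_mul (a := B) (t1.add_const (eLpNorm g 2 (slab n r ε W)))
      (Or.inr hBt)).add
    ((ENNReal.Tendsto.const_mul (a := D) (t2.add_const (eLpNorm g 2 (slab n ε δ 1)))
      (Or.inr hDt)).add
    (ENNReal.Tendsto.const_mul (a := ENNReal.ofReal (1 / √(δ - ε))) h2
      (Or.inr ENNReal.ofReal_ne_top))))
  simp only [mul_zero, zero_add, add_zero] at hlim
  exact ge_of_tendsto' hlim key

/-- Comparison of the averages over `(0, ε)` and `(ε, δ)`. -/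
theorem NormalApprox.eLpNorm_avg_zero_sub_avg_le (h : NormalApprox u g)
    (hu : MemLp u 2 (volOmega n)) {ε δ : ℝ} (hε : 0 < ε) (hεδ : ε < δ) (hδ : δ ≤ 1 / 2)
    (hg : ∀ r : ℝ, 0 < r → AEStronglyMeasurable g ((volOmega n).restrict (innerDomain n r)))
    {W : ℝ → ℝ≥0∞} (hWm : AEMeasurable W (volume.restrict (Ioo 0 ε)))
    (hW0 : ∀ σ ∈ Ioo 0 ε, W σ ≠ 0) {C : ℝ≥0∞} (hC : C ≠ ⊤) (hW : ∀ σ ∈ Ioo 0 ε, W σ ≤ C)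
    (hB : ∫⁻ s in Ioo 0 ε, resist W ε s ^ (1 / 2 : ℝ) ≠ ⊤)
    {M : ℝ≥0∞} (hM : M ≠ ⊤) (hM1 : eLpNorm g 2 (slab n 0 ε W) ≤ M)
    (hM2 : eLpNorm g 2 (slab n ε δ 1) ≤ M) :
    eLpNorm (fun y => avg 0 ε u y - avg ε δ u y) 2 (volume : Measure (UnitAddTorus (Fin n))) ≤
      (ENNReal.ofReal ε)⁻¹ * (∫⁻ s in Ioo 0 ε, resist W ε s ^ (1 / 2 : ℝ)) * M +
      ENNReal.ofReal (δ - ε) ^ (1 / 2 : ℝ) * M := by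
  set I := ∫⁻ s in Ioo 0 ε, resist W ε s ^ (1 / 2 : ℝ)
  set D := ENNReal.ofReal (δ - ε) ^ (1 / 2 : ℝ)
  -- The normal derivatives of the approximants converge only away from the boundary, hence the
  -- detour through `(r, ε)`. Since `u` is square integrable up to the boundary and the bounds are
  -- uniform in `r`, one may let `r ↓ 0`.
  have hlim : Tendsto (fun r => eLpNorm (fun y => avg r ε u y - avg 0 ε u y) 2
      (volume : Measure (UnitAddTorus (Fin n))) + ((ENNReal.ofReal (ε - r))⁻¹ * I * M + D * M))
      (𝓝[>] 0) (𝓝 (0 + ((ENNReal.ofReal ε)⁻¹ * I * M + D * M))) := by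
    refine (tendsto_eLpNorm_avg_shift hu hε (by linarith)).add (Tendsto.add_const _ ?_)
    simp only [mul_assoc]
    refine ENNReal.Tendsto.mul_const ?_ (Or.inr (ENNReal.mul_ne_top hB hM))
    refine tendsto_inv_iff.2 (ENNReal.tendsto_ofReal ?_)
    have : Tendsto (fun r : ℝ => ε - r) (𝓝 0) (𝓝 (ε - 0)) := tendsto_const_nhds.sub tendsto_id
    rw [sub_zero] at this
    exact this.mono_left nhdsWithin_le_nhds
  rw [zero_add] at hlim
  refine ge_of_tendsto hlim ?_
  filter_upwards [Ioo_mem_nhdsGT hε] with r hr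
  have hsub : Ioo r ε ⊆ Ioo 0 ε := Ioo_subset_Ioo_left hr.1.le
  have hI : ∫⁻ s in Ioo r ε, resist W ε s ^ (1 / 2 : ℝ) ≤ I := lintegral_mono_set hsub
  have hs : slab n r ε W ≤ slab n 0 ε W := by
    refine Measure.prod_mono le_rfl ?_
    refine Measure.le_iff.2 fun s hs => ?_
    rw [withDensity_apply _ hs, withDensity_apply _ hs]
    exact lintegral_mono' (Measure.restrict_mono le_rfl (Measure.restrict_mono hsub le_rfl)) le_rfl
  have key := h.eLpNorm_avg_sub_avg_le hu hr.1 hr.2 hεδ hδ (hg r hr.1)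
    (hWm.mono_measure (Measure.restrict_mono hsub le_rfl)) (fun σ hσ => hW0 σ (hsub hσ)) hC
    (fun σ hσ => hW σ (hsub hσ)) (ne_top_of_le_ne_top hB hI)
  have m1 := aestronglyMeasurable_avg_of_memLp hu le_rfl hε (by linarith)
  have m2 := aestronglyMeasurable_avg_of_memLp hu hr.1.le hr.2 (by linarith)
  have m3 := aestronglyMeasurable_avg_of_memLp hu hε.le hεδ (by linarith)
  refine (eLpNorm_sub_triangle m1 m2 m3).trans (add_le_add (le_of_eq ?_) (key.trans ?_))
  · rw [← eLpNorm_neg]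
    congr 1
    funext x
    simp
  · gcongr
    exact (eLpNorm_mono_measure _ hs).trans hM1

/-- The trace is close to the averages. -/
theorem eLpNorm_avg_sub_limit_le {ι : Type*} {l : Filter ι} [l.NeBot] {e : ι → ℝ}
    (he : Tendsto e l (𝓝[>] 0)) {U : ι → Cyl n → ℝ} {v : UnitAddTorus (Fin n) → ℝ}
    (hv : AEStronglyMeasurable v (volume : Measure (UnitAddTorus (Fin n))))
    (hU : ∀ i, MemLp (U i) 2 (volOmega n)) (hu : MemLp u 2 (volOmega n))
    (hUu : Tendsto (fun i => eLpNorm (fun x => U i x - u x) 2 (volOmega n)) l (𝓝 0))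
    (hUv : Tendsto (fun i => eLpNorm (fun y => avg 0 (e i) (U i) y - v y) 2
      (volume : Measure (UnitAddTorus (Fin n)))) l (𝓝 0))
    {B : ι → ℝ≥0∞} (hB : Tendsto B l (𝓝 0)) {M : ℝ≥0∞} (hM : M ≠ ⊤) {δ : ℝ} (hδ0 : 0 < δ)
    (hδ : δ ≤ 1 / 2)
    (h : ∀ᶠ i in l, eLpNorm (fun y => avg 0 (e i) (U i) y - avg (e i) δ (U i) y) 2
      (volume : Measure (UnitAddTorus (Fin n))) ≤
        B i * M + ENNReal.ofReal (δ - e i) ^ (1 / 2 : ℝ) * M) :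
    eLpNorm (fun y => avg 0 δ u y - v y) 2 (volume : Measure (UnitAddTorus (Fin n))) ≤
      ENNReal.ofReal δ ^ (1 / 2 : ℝ) * M := by
  have he0 : Tendsto e l (𝓝 0) := he.mono_right nhdsWithin_le_nhds
  have hpos : ∀ᶠ i in l, 0 < e i := he.eventually self_mem_nhdsWithin
  -- This keeps the width of `(e i, δ)` above `δ/2`, so the constant in the comparison of `u` with
  -- `U i` does not depend on `i`.
  have hlt : ∀ᶠ i in l, e i < δ / 2 := he0.eventually_lt_const (by linarith)
  have l1 := (tendsto_eLpNorm_avg_shift hu hδ0 (by linarith)).comp he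
  have l2 : Tendsto (fun i => ENNReal.ofReal (1 / √(δ / 2)) *
      eLpNorm (fun x => U i x - u x) 2 (volOmega n)) l (𝓝 0) := by
    simpa using ENNReal.Tendsto.const_mul (a := ENNReal.ofReal (1 / √(δ / 2))) hUu
      (Or.inr ENNReal.ofReal_ne_top)
  have l3 : Tendsto (fun i => B i * M) l (𝓝 0) := by
    simpa using ENNReal.Tendsto.mul_const hB (Or.inr hM)
  have hlim := l1.add (l2.add ((l3.add_const (ENNReal.ofReal δ ^ (1 / 2 : ℝ) * M)).add hUv))
  simp only [zero_add, add_zero] at hlim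
  refine ge_of_tendsto hlim ?_
  filter_upwards [hpos, hlt, h] with i h1 h2 h3
  have hed : e i < δ := by linarith
  have m1 := aestronglyMeasurable_avg_of_memLp hu le_rfl hδ0 (by linarith)
  have m2 := aestronglyMeasurable_avg_of_memLp hu h1.le hed (by linarith)
  have m3 := aestronglyMeasurable_avg_of_memLp (hU i) h1.le hed (by linarith)
  have m4 := aestronglyMeasurable_avg_of_memLp (hU i) le_rfl h1 (by linarith)
  refine (eLpNorm_sub_triangle m1 m2 hv).trans (add_le_add (le_of_eq ?_)
    ((eLpNorm_sub_triangle m2 m3 hv).trans (add_le_add ?_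
    ((eLpNorm_sub_triangle m3 m4 hv).trans (add_le_add ?_ le_rfl)))))
  · rw [← eLpNorm_neg]
    congr 1
    funext x
    simp
  · refine (ThinLayer.eLpNorm_avg_sub_avg_le hu (hU i) h1.le hed (by linarith)).trans ?_
    rw [← eLpNorm_neg]
    refine mul_le_mul' ?_ (le_of_eq ?_)
    · apply ENNReal.ofReal_le_ofReal
      apply one_div_le_one_div_of_le
      · exact Real.sqrt_pos.2 (by linarith)
      · exact Real.sqrt_le_sqrt (by linarith)
    · congr 1
      funext x
      simp
  · rw [← eLpNorm_neg]
    refine le_trans (le_of_eq ?_) (h3.trans ?_)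
    · congr 1
      funext x
      simp
    · gcongr
      linarith

/-- Convergence of traces. -/
theorem tendsto_trace {ψ : ℕ → Cyl n → ℝ} (hψ : ∀ k, ContDiff ℝ 1 (ψ k ∘ cover n))
    (hu : MemLp u 2 (volOmega n))
    (hψu : Tendsto (fun k => eLpNorm (fun x => ψ k x - u x) 2 (volOmega n)) atTop (𝓝 0))
    {M : ℝ≥0∞} (hM : M ≠ ⊤)
    (hψM : ∀ᶠ k in atTop, eLpNorm (pderiv (Fin.last n) (ψ k)) 2 (volOmega n) ≤ M)
    {v : UnitAddTorus (Fin n) → ℝ}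
    (hv : AEStronglyMeasurable v (volume : Measure (UnitAddTorus (Fin n))))
    (h : ∀ δ : ℝ, 0 < δ → δ ≤ 1 / 2 →
      eLpNorm (fun y => avg 0 δ u y - v y) 2 (volume : Measure (UnitAddTorus (Fin n))) ≤
        ENNReal.ofReal δ ^ (1 / 2 : ℝ) * M) :
    Tendsto (fun k => eLpNorm (fun y => ψ k (y, 0) - v y) 2
      (volume : Measure (UnitAddTorus (Fin n)))) atTop (𝓝 0) := by
  rw [ENNReal.tendsto_nhds_zero]
  intro η hη
  have hsq : Tendsto (fun δ : ℝ => ENNReal.ofReal δ ^ (1 / 2 : ℝ) * M +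
      ENNReal.ofReal δ ^ (1 / 2 : ℝ) * M) (𝓝[>] 0) (𝓝 0) := by
    have h1 : Tendsto (fun δ : ℝ => ENNReal.ofReal δ ^ (1 / 2 : ℝ)) (𝓝[>] 0) (𝓝 0) := by
      have hc : Continuous fun δ : ℝ => ENNReal.ofReal δ ^ (1 / 2 : ℝ) :=
        ENNReal.continuous_rpow_const.comp ENNReal.continuous_ofReal
      have := (hc.tendsto 0).mono_left (nhdsWithin_le_nhds (s := Ioi 0))
      rwa [ENNReal.ofReal_zero, ENNReal.zero_rpow_of_pos (by norm_num)] at this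
    have h2 := ENNReal.Tendsto.mul_const (b := M) h1 (Or.inr hM)
    simpa using h2.add h2
  -- First `δ` is chosen so that both errors of size `δ^(1/2) M` fit below `η`; only then is `k`
  -- taken large, at this fixed `δ`.
  obtain ⟨δ, hδη, hδ⟩ := ((hsq.eventually_lt_const hη).and
    (Ioo_mem_nhdsGT (show (0 : ℝ) < 1 / 2 by norm_num))).exists
  have l2 : Tendsto (fun k => ENNReal.ofReal (1 / √(δ - 0)) *
      eLpNorm (fun x => ψ k x - u x) 2 (volOmega n) + (ENNReal.ofReal δ ^ (1 / 2 : ℝ) * M +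
      ENNReal.ofReal δ ^ (1 / 2 : ℝ) * M)) atTop (𝓝 (ENNReal.ofReal δ ^ (1 / 2 : ℝ) * M +
      ENNReal.ofReal δ ^ (1 / 2 : ℝ) * M)) := by
    simpa using (ENNReal.Tendsto.const_mul (a := ENNReal.ofReal (1 / √(δ - 0))) hψu
      (Or.inr ENNReal.ofReal_ne_top)).add_const (ENNReal.ofReal δ ^ (1 / 2 : ℝ) * M +
      ENNReal.ofReal δ ^ (1 / 2 : ℝ) * M)
  filter_upwards [l2.eventually_lt_const hδη, hψM] with k hk hkM
  refine le_trans ?_ hk.le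
  have hψ2 := memLp_of_contDiff (hψ k)
  have m1 : AEStronglyMeasurable (fun y => ψ k (y, 0))
      (volume : Measure (UnitAddTorus (Fin n))) :=
    ((continuous_of_contDiff (hψ k)).comp (by fun_prop :
      Continuous fun y : UnitAddTorus (Fin n) => (y, (0 : ℝ)))).aestronglyMeasurable
  have m2 := aestronglyMeasurable_avg_of_memLp hψ2 le_rfl hδ.1 (by linarith [hδ.2])
  have m3 := aestronglyMeasurable_avg_of_memLp hu le_rfl hδ.1 (by linarith [hδ.2])
  have e1 : eLpNorm (fun y => ψ k (y, 0) - avg 0 δ (ψ k) y) 2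
      (volume : Measure (UnitAddTorus (Fin n))) ≤ ENNReal.ofReal δ ^ (1 / 2 : ℝ) * M := by
    have := eLpNorm_avg_sub_le_one (hψ k) hδ.1 (p := 0) ⟨le_rfl, hδ.1.le⟩
    rw [← eLpNorm_neg, sub_zero] at this
    refine le_trans (le_of_eq ?_) (this.trans ?_)
    · congr 1
      funext x
      simp
    · gcongr
      exact (eLpNorm_mono_measure _ (slab_one_le_volOmega le_rfl (by linarith [hδ.2]))).trans hkM
  have e2 := ThinLayer.eLpNorm_avg_sub_avg_le hψ2 hu le_rfl hδ.1 (by linarith [hδ.2])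
  calc _ ≤ _ := (eLpNorm_sub_triangle m1 m2 hv).trans
        (add_le_add le_rfl (eLpNorm_sub_triangle m2 m3 hv))
    _ ≤ _ := add_le_add e1 (add_le_add e2 (h δ hδ.1 hδ.2.le))
    _ = _ := by ring

end Averages

/-! ### Weak limits of gradients -/

/-- Banach–Alaoglu, transported by the Riesz isomorphism. Along an ultrafilter the limit exists
without passing to a subsequence. -/
theorem exists_weak_limit {H ι : Type*} [NormedAddCommGroup H] [InnerProductSpace ℝ H]
    [CompleteSpace H] (U : Ultrafilter ι) {h : ι → H} {M : ℝ} (hM : ∀ᶠ i in U, ‖h i‖ ≤ M) :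
    ∃ h₀ : H, ‖h₀‖ ≤ M ∧ ∀ x, Tendsto (fun i => inner ℝ (h i) x) U (𝓝 (inner ℝ h₀ x)) := by
  have hK := WeakDual.isCompact_closedBall (𝕜 := ℝ) (E := H) 0 M
  let f : ι → WeakDual ℝ H := fun i => StrongDual.toWeakDual (InnerProductSpace.toDual ℝ H (h i))
  have hf : ((U.map f : Ultrafilter _) : Filter _) ≤
      𝓟 (WeakDual.toStrongDual ⁻¹' Metric.closedBall (0 : StrongDual ℝ H) M) := by
    rw [le_principal_iff, Ultrafilter.coe_map, mem_map]
    filter_upwards [hM] with i hi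
    simpa [f] using hi
  obtain ⟨x, hx, hlim⟩ := hK.ultrafilter_le_nhds (U.map f) hf
  refine ⟨(InnerProductSpace.toDual ℝ H).symm (WeakDual.toStrongDual x), ?_, fun y => ?_⟩
  · simpa using hx
  · have h1 : Tendsto f U (𝓝 x) := hlim
    have h2 := ((WeakDual.eval_continuous y).tendsto x).comp h1
    simpa [f, Function.comp_def] using h2

theorem IsTest.contDiff_one {φ : Cyl n → ℝ} (h : IsTest φ) : ContDiff ℝ 1 (φ ∘ cover n) :=
  h.1.of_le (by simp)

theorem IsTest.continuous {φ : Cyl n → ℝ} (h : IsTest φ) : Continuous φ :=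
  continuous_of_contDiff h.contDiff_one

theorem IsTest.exists_bound {φ : Cyl n → ℝ} (h : IsTest φ) : ∃ C, ∀ x, |φ x| ≤ C :=
  exists_bound_of_compact h.continuous h.2.1

theorem IsTest.exists_bound_pderiv {φ : Cyl n → ℝ} (h : IsTest φ) (i : Fin (n + 1)) :
    ∃ C, ∀ x, |pderiv i φ x| ≤ C := by
  obtain ⟨C, hC⟩ := exists_bound_of_compact (continuous_cderiv h.contDiff_one)
    (hasCompactSupport_cderiv h.2.1)
  refine ⟨C, fun x => ?_⟩
  rw [pderiv_eq_cderiv h.contDiff_one, ← Real.norm_eq_abs]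
  refine (ContinuousLinearMap.le_opNorm _ _).trans ?_
  simpa using hC x

theorem continuous_bdryDist : Continuous (bdryDist (n := n)) := by
  unfold bdryDist; fun_prop

theorem bdryDist_pos {x : Cyl n} (hx : x ∈ Omega n) : 0 < bdryDist x :=
  lt_min hx.2.1 (sub_pos.2 hx.2.2)

theorem bdryDist_le (x : Cyl n) : bdryDist x ≤ 1 / 2 := by
  unfold bdryDist
  rcases le_total x.2 (1 / 2) with h | h
  · exact (min_le_left _ _).trans h
  · exact (min_le_right _ _).trans (by linarith)

/-- The distance to the boundary has a positive minimum on the compact support. -/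
theorem IsTest.exists_support {φ : Cyl n → ℝ} (h : IsTest φ) :
    ∃ δ > 0, ∀ x, φ x ≠ 0 → x ∈ innerDomain n δ := by
  have hsub : ∀ x, φ x ≠ 0 → x ∈ tsupport φ := fun x hx => subset_tsupport φ hx
  rcases (tsupport φ).eq_empty_or_nonempty with h0 | h0
  · refine ⟨1, one_pos, fun x hx => ?_⟩
    exact absurd (h0 ▸ hsub x hx) (notMem_empty x)
  · obtain ⟨x₀, hx₀, hmin⟩ := (show IsCompact (tsupport φ) from h.2.1).exists_isMinOn h0
      (continuous_bdryDist (n := n)).continuousOn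
    exact ⟨bdryDist x₀, bdryDist_pos (h.2.2 hx₀), fun x hx => ⟨h.2.2 (hsub x hx), hmin (hsub x hx)⟩⟩

theorem IsWeakGrad.aestronglyMeasurable {u : Cyl n → ℝ}
    {G : Cyl n → EuclideanSpace ℝ (Fin (n + 1))} (h : IsWeakGrad u G) :
    AEStronglyMeasurable G (volOmega n) := by
  have h1 : AEStronglyMeasurable G
      ((volOmega n).restrict (⋃ k : ℕ, innerDomain n (1 / ((k : ℝ) + 1)))) :=
    aestronglyMeasurable_iUnion_iff.2 fun k => (h.1 _ (by positivity)).1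
  rwa [Measure.restrict_eq_self_of_ae_mem] at h1
  filter_upwards [ae_mem_Omega n] with x hx
  obtain ⟨k, hk⟩ := exists_nat_one_div_lt (bdryDist_pos hx)
  exact mem_iUnion.2 ⟨k, hx, hk.le⟩

theorem tendsto_integral_mul {ι : Type*} {l : Filter ι} {U : ι → Cyl n → ℝ} {u g : Cyl n → ℝ}
    (hU : ∀ i, MemLp (U i) 2 (volOmega n)) (hu : MemLp u 2 (volOmega n))
    (h : Tendsto (fun i => eLpNorm (fun x => U i x - u x) 2 (volOmega n)) l (𝓝 0))
    (hg : Continuous g) {C : ℝ} (hC : ∀ x, |g x| ≤ C) :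
    Tendsto (fun i => ∫ x, U i x * g x ∂(volOmega n)) l (𝓝 (∫ x, u x * g x ∂(volOmega n))) := by
  have hb : ∀ {f : Cyl n → ℝ}, MemLp f 2 (volOmega n) →
      Integrable (fun x => f x * g x) (volOmega n) := fun hf =>
    (hf.integrable (by norm_num)).mul_bdd hg.aestronglyMeasurable (Eventually.of_forall hC)
  refine tendsto_integral_of_L1 _ (hb hu).1 (Eventually.of_forall fun i => hb (hU i)) ?_
  have h1 : Tendsto (fun i => eLpNorm (fun x => U i x - u x) 2 (volOmega n) * ENNReal.ofReal C)
      l (𝓝 0) := by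
    simpa using ENNReal.Tendsto.mul_const (b := ENNReal.ofReal C) h (Or.inr ENNReal.ofReal_ne_top)
  refine tendsto_of_tendsto_of_tendsto_of_le_of_le tendsto_const_nhds h1 (fun _ => zero_le)
    fun i => ?_
  have hm : AEStronglyMeasurable (fun x => U i x - u x) (volOmega n) := (hU i).1.sub hu.1
  calc ∫⁻ x, ‖U i x * g x - u x * g x‖ₑ ∂(volOmega n)
      ≤ ∫⁻ x, ‖U i x - u x‖ₑ * ENNReal.ofReal C ∂(volOmega n) := by
        refine lintegral_mono fun x => ?_
        rw [← sub_mul, enorm_mul, ← ofReal_norm (g x)]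
        gcongr
        exact hC x
    _ = eLpNorm (fun x => U i x - u x) 1 (volOmega n) * ENNReal.ofReal C := by
        rw [lintegral_mul_const' _ _ ENNReal.ofReal_ne_top, eLpNorm_one_eq_lintegral_enorm]
    _ ≤ _ := by
        gcongr
        exact eLpNorm_le_eLpNorm_of_exponent_le (by norm_num) hm

/-! ### Consequences of admissibility -/

section Admissible

variable {p : ℝ} {a : ℝ → ℝ → ℝ}

/-- By the intermediate value theorem: `a ε` is continuous, has no zero on `(0, 1/2]`, and is at
least `c > 0` at `1/2`. -/
theorem Admissible.pos (h : Admissible p a) {ε : ℝ} (hε : ε ∈ Ioo (0 : ℝ) (1 / 2)) {d : ℝ}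
    (hd : d ∈ Ioc (0 : ℝ) (1 / 2)) : 0 < a ε d := by
  obtain ⟨c, hc, hlow⟩ := h.lower
  have h2 : 0 < a ε (1 / 2) := hc.trans_le (hlow ε hε _ ⟨hε.2.le, le_rfl⟩)
  by_contra! hneg
  obtain ⟨t, ht, ht0⟩ := intermediate_value_Icc hd.2
    ((h.continuousOn ε hε).mono (Icc_subset_Icc_left hd.1.le)) ⟨hneg, h2.le⟩
  exact h.ne_zero ε hε t ⟨hd.1.trans_le ht.1, ht.2⟩ ht0

theorem Admissible.continuousOn_comp (h : Admissible p a) {ε : ℝ} (hε : ε ∈ Ioo (0 : ℝ) (1 / 2)) :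
    ContinuousOn (fun x : Cyl n => a ε (bdryDist x)) (Omega n) :=
  (h.continuousOn ε hε).comp continuous_bdryDist.continuousOn
    fun _ hx => ⟨(bdryDist_pos hx).le, bdryDist_le _⟩

theorem Admissible.aestronglyMeasurable (h : Admissible p a) {ε : ℝ}
    (hε : ε ∈ Ioo (0 : ℝ) (1 / 2)) :
    AEStronglyMeasurable (fun x : Cyl n => a ε (bdryDist x)) (volOmega n) := by
  rw [volOmega_eq_restrict]
  exact (h.continuousOn_comp hε).aestronglyMeasurable (isOpen_Omega n).measurableSet

theorem Admissible.eventually_abs_sub_le (h : Admissible p a) {δ η : ℝ} (hδ : 0 < δ) (hη : 0 < η) :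
    ∀ᶠ ε in 𝓝[>] (0 : ℝ), ∀ x ∈ innerDomain n δ, |1 - a ε (bdryDist x)| ≤ η := by
  have h1 := (tendstoLocallyUniformlyOn_iff_tendstoUniformlyOn_of_compact
    (isCompact_Icc (a := δ) (b := 1 / 2))).1
    (h.tendsto_one.mono fun x hx => ⟨hδ.trans_le hx.1, hx.2⟩)
  filter_upwards [Metric.tendstoUniformlyOn_iff.1 h1 η hη] with ε hε x hx
  exact (hε _ ⟨hx.2, bdryDist_le x⟩).le

theorem enorm_sqrt_sq (w : ℝ) : ‖√w‖ₑ ^ 2 = ENNReal.ofReal w := by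
  rw [Real.enorm_eq_ofReal (Real.sqrt_nonneg _), ← ENNReal.ofReal_pow (Real.sqrt_nonneg _)]
  rcases le_total 0 w with h | h
  · rw [Real.sq_sqrt h]
  · rw [Real.sqrt_eq_zero_of_nonpos h, ENNReal.ofReal_of_nonpos h]
    simp

theorem abs_one_sub_sqrt_le {w : ℝ} (hw : 0 ≤ w) : |1 - √w| ≤ |1 - w| := by
  have h1 : 1 - w = (1 - √w) * (1 + √w) := by
    have := Real.sq_sqrt hw
    ring_nf
    rw [this]
  have h2 := Real.sqrt_nonneg w
  rw [h1, abs_mul]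
  refine le_mul_of_one_le_right (abs_nonneg _) ?_
  rw [abs_of_nonneg (by linarith)]
  linarith

/-- The part of the Dirichlet integral away from the boundary. -/
theorem lintegral_innerDomain_le {F : Type*} [NormedAddCommGroup F] {c : ℝ} {w : Cyl n → ℝ}
    {G : Cyl n → F} {δ : ℝ} (hw : ∀ x ∈ innerDomain n δ, c ≤ w x) (hc : 0 < c) {K : ℝ≥0∞}
    (hK : ∫⁻ x, ENNReal.ofReal (w x) * ‖G x‖ₑ ^ 2 ∂(volOmega n) ≤ K) :
    ∫⁻ x in innerDomain n δ, ‖G x‖ₑ ^ 2 ∂(volOmega n) ≤ K / ENNReal.ofReal c := by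
  have hc0 : ENNReal.ofReal c ≠ 0 := by simpa using hc
  rw [ENNReal.le_div_iff_mul_le (Or.inl hc0) (Or.inl ENNReal.ofReal_ne_top), mul_comm,
    ← lintegral_const_mul' _ _ ENNReal.ofReal_ne_top]
  refine le_trans ?_ ((setLIntegral_le_lintegral (innerDomain n δ) _).trans hK)
  refine setLIntegral_mono' (measurableSet_innerDomain n δ) fun x hx => ?_
  gcongr
  exact hw x hx

/-- The lower bound is the minimum of `a ε` over `[δ, 1/2]`. It depends on `ε` and `δ`, but it is
available for `δ < ε` as well, where the uniform constant `c` says nothing. -/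
theorem Admissible.memLp_innerDomain (h : Admissible p a) {ε : ℝ} (hε : ε ∈ Ioo (0 : ℝ) (1 / 2))
    {G : Cyl n → EuclideanSpace ℝ (Fin (n + 1))} (hG : AEStronglyMeasurable G (volOmega n))
    {K : ℝ≥0∞} (hKt : K ≠ ⊤)
    (hK : ∫⁻ x, ENNReal.ofReal (a ε (bdryDist x)) * ‖G x‖ₑ ^ 2 ∂(volOmega n) ≤ K) {δ : ℝ}
    (hδ : 0 < δ) : MemLp G 2 ((volOmega n).restrict (innerDomain n δ)) := by
  refine ⟨hG.restrict, ?_⟩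
  obtain ⟨c, hc, hlow⟩ : ∃ c, 0 < c ∧ ∀ x ∈ innerDomain n δ, c ≤ a ε (bdryDist x) := by
    rcases (Icc δ (1 / 2)).eq_empty_or_nonempty with h0 | h0
    · refine ⟨1, one_pos, fun x hx => ?_⟩
      have hm : bdryDist x ∈ Icc δ (1 / 2) := ⟨hx.2, bdryDist_le x⟩
      rw [h0] at hm
      exact absurd hm (notMem_empty _)
    · obtain ⟨d, hd, hmin⟩ := isCompact_Icc.exists_isMinOn h0
        ((h.continuousOn ε hε).mono (Icc_subset_Icc_left hδ.le))
      exact ⟨_, h.pos hε ⟨hδ.trans_le hd.1, hd.2⟩, fun x hx => hmin ⟨hx.2, bdryDist_le x⟩⟩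
  have h1 := lintegral_innerDomain_le hlow hc hK
  rw [← eLpNorm_two_sq] at h1
  by_contra hcon
  rw [not_lt, top_le_iff] at hcon
  rw [hcon] at h1
  simp only [ne_eq, OfNat.ofNat_ne_zero, not_false_eq_true, ENNReal.top_pow, top_le_iff] at h1
  exact ENNReal.div_ne_top hKt (by simpa using hc) h1

/-- Bounded energy gives a weak gradient of the limit. -/
theorem Admissible.exists_weakGrad_limit (h : Admissible p a) (U : Ultrafilter Param)
    (hU : (U : Filter Param) ≤ toZero) {u : Param → Cyl n → ℝ} {u₀ : Cyl n → ℝ}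
    (hu : ∀ ε, MemLp (u ε) 2 (volOmega n)) (hu₀ : MemLp u₀ 2 (volOmega n))
    (hlim : Tendsto (fun ε => eLpNorm (fun x => u ε x - u₀ x) 2 (volOmega n)) U (𝓝 0))
    {G : Param → Cyl n → EuclideanSpace ℝ (Fin (n + 1))}
    (hG : ∀ᶠ ε in U, IsWeakGrad (u ε) (G ε)) {K : ℝ≥0∞} (hKt : K ≠ ⊤)
    (hK : ∀ᶠ ε : Param in U,
      ∫⁻ x, ENNReal.ofReal (a ε (bdryDist x)) * ‖G ε x‖ₑ ^ 2 ∂(volOmega n) ≤ K) :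
    ∃ H : Cyl n → EuclideanSpace ℝ (Fin (n + 1)), MemLp H 2 (volOmega n) ∧ IsWeakGrad u₀ H ∧
      ∫⁻ x, ‖H x‖ₑ ^ 2 ∂(volOmega n) ≤ K := by
  classical
  have hzero : Tendsto (Subtype.val : Param → ℝ) U (𝓝[>] 0) := tendsto_comap.mono_left hU
  obtain ⟨c, hc, hlow⟩ := h.lower
  -- Unlike `G ε`, the weighted field is bounded in `L²` up to the boundary, and its squared norm is
  -- the Dirichlet integral itself.
  set F : Param → Cyl n → EuclideanSpace ℝ (Fin (n + 1)) := fun ε x =>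
    √(a ε (bdryDist x)) • G ε x with hF
  have hFsq : ∀ ε, ∫⁻ x, ‖F ε x‖ₑ ^ 2 ∂(volOmega n) =
      ∫⁻ x, ENNReal.ofReal (a ε (bdryDist x)) * ‖G ε x‖ₑ ^ 2 ∂(volOmega n) := fun ε => by
    refine lintegral_congr fun x => ?_
    rw [hF, enorm_smul, mul_pow, enorm_sqrt_sq]
  have hFm : ∀ᶠ ε in U, MemLp (F ε) 2 (volOmega n) ∧
      eLpNorm (F ε) 2 (volOmega n) ≤ K ^ (1 / 2 : ℝ) := by
    filter_upwards [hG, hK] with ε h1 h2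
    have h3 : eLpNorm (F ε) 2 (volOmega n) ≤ K ^ (1 / 2 : ℝ) := by
      apply eLpNorm_two_le
      rw [sqrt_sq, hFsq]
      exact h2
    refine ⟨⟨((Real.continuous_sqrt.comp_aestronglyMeasurable
      (h.aestronglyMeasurable ε.2)).smul h1.aestronglyMeasurable), h3.trans_lt ?_⟩, h3⟩
    exact (ENNReal.rpow_ne_top_of_nonneg (by norm_num) hKt).lt_top
  have hKr : K ^ (1 / 2 : ℝ) ≠ ⊤ := ENNReal.rpow_ne_top_of_nonneg (by norm_num) hKt
  let f : Param → Lp (EuclideanSpace ℝ (Fin (n + 1))) 2 (volOmega n) := fun ε =>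
    if hm : MemLp (F ε) 2 (volOmega n) then hm.toLp (F ε) else 0
  have hfn : ∀ᶠ ε in U, ‖f ε‖ ≤ (K ^ (1 / 2 : ℝ)).toReal := by
    filter_upwards [hFm] with ε hε
    simp only [f, dif_pos hε.1, Lp.norm_toLp]
    exact ENNReal.toReal_mono hKr hε.2
  obtain ⟨H, hHn, hHw⟩ := exists_weak_limit U hfn
  have hH2 := Lp.memLp H
  refine ⟨H, hH2, ⟨fun δ hδ => (hH2.restrict _).integrable (by norm_num), fun i φ hφ => ?_⟩, ?_⟩
  · obtain ⟨δ, hδ, hsupp⟩ := hφ.exists_support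
    obtain ⟨C, hC⟩ := hφ.exists_bound
    obtain ⟨C', hC'⟩ := hφ.exists_bound_pderiv i
    have hC0 : 0 ≤ C := (abs_nonneg _).trans (hC 0)
    have l1 := tendsto_integral_mul hu hu₀ hlim (continuous_pderiv hφ.contDiff_one i) hC'
    have hφm : MemLp (fun x => EuclideanSpace.single i (φ x)) 2 (volOmega n) := by
      refine MemLp.of_bound (C := C) ?_ (Eventually.of_forall fun x => ?_)
      · have : (fun x => EuclideanSpace.single i (φ x)) =
            fun x => φ x • EuclideanSpace.single i (1 : ℝ) := by
          funext x
          ext j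
          by_cases hj : j = i <;> simp [hj]
        rw [this]
        exact (hφ.continuous.smul continuous_const).aestronglyMeasurable
      · simpa using hC x
    have l2 := hHw (hφm.toLp _)
    have e0 : inner ℝ H (hφm.toLp _) = ∫ x, H x i * φ x ∂(volOmega n) := by
      rw [L2.inner_def]
      refine integral_congr_ae ?_
      filter_upwards [hφm.coeFn_toLp] with x hx
      rw [hx, EuclideanSpace.inner_single_right]
      simp [mul_comm]
    rw [e0] at l2
    have e1 : ∀ᶠ ε in U, inner ℝ (f ε) (hφm.toLp _) =
        ∫ x, F ε x i * φ x ∂(volOmega n) := by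
      filter_upwards [hFm] with ε hε
      rw [L2.inner_def]
      refine integral_congr_ae ?_
      simp only [f, dif_pos hε.1]
      filter_upwards [hφm.coeFn_toLp, hε.1.coeFn_toLp] with x hx hx2
      rw [hx, hx2, EuclideanSpace.inner_single_right]
      simp [mul_comm]
    -- On the support of `φ` the weight tends to `1` uniformly, and for `ε < δ` the field `G ε` is
    -- bounded there in `L¹`; so the weight can be dropped in the limit.
    have l3 : Tendsto (fun ε : Param => ∫ x, F ε x i * φ x ∂(volOmega n) -
        ∫ x, G ε x i * φ x ∂(volOmega n)) U (𝓝 0) := by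
      set L := (K / ENNReal.ofReal c) ^ (1 / 2 : ℝ) with hL
      have hLt : L ≠ ⊤ := ENNReal.rpow_ne_top_of_nonneg (by norm_num)
        (ENNReal.div_ne_top hKt (by simpa using hc))
      rw [Metric.tendsto_nhds]
      intro η hη
      -- With this tolerance the final bound is at most `η / 2`; the summands `+ 1` guard against
      -- division by zero.
      have hη' : 0 < η / (2 * (C + 1) * (L.toReal + 1)) := by positivity
      have hsm : ∀ᶠ ε in (U : Filter Param), ε.1 < δ :=
        (hzero.mono_right nhdsWithin_le_nhds).eventually_lt_const hδ
      filter_upwards [hFm, hG, hK, hsm, hzero.eventually (h.eventually_abs_sub_le (n := n) hδ hη')]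
        with ε h1 h2 h3 h4 h5
      have hlow' : ∀ x ∈ innerDomain n δ, c ≤ a ε (bdryDist x) := fun x hx =>
        hlow ε ε.2 _ ⟨h4.le.trans hx.2, bdryDist_le x⟩
      have hGL : ∫⁻ x in innerDomain n δ, ‖G ε x‖ₑ ∂(volOmega n) ≤ L := by
        have h6 := lintegral_innerDomain_le hlow' hc h3
        have h7 := lintegral_mul_sq_le (μ := (volOmega n).restrict (innerDomain n δ)) (f := 1)
          aemeasurable_const h2.aestronglyMeasurable.restrict.enorm
        simp only [Pi.one_apply, one_mul, one_pow, lintegral_one] at h7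
        apply le_of_sq_le_sq
        rw [hL, sqrt_sq]
        refine h7.trans ((mul_le_of_le_one_left zero_le ?_).trans h6)
        exact (Measure.restrict_apply_univ _).trans_le prob_le_one
      have hGi : Integrable (fun x => G ε x i * φ x) (volOmega n) := by
        have h8 : Integrable (fun x => (innerDomain n δ).indicator (fun x => G ε x i) x * φ x)
            (volOmega n) := by
          refine Integrable.mul_bdd ?_ hφ.continuous.aestronglyMeasurable (Eventually.of_forall hC)
          rw [integrable_indicator_iff (measurableSet_innerDomain n δ)]
          exact (h2.1 δ hδ).eval_piLp i
        refine h8.congr (Eventually.of_forall fun x => ?_)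
        by_cases hx : φ x = 0
        · simp [hx]
        · simp [indicator_of_mem (hsupp x hx)]
      have hFi : Integrable (fun x => F ε x i * φ x) (volOmega n) :=
        ((memLp_coord h1.1 i).integrable (by norm_num)).mul_bdd
          hφ.continuous.aestronglyMeasurable (Eventually.of_forall hC)
      rw [← integral_sub hFi hGi, dist_zero_right]
      have hbound : ‖∫ x, (F ε x i * φ x - G ε x i * φ x) ∂(volOmega n)‖ₑ ≤
          ENNReal.ofReal (η / (2 * (C + 1) * (L.toReal + 1)) * C) * L := by
        refine (enorm_integral_le_lintegral_enorm _).trans ?_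
        refine le_trans ?_ (mul_le_mul_right hGL _)
        rw [← lintegral_const_mul' _ _ ENNReal.ofReal_ne_top,
          ← lintegral_indicator (measurableSet_innerDomain n δ)]
        refine lintegral_mono fun x => ?_
        by_cases hx : φ x = 0
        · simp [hx]
        · have hxi := hsupp x hx
          rw [indicator_of_mem hxi, ← ofReal_norm, ← ofReal_norm (G ε x),
            ← ENNReal.ofReal_mul (by positivity)]
          apply ENNReal.ofReal_le_ofReal
          have e3 : F ε x i * φ x - G ε x i * φ x =
              -((1 - √(a ε (bdryDist x))) * φ x * G ε x i) := by
            simp only [hF, PiLp.smul_apply, smul_eq_mul]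
            ring
          rw [e3, norm_neg, norm_mul, norm_mul]
          gcongr
          · exact (abs_one_sub_sqrt_le (hc.le.trans (hlow' x hxi))).trans (h5 x hxi)
          · exact hC x
          · exact PiLp.norm_apply_le _ _
      rw [← ofReal_norm, ← ENNReal.ofReal_toReal hLt, ← ENNReal.ofReal_mul (by positivity),
        ENNReal.ofReal_le_ofReal_iff (by positivity),
        ENNReal.toReal_ofReal ENNReal.toReal_nonneg] at hbound
      refine hbound.trans_lt ?_
      have hl0 : 0 ≤ L.toReal := ENNReal.toReal_nonneg
      have : η / (2 * (C + 1) * (L.toReal + 1)) * C * L.toReal =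
          η * (C / (C + 1) * (L.toReal / (L.toReal + 1)) / 2) := by
        field_simp
      rw [this]
      have q1 : C / (C + 1) ≤ 1 := (div_le_one (by linarith)).2 (by linarith)
      have q2 : L.toReal / (L.toReal + 1) ≤ 1 := (div_le_one (by linarith)).2 (by linarith)
      have q3 : C / (C + 1) * (L.toReal / (L.toReal + 1)) ≤ 1 :=
        mul_le_one₀ q1 (by positivity) q2
      nlinarith
    have l4 : Tendsto (fun ε : Param => ∫ x, G ε x i * φ x ∂(volOmega n)) U
        (𝓝 (∫ x, H x i * φ x ∂(volOmega n))) := by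
      have := (l2.congr' e1).sub l3
      simpa using this
    refine tendsto_nhds_unique l1 (l4.neg.congr' ?_)
    filter_upwards [hG] with ε hε
    rw [hε.2 i φ hφ]
  · rw [← eLpNorm_two_sq, ← sqrt_sq K]
    gcongr
    rw [Lp.norm_def] at hHn
    exact (ENNReal.toReal_le_toReal hH2.2.ne hKr).1 hHn

end Admissible

/-! ### The surface measure -/

theorem surf_eq_map (n : ℕ) : surf n =
    (volume : Measure (UnitAddTorus (Fin n))).map (fun y => (y, (0 : ℝ))) +
    (volume : Measure (UnitAddTorus (Fin n))).map (fun y => (y, (1 : ℝ))) := by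
  rw [surf, Measure.prod_add, Measure.prod_dirac, Measure.prod_dirac]

theorem eLpNorm_surf_sq (f : Cyl n → ℝ) : eLpNorm f 2 (surf n) ^ 2 =
    eLpNorm (fun y => f (y, 0)) 2 (volume : Measure (UnitAddTorus (Fin n))) ^ 2 +
    eLpNorm (fun y => f (y, 1)) 2 (volume : Measure (UnitAddTorus (Fin n))) ^ 2 := by
  have e : ∀ c : ℝ, MeasurableEmbedding (fun y : UnitAddTorus (Fin n) => (y, c)) :=
    fun c => measurableEmbedding_prod_mk_right c
  simp only [eLpNorm_two_sq]
  rw [surf_eq_map, lintegral_add_measure, (e 0).lintegral_map, (e 1).lintegral_map]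

theorem tendsto_eLpNorm_surf_iff {ι : Type*} {l : Filter ι} {f : ι → Cyl n → ℝ} :
    Tendsto (fun i => eLpNorm (f i) 2 (surf n)) l (𝓝 0) ↔
      Tendsto (fun i => eLpNorm (fun y => f i (y, 0)) 2
        (volume : Measure (UnitAddTorus (Fin n)))) l (𝓝 0) ∧
      Tendsto (fun i => eLpNorm (fun y => f i (y, 1)) 2
        (volume : Measure (UnitAddTorus (Fin n)))) l (𝓝 0) := by
  constructor
  · intro h
    constructor
    · refine tendsto_of_tendsto_of_tendsto_of_le_of_le tendsto_const_nhds h (fun _ => zero_le)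
        fun i => le_of_sq_le_sq ?_
      rw [eLpNorm_surf_sq]
      exact le_self_add
    · refine tendsto_of_tendsto_of_tendsto_of_le_of_le tendsto_const_nhds h (fun _ => zero_le)
        fun i => le_of_sq_le_sq ?_
      rw [eLpNorm_surf_sq]
      exact le_add_self
  · rintro ⟨h1, h2⟩
    apply tendsto_zero_of_sq
    simp only [eLpNorm_surf_sq]
    simpa using (ENNReal.Tendsto.pow (n := 2) h1).add (ENNReal.Tendsto.pow (n := 2) h2)

theorem aestronglyMeasurable_surf {v : Cyl n → ℝ} (hv : AEStronglyMeasurable v (surf n)) :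
    AEStronglyMeasurable (fun y => v (y, 0)) (volume : Measure (UnitAddTorus (Fin n))) ∧
    AEStronglyMeasurable (fun y => v (y, 1)) (volume : Measure (UnitAddTorus (Fin n))) := by
  have e : ∀ c : ℝ, MeasurableEmbedding (fun y : UnitAddTorus (Fin n) => (y, c)) :=
    fun c => measurableEmbedding_prod_mk_right c
  rw [surf_eq_map, aestronglyMeasurable_add_measure_iff] at hv
  exact ⟨(e 0).aestronglyMeasurable_map_iff.1 hv.1, (e 1).aestronglyMeasurable_map_iff.1 hv.2⟩

theorem bdryAvg_zero (ε : ℝ) (u : Cyl n → ℝ) (y : UnitAddTorus (Fin n)) :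
    bdryAvg ε u (y, 0) = avg 0 ε u y := by
  simp [bdryAvg, avg]

theorem bdryAvg_one (ε : ℝ) (u : Cyl n → ℝ) (y : UnitAddTorus (Fin n)) :
    bdryAvg ε u (y, 1) = avg 0 ε (u ∘ reflect) y := by
  simp only [bdryAvg, avg, Function.comp_apply, reflect]
  rw [intervalIntegral.integral_comp_sub_left (fun s => u (y, s)) 1]
  simp

/-! ### The lower bound -/

section Lower

variable {p : ℝ} {a : ℝ → ℝ → ℝ}

/-- The weight in the layer. -/
def weight (a : ℝ → ℝ → ℝ) (ε s : ℝ) : ℝ≥0∞ := ENNReal.ofReal (a ε s)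

/-- For `p = 1/2` this is the assumption, with `resist` spelled out. For `p = 1`, Cauchy–Schwarz in
`s` bounds the square of the mean of the roots by the mean. -/
theorem Admissible.tendsto_resist (h : Admissible p a) (hp : p = 1 / 2 ∨ p = 1) :
    Tendsto (fun ε : ℝ => (ENNReal.ofReal ε)⁻¹ *
      ∫⁻ s in Ioo 0 ε, resist (weight a ε) ε s ^ (1 / 2 : ℝ)) (𝓝[>] 0) (𝓝 0) := by
  have hres : ∀ ε ∈ Ioo (0 : ℝ) (1 / 2), ∀ s ∈ Ioo 0 ε,
      ∫⁻ σ in Ioo s ε, ENNReal.ofReal (1 / a ε σ) = resist (weight a ε) ε s := by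
    intro ε hε s hs
    rw [resist, min_eq_left hs.2.le, max_eq_right hs.2.le]
    refine setLIntegral_congr_fun measurableSet_Ioo fun σ hσ => ?_
    have hpos := h.pos hε (d := σ) ⟨hs.1.trans hσ.1, hσ.2.le.trans hε.2.le⟩
    simp only [weight]
    rw [one_div, ENNReal.ofReal_inv_of_pos hpos]
  have hsmall : ∀ᶠ ε in 𝓝[>] (0 : ℝ), ε ∈ Ioo (0 : ℝ) (1 / 2) :=
    Ioo_mem_nhdsGT (by norm_num)
  have hnd := h.nondegenerate
  rcases hp with rfl | rfl
  · refine hnd.congr' ?_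
    filter_upwards [hsmall] with ε hε
    congr 1
    refine setLIntegral_congr_fun measurableSet_Ioo fun s hs => ?_
    rw [hres ε hε s hs]
  · refine tendsto_zero_of_sq (tendsto_of_tendsto_of_tendsto_of_le_of_le' tendsto_const_nhds hnd
      (Eventually.of_forall fun _ => zero_le) ?_)
    filter_upwards [hsmall] with ε hε
    simp only [ENNReal.rpow_one]
    set A : ℝ → ℝ≥0∞ := fun s => ∫⁻ σ in Ioo s ε, ENNReal.ofReal (1 / a ε σ)
    have hA : Measurable A := by
      refine Antitone.measurable fun s t hst => ?_
      exact lintegral_mono_set (Ioo_subset_Ioo_left hst)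
    have e : ∫⁻ s in Ioo 0 ε, resist (weight a ε) ε s ^ (1 / 2 : ℝ) =
        ∫⁻ s in Ioo 0 ε, 1 * A s ^ (1 / 2 : ℝ) := by
      refine setLIntegral_congr_fun measurableSet_Ioo fun s hs => ?_
      simp only [A]
      rw [hres ε hε s hs, one_mul]
    have h1 := lintegral_mul_sq_le (μ := volume.restrict (Ioo 0 ε)) (f := fun _ => 1)
      (g := fun s => A s ^ (1 / 2 : ℝ)) aemeasurable_const (hA.pow_const _).aemeasurable
    simp only [one_pow, lintegral_one, Measure.restrict_apply_univ, Real.volume_Ioo, sub_zero,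
      sqrt_sq] at h1
    have h0 : ENNReal.ofReal ε ≠ 0 := by simpa using hε.1
    calc _ ≤ (ENNReal.ofReal ε)⁻¹ ^ 2 * (ENNReal.ofReal ε * ∫⁻ s in Ioo 0 ε, A s) := by
          rw [mul_pow, e]
          gcongr
      _ = _ := by
          rw [sq, mul_assoc, ← mul_assoc _ (ENNReal.ofReal ε),
            ENNReal.inv_mul_cancel h0 ENNReal.ofReal_ne_top, one_mul]

/-- In the lower layer `d(x) = x_N` because `ε < 1/2`, so the weighted norm on the slab is a part of
the energy. -/
theorem slab_weight_le {ε : ℝ} (hε : ε ∈ Ioo (0 : ℝ) (1 / 2)) (h : Admissible p a) {g : Cyl n → ℝ}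
    {K : ℝ≥0∞} (hg : AEStronglyMeasurable g (volOmega n))
    (hK : ∫⁻ x, ENNReal.ofReal (a ε (bdryDist x)) * ‖g x‖ₑ ^ 2 ∂(volOmega n) ≤ K) :
    eLpNorm g 2 (slab n 0 ε (weight a ε)) ≤ K ^ (1 / 2 : ℝ) := by
  have hsub : Ioo 0 ε ⊆ Icc 0 (1 / 2) := fun s hs => ⟨hs.1.le, hs.2.le.trans hε.2.le⟩
  have hW : AEMeasurable (weight a ε) (volume.restrict (Ioo 0 ε)) :=
    (((h.continuousOn ε hε).mono hsub).aestronglyMeasurable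
      measurableSet_Ioo).aemeasurable.ennreal_ofReal
  have hgs : AEStronglyMeasurable g (slab n 0 ε 1) :=
    hg.mono_measure (slab_one_le_volOmega le_rfl (by linarith [hε.2]))
  have hW2 : AEMeasurable (fun x : Cyl n => weight a ε x.2) (slab n 0 ε 1) := by
    rw [slab_one]
    exact hW.comp_snd
  have hslab : slab n 0 ε (weight a ε) = (slab n 0 ε 1).withDensity fun x => weight a ε x.2 := by
    rw [slab_one, slab, prod_withDensity_right₀ hW]
  apply eLpNorm_two_le
  rw [sqrt_sq, hslab, lintegral_withDensity_eq_lintegral_mul₀ hW2 (hgs.enorm.pow_const 2)]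
  refine le_trans ?_ hK
  refine le_trans (le_of_eq ?_) (lintegral_mono' (slab_one_le_volOmega (n := n) le_rfl
    (show ε ≤ 1 by linarith [hε.2])) le_rfl)
  refine lintegral_congr_ae ?_
  have hae : ∀ᵐ x ∂(slab n 0 ε 1), x ∈ (univ : Set (UnitAddTorus (Fin n))) ×ˢ Ioo 0 ε := by
    rw [slab_one, ← Measure.restrict_univ (μ := (volume : Measure (UnitAddTorus (Fin n)))),
      Measure.prod_restrict]
    exact ae_restrict_mem (MeasurableSet.univ.prod measurableSet_Ioo)
  filter_upwards [hae] with x hx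
  have : bdryDist x = x.2 := min_eq_left (by linarith [hx.2.1, hx.2.2, hε.2])
  simp only [Pi.mul_apply, weight, this]

/-- The boundary values of the limit, on one component of the boundary. -/
theorem Admissible.exists_trace_bound (h : Admissible p a) (hp : p = 1 / 2 ∨ p = 1)
    {l : Filter Param} [l.NeBot] (hl : l ≤ toZero) {u : Param → Cyl n → ℝ} {u₀ : Cyl n → ℝ}
    (hu : ∀ ε, MemLp (u ε) 2 (volOmega n)) (hu₀ : MemLp u₀ 2 (volOmega n))
    (hlim : Tendsto (fun ε => eLpNorm (fun x => u ε x - u₀ x) 2 (volOmega n)) l (𝓝 0))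
    {v : UnitAddTorus (Fin n) → ℝ}
    (hv : AEStronglyMeasurable v (volume : Measure (UnitAddTorus (Fin n))))
    (hlv : Tendsto (fun ε : Param => eLpNorm (fun y => avg 0 ε (u ε) y - v y) 2
      (volume : Measure (UnitAddTorus (Fin n)))) l (𝓝 0))
    {g : Param → Cyl n → ℝ} (hg : ∀ᶠ ε in l, AEStronglyMeasurable (g ε) (volOmega n))
    (hug : ∀ᶠ ε in l, NormalApprox (u ε) (g ε)) {K : ℝ≥0∞} (hKt : K ≠ ⊤)
    (hK : ∀ᶠ ε : Param in l,
      ∫⁻ x, ENNReal.ofReal (a ε (bdryDist x)) * ‖g ε x‖ₑ ^ 2 ∂(volOmega n) ≤ K) :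
    ∃ M : ℝ≥0∞, M ≠ ⊤ ∧ ∀ δ : ℝ, 0 < δ → δ ≤ 1 / 2 →
      eLpNorm (fun y => avg 0 δ u₀ y - v y) 2 (volume : Measure (UnitAddTorus (Fin n))) ≤
        ENNReal.ofReal δ ^ (1 / 2 : ℝ) * M := by
  obtain ⟨c, hc, hlow⟩ := h.lower
  obtain ⟨C, hC⟩ := h.upper
  have hzero : Tendsto (Subtype.val : Param → ℝ) l (𝓝[>] 0) := tendsto_comap.mono_left hl
  have hB := (h.tendsto_resist hp).comp hzero
  -- The first summand bounds the normal derivative in the layer with the weight, the second one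
  -- without weight outside it, where `a ε ≥ c`.
  set M := K ^ (1 / 2 : ℝ) + (K / ENNReal.ofReal c) ^ (1 / 2 : ℝ) with hMdef
  have hM : M ≠ ⊤ := ENNReal.add_ne_top.2 ⟨ENNReal.rpow_ne_top_of_nonneg (by norm_num) hKt,
    ENNReal.rpow_ne_top_of_nonneg (by norm_num) (ENNReal.div_ne_top hKt (by simpa using hc))⟩
  refine ⟨M, hM, fun δ hδ0 hδ => eLpNorm_avg_sub_limit_le hzero hv hu hu₀ hlim hlv hB hM hδ0 hδ ?_⟩
  have hfin := hB.eventually_lt_const ENNReal.zero_lt_top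
  have hsm : ∀ᶠ ε : Param in l, ε.1 < δ :=
    (hzero.mono_right nhdsWithin_le_nhds).eventually_lt_const hδ0
  filter_upwards [hg, hug, hK, hfin, hsm] with ε h1 h2 h3 h4 h5
  have hsub : Ioo 0 ε.1 ⊆ Icc 0 (1 / 2) := fun s hs => ⟨hs.1.le, hs.2.le.trans ε.2.2.le⟩
  have h0 : ENNReal.ofReal ε.1 ≠ 0 := by simpa using ε.2.1
  refine h2.eLpNorm_avg_zero_sub_avg_le (hu ε) ε.2.1 h5 hδ (fun r _ => h1.restrict)
    (W := weight a ε) (C := ENNReal.ofReal C) ?_ ?_ ENNReal.ofReal_ne_top ?_ ?_ hM ?_ ?_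
  · exact (((h.continuousOn ε ε.2).mono hsub).aestronglyMeasurable
      measurableSet_Ioo).aemeasurable.ennreal_ofReal
  · intro σ hσ
    simpa [weight] using h.pos ε.2 ⟨hσ.1, hσ.2.le.trans ε.2.2.le⟩
  · intro σ hσ
    exact ENNReal.ofReal_le_ofReal (hC ε ε.2 σ (hsub hσ))
  -- An infinite integral would contradict the convergence of its normalization to `0`.
  · intro htop
    simp only [Function.comp_apply, htop] at h4
    rw [ENNReal.mul_top (ENNReal.inv_ne_zero.2 ENNReal.ofReal_ne_top)] at h4
    exact lt_irrefl _ h4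
  · exact (slab_weight_le ε.2 h h1 h3).trans le_self_add
  · refine le_trans ?_ (le_add_self (a := (K / ENNReal.ofReal c) ^ (1 / 2 : ℝ)))
    apply eLpNorm_two_le
    rw [sqrt_sq]
    have h6 := lintegral_innerDomain_le (δ := ε.1)
      (fun x hx => hlow ε ε.2 _ ⟨hx.2, bdryDist_le x⟩) hc h3
    refine le_trans (lintegral_mono' ?_ le_rfl) h6
    have := slab_le_smul (n := n) (W := 1) (C := 1) ε.2.1.le le_rfl hδ fun _ _ => le_rfl
    rwa [one_smul] at this

theorem memLp_reflect {u : Cyl n → ℝ} (hu : MemLp u 2 (volOmega n)) :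
    MemLp (u ∘ reflect) 2 (volOmega n) := hu.comp_measurePreserving (measurePreserving_reflect n)

theorem eLpNorm_sub_reflect {f g : Cyl n → ℝ} (hf : AEStronglyMeasurable f (volOmega n))
    (hg : AEStronglyMeasurable g (volOmega n)) :
    eLpNorm (fun x => (f ∘ reflect) x - (g ∘ reflect) x) 2 (volOmega n) =
      eLpNorm (fun x => f x - g x) 2 (volOmega n) := by
  have := eLpNorm_comp_measurePreserving (p := 2) (hf.sub hg) (measurePreserving_reflect n)
  rw [Pi.sub_comp] at this
  exact this

/-- Square integrability of `G` is not assumed: it follows from a single `ψ k₀` whose gradient is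
within distance `1` of `G`, since `grad (ψ k₀)` is continuous up to the boundary. -/
theorem exists_pderiv_bound {ψ : ℕ → Cyl n → ℝ} {G : Cyl n → EuclideanSpace ℝ (Fin (n + 1))}
    (hψ : ∀ k, ContDiff ℝ 1 (ψ k ∘ cover n)) (hG : AEStronglyMeasurable G (volOmega n))
    (hψG : Tendsto (fun k => eLpNorm (fun x => grad (ψ k) x - G x) 2 (volOmega n)) atTop (𝓝 0)) :
    ∃ M : ℝ≥0∞, M ≠ ⊤ ∧
      (∀ᶠ k in atTop, eLpNorm (pderiv (Fin.last n) (ψ k)) 2 (volOmega n) ≤ M) ∧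
      ∀ᶠ k in atTop, eLpNorm (pderiv (Fin.last n) (ψ k ∘ reflect)) 2 (volOmega n) ≤ M := by
  have hgm : ∀ k, AEStronglyMeasurable (grad (ψ k)) (volOmega n) :=
    fun k => (continuous_grad (hψ k)).aestronglyMeasurable
  have hev := hψG.eventually_lt_const (zero_lt_one (α := ℝ≥0∞))
  obtain ⟨k₀, hk₀⟩ := hev.exists
  have hG2 : eLpNorm G 2 (volOmega n) < ⊤ := by
    have h1 : G = fun x => grad (ψ k₀) x - (grad (ψ k₀) x - G x) := by
      funext x
      simp
    rw [h1]
    refine (eLpNorm_sub_le (hgm k₀) ((hgm k₀).sub hG) (by norm_num)).trans_lt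
      (ENNReal.add_lt_top.2 ⟨?_, hk₀.trans ENNReal.one_lt_top⟩)
    exact (memLp_of_continuous (continuous_grad (hψ k₀))).2
  refine ⟨eLpNorm G 2 (volOmega n) + 1, ENNReal.add_ne_top.2 ⟨hG2.ne, ENNReal.one_ne_top⟩, ?_⟩
  have hM : ∀ᶠ k in atTop, eLpNorm (pderiv (Fin.last n) (ψ k)) 2 (volOmega n) ≤
      eLpNorm G 2 (volOmega n) + 1 := by
    filter_upwards [hev] with k hk
    have h1 : eLpNorm (pderiv (Fin.last n) (ψ k)) 2 (volOmega n) ≤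
        eLpNorm (grad (ψ k)) 2 (volOmega n) := eLpNorm_coord_le (grad (ψ k)) (Fin.last n)
    refine h1.trans (le_trans (le_of_eq ?_)
      ((eLpNorm_add_le hG ((hgm k).sub hG) (by norm_num)).trans (add_le_add le_rfl hk.le)))
    congr 1
    funext x
    simp
  refine ⟨hM, ?_⟩
  filter_upwards [hM] with k hk
  refine le_trans (le_of_eq ?_) hk
  rw [show pderiv (Fin.last n) (ψ k ∘ reflect) = -(pderiv (Fin.last n) (ψ k) ∘ reflect) from
    funext fun x => pderiv_last_reflect (hψ k) x, eLpNorm_neg]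
  exact eLpNorm_comp_measurePreserving (continuous_pderiv (hψ k) _).aestronglyMeasurable
    (measurePreserving_reflect n)

/-- Compactness: limits of functions of bounded energy lie in the domain of the limit energy. -/
theorem Admissible.exists_limit (h : Admissible p a) (hp : p = 1 / 2 ∨ p = 1)
    (U : Ultrafilter Param) (hU : (U : Filter Param) ≤ toZero) {u : Param → Cyl n → ℝ}
    {u₀ v : Cyl n → ℝ} (hu : ∀ ε, MemLp (u ε) 2 (volOmega n)) (hu₀ : MemLp u₀ 2 (volOmega n))
    (hlim : Tendsto (fun ε => eLpNorm (fun x => u ε x - u₀ x) 2 (volOmega n)) U (𝓝 0))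
    (hv : AEStronglyMeasurable v (surf n))
    (hlv : Tendsto (fun ε : Param => eLpNorm (fun x => bdryAvg ε (u ε) x - v x) 2 (surf n))
      U (𝓝 0))
    {G : Param → Cyl n → EuclideanSpace ℝ (Fin (n + 1))}
    (hG : ∀ᶠ ε in U, IsWeakGrad (u ε) (G ε)) {K : ℝ≥0∞} (hKt : K ≠ ⊤)
    (hK : ∀ᶠ ε : Param in U,
      ∫⁻ x, ENNReal.ofReal (a ε (bdryDist x)) * ‖G ε x‖ₑ ^ 2 ∂(volOmega n) ≤ K) :
    MemH1 u₀ ∧ IsTrace u₀ v ∧ ∃ H : Cyl n → EuclideanSpace ℝ (Fin (n + 1)), IsWeakGrad u₀ H ∧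
      ∫⁻ x, ‖H x‖ₑ ^ 2 ∂(volOmega n) ≤ K := by
  obtain ⟨H, hH2, hHw, hHK⟩ := h.exists_weakGrad_limit U hU hu hu₀ hlim hG hKt hK
  refine ⟨⟨hu₀, H, hHw, hH2⟩, ?_, H, hHw, hHK⟩
  obtain ⟨hv0, hv1⟩ := aestronglyMeasurable_surf hv
  obtain ⟨hl0, hl1⟩ := tendsto_eLpNorm_surf_iff.1 hlv
  simp only [bdryAvg_zero] at hl0
  simp only [bdryAvg_one] at hl1
  set g : Param → Cyl n → ℝ := fun ε x => G ε x (Fin.last n) with hg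
  have hgm : ∀ᶠ ε in U, AEStronglyMeasurable (g ε) (volOmega n) := by
    filter_upwards [hG] with ε hε
    exact (EuclideanSpace.proj (Fin.last n) :
      EuclideanSpace ℝ (Fin (n + 1)) →L[ℝ] ℝ).continuous.comp_aestronglyMeasurable
        hε.aestronglyMeasurable
  have hug : ∀ᶠ ε in U, NormalApprox (u ε) (g ε) := by
    filter_upwards [hG, hK] with ε h1 h2
    exact normalApprox_of_isWeakGrad (hu ε) h1 fun δ hδ =>
      h.memLp_innerDomain ε.2 h1.aestronglyMeasurable hKt h2 hδ
  have hgK : ∀ᶠ ε : Param in U,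
      ∫⁻ x, ENNReal.ofReal (a ε (bdryDist x)) * ‖g ε x‖ₑ ^ 2 ∂(volOmega n) ≤ K := by
    filter_upwards [hK] with ε hε
    refine (lintegral_mono fun x => ?_).trans hε
    gcongr
    rw [← ofReal_norm, ← ofReal_norm]
    exact ENNReal.ofReal_le_ofReal (PiLp.norm_apply_le _ _)
  obtain ⟨M0, hM0, hb0⟩ := h.exists_trace_bound hp hU hu hu₀ hlim hv0 hl0 hgm hug hKt hgK
  -- The component `x_N = 1` is carried to `x_N = 0` by the reflection, which preserves the measure
  -- and `d`, hence all the bounds.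
  have hlimr : Tendsto (fun ε => eLpNorm (fun x => (u ε ∘ reflect) x - (u₀ ∘ reflect) x) 2
      (volOmega n)) U (𝓝 0) :=
    hlim.congr fun ε => (eLpNorm_sub_reflect (hu ε).1 hu₀.1).symm
  have hgmr : ∀ᶠ ε in U, AEStronglyMeasurable (fun x => -g ε (reflect x)) (volOmega n) := by
    filter_upwards [hgm] with ε hε
    exact (hε.comp_measurePreserving (measurePreserving_reflect n)).neg
  have hugr : ∀ᶠ ε in U, NormalApprox (u ε ∘ reflect) fun x => -g ε (reflect x) := by
    filter_upwards [hug, hgm] with ε h1 h2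
    exact h1.reflect (hu ε).1 fun _ _ => h2.restrict
  have hgKr : ∀ᶠ ε : Param in U,
      ∫⁻ x, ENNReal.ofReal (a ε (bdryDist x)) * ‖-g ε (reflect x)‖ₑ ^ 2 ∂(volOmega n) ≤ K := by
    filter_upwards [hgK, hgm] with ε h1 h2
    refine le_trans (le_of_eq ?_) h1
    have hm : AEMeasurable (fun x => ENNReal.ofReal (a ε (bdryDist x)) * ‖g ε x‖ₑ ^ 2)
        (volOmega n) :=
      (h.aestronglyMeasurable ε.2).aemeasurable.ennreal_ofReal.mul (h2.enorm.pow_const 2)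
    have hmp := measurePreserving_reflect n
    rw [← hmp.map_eq] at hm
    have := lintegral_map' hm hmp.measurable.aemeasurable
    rw [hmp.map_eq] at this
    rw [this]
    simp only [bdryDist_reflect, enorm_neg]
  obtain ⟨M1, hM1, hb1⟩ := h.exists_trace_bound hp hU (fun ε => memLp_reflect (hu ε))
    (memLp_reflect hu₀) hlimr hv1 hl1 hgmr hugr hKt hgKr
  -- Any `C¹` sequence converging in `H¹` will do: the estimates on the averages of `u₀` force its
  -- boundary values to converge to `v`.
  obtain ⟨ψ, hψ, hψu, hψG⟩ := exists_contDiff_approx hu₀ hHw hH2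
  obtain ⟨M2, hM2t, hψM, hψMr⟩ := exists_pderiv_bound hψ hHw.aestronglyMeasurable hψG
  refine ⟨H, ψ, hHw, hψ, hψu, hψG, tendsto_eLpNorm_surf_iff.2 ⟨?_, ?_⟩⟩
  · refine tendsto_trace hψ hu₀ hψu (M := M0 + M2) (ENNReal.add_ne_top.2 ⟨hM0, hM2t⟩) ?_ hv0 ?_
    · filter_upwards [hψM] with k hk
      exact hk.trans le_add_self
    · intro δ hδ0 hδ
      refine (hb0 δ hδ0 hδ).trans ?_
      gcongr
      exact le_self_add
  · have := tendsto_trace (fun k => contDiff_reflect (hψ k)) (memLp_reflect hu₀) (hψu.congr fun k =>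
      (eLpNorm_sub_reflect (memLp_of_contDiff (hψ k)).1 hu₀.1).symm) (M := M1 + M2)
      (ENNReal.add_ne_top.2 ⟨hM1, hM2t⟩) ?_ hv1 ?_
    · simpa [reflect] using this
    · filter_upwards [hψMr] with k hk
      exact hk.trans le_add_self
    · intro δ hδ0 hδ
      refine (hb1 δ hδ0 hδ).trans ?_
      gcongr
      exact le_self_add

end Lower

/-! ### The lower limit -/

section LowerLimit

variable {p : ℝ} {a : ℝ → ℝ → ℝ}

theorem exists_isWeakGrad_of_energy_lt {ε : ℝ} {u : Cyl n → ℝ} {L : ℝ≥0∞}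
    (h : energy a ε u < L) : ∃ G, IsWeakGrad u G ∧
      ∫⁻ x, ENNReal.ofReal (a ε (bdryDist x)) * ‖G x‖ₑ ^ 2 ∂(volOmega n) ≤ 2 * L := by
  unfold energy at h
  split_ifs at h
  · obtain ⟨G, hG⟩ := iInf_lt_iff.1 h
    obtain ⟨hw, hlt⟩ := iInf_lt_iff.1 hG
    refine ⟨G, hw, ?_⟩
    rw [← ENNReal.inv_mul_le_iff (by norm_num) (by norm_num)]
    exact hlt.le
  · exact absurd h not_top_lt

/-- If the inequality failed, some `L` would lie strictly between the two sides, and the energies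
would be below `L` frequently. Along an ultrafilter concentrated there, the compactness lemma puts
`(u₀, v)` in the domain with energy at most `L`. -/
theorem Admissible.energy₀_le_liminf (h : Admissible p a) (hp : p = 1 / 2 ∨ p = 1)
    {u : Param → Cyl n → ℝ} {u₀ v : Cyl n → ℝ} (hu : ∀ ε, MemLp (u ε) 2 (volOmega n))
    (hu₀ : MemLp u₀ 2 (volOmega n)) (hv : AEStronglyMeasurable v (surf n))
    (hlim : Tendsto (fun ε => eLpNorm (fun x => u ε x - u₀ x) 2 (volOmega n)) toZero (𝓝 0))
    (hlv : Tendsto (fun ε : Param => eLpNorm (fun x => bdryAvg ε (u ε) x - v x) 2 (surf n))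
      toZero (𝓝 0)) :
    energy₀ u₀ v ≤ liminf (fun ε : Param => energy a ε (u ε)) toZero := by
  by_contra! hlt
  obtain ⟨L, hL1, hL2⟩ := exists_between hlt
  have hfreq : ∃ᶠ ε in toZero, energy a ε.1 (u ε) < L :=
    frequently_lt_of_liminf_lt (by isBoundedDefault) hL1
  have hne : (toZero ⊓ 𝓟 {ε : Param | energy a ε.1 (u ε) < L}).NeBot :=
    frequently_mem_iff_neBot.1 hfreq
  set U := Ultrafilter.of (toZero ⊓ 𝓟 {ε : Param | energy a ε.1 (u ε) < L})
  have hU := Ultrafilter.of_le (toZero ⊓ 𝓟 {ε : Param | energy a ε.1 (u ε) < L})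
  have hU1 : (U : Filter Param) ≤ toZero := hU.trans inf_le_left
  have hU2 : ∀ᶠ ε : Param in U, energy a ε.1 (u ε) < L :=
    (hU.trans inf_le_right) (mem_principal_self _)
  have hex : ∀ ε : Param, ∃ G, energy a ε.1 (u ε) < L → IsWeakGrad (u ε) G ∧
      ∫⁻ x, ENNReal.ofReal (a ε (bdryDist x)) * ‖G x‖ₑ ^ 2 ∂(volOmega n) ≤ 2 * L := by
    intro ε
    by_cases hε : energy a ε.1 (u ε) < L
    · obtain ⟨G, hG⟩ := exists_isWeakGrad_of_energy_lt hε
      exact ⟨G, fun _ => hG⟩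
    · exact ⟨0, fun h => absurd h hε⟩
  choose G hG using hex
  have hLt : L ≠ ⊤ := (hL2.trans_le le_top).ne
  obtain ⟨hm, ht, H, hHw, hHK⟩ := h.exists_limit hp U hU1 hu hu₀ (hlim.mono_left hU1) hv
    (hlv.mono_left hU1) (hU2.mono fun ε hε => (hG ε hε).1)
    (ENNReal.mul_ne_top ENNReal.ofNat_ne_top hLt) (hU2.mono fun ε hε => (hG ε hε).2)
  refine hL2.not_ge ?_
  rw [energy₀, if_pos ⟨hm, ht⟩]
  refine (iInf₂_le H hHw).trans ?_
  rw [ENNReal.inv_mul_le_iff (by norm_num) (by norm_num)]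
  simpa using hHK

end LowerLimit

/-! ### Recovery sequences -/

/-- Dominated convergence is applied along sequences, which suffice for a countably generated
filter. -/
instance : IsCountablyGenerated toZero := by
  unfold toZero
  infer_instance

theorem tendsto_val : Tendsto (Subtype.val : Param → ℝ) toZero (𝓝[>] 0) := tendsto_comap

instance : NeBot toZero := by
  rw [toZero, comap_neBot_iff]
  intro s hs
  obtain ⟨x, hx⟩ := NeBot.nonempty_of_mem inferInstance
    (inter_mem hs (Ioo_mem_nhdsGT (show (0 : ℝ) < 1 / 2 by norm_num)))
  exact ⟨⟨x, hx.2⟩, hx.1⟩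

section Recovery

variable {p : ℝ} {a : ℝ → ℝ → ℝ}

theorem Admissible.tendsto_lintegral (h : Admissible p a)
    {G : Cyl n → EuclideanSpace ℝ (Fin (n + 1))} (hG : MemLp G 2 (volOmega n)) :
    Tendsto (fun ε : Param => ∫⁻ x, ENNReal.ofReal (a ε (bdryDist x)) * ‖G x‖ₑ ^ 2 ∂(volOmega n))
      toZero (𝓝 (∫⁻ x, ‖G x‖ₑ ^ 2 ∂(volOmega n))) := by
  obtain ⟨C, hC⟩ := h.upper
  refine tendsto_of_seq_tendsto fun e he => ?_
  refine tendsto_lintegral_of_dominated_convergence'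
    (fun x => ENNReal.ofReal C * ‖G x‖ₑ ^ 2) (fun k => ?_) (fun k => ?_) ?_ ?_
  · exact (h.aestronglyMeasurable (e k).2).aemeasurable.ennreal_ofReal.mul
      (hG.1.enorm.pow_const 2)
  · filter_upwards [ae_mem_Omega n] with x hx
    gcongr
    exact hC _ (e k).2 _ ⟨(bdryDist_pos hx).le, bdryDist_le x⟩
  · rw [lintegral_const_mul' _ _ ENNReal.ofReal_ne_top, ← eLpNorm_two_sq]
    exact ENNReal.mul_ne_top ENNReal.ofReal_ne_top (ENNReal.pow_ne_top hG.2.ne)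
  · filter_upwards [ae_mem_Omega n] with x hx
    have h1 : Tendsto (fun ε => a ε (bdryDist x)) (𝓝[>] 0) (𝓝 1) :=
      h.tendsto_one.tendsto_at ⟨bdryDist_pos hx, bdryDist_le x⟩
    have h2 := ENNReal.tendsto_ofReal (h1.comp (tendsto_val.comp he))
    have h3 := ENNReal.Tendsto.mul_const (b := ‖G x‖ₑ ^ 2) h2 (Or.inl (by simp))
    simpa using h3

theorem MemH1.memH1loc {u : Cyl n → ℝ} (hu : MemH1 u) : MemH1loc u := by
  obtain ⟨h1, G, h2, h3⟩ := hu
  exact ⟨fun _ _ => h1.restrict _, G, h2, fun _ _ => h3.restrict _⟩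

/-- Each weak gradient of `u` competes in every `energy a ε u`, and for a square integrable one the
weighted integrals converge to the unweighted one. -/
theorem Admissible.limsup_energy_le (h : Admissible p a) {u : Cyl n → ℝ} (hu : MemH1 u) :
    limsup (fun ε : Param => energy a ε u) toZero ≤ dirichlet (fun _ => 1) u := by
  refine le_iInf₂ fun G hG => ?_
  by_cases htop : ∫⁻ x, ‖G x‖ₑ ^ 2 ∂(volOmega n) = ⊤
  · simp [htop, ENNReal.mul_top]
  have hG2 : MemLp G 2 (volOmega n) := by
    refine ⟨hG.aestronglyMeasurable, ?_⟩
    rw [← eLpNorm_two_sq] at htop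
    rw [lt_top_iff_ne_top]
    contrapose! htop
    simp [htop]
  have ht := ENNReal.Tendsto.const_mul (a := 2⁻¹) (h.tendsto_lintegral hG2)
    (Or.inr (by norm_num))
  simp only [ENNReal.ofReal_one, one_mul]
  rw [← ht.limsup_eq]
  refine limsup_le_limsup (Eventually.of_forall fun ε => ?_)
  simp only [energy, if_pos hu.memH1loc]
  exact iInf₂_le G hG

/-- For the approximants, average and boundary value differ by at most `ε^(1/2) M`, with `M`
independent of `k`. Letting `k → ∞` at fixed `ε` gives the same bound for `u` and `v`. -/
theorem IsTrace.tendsto_bdryAvg {u v : Cyl n → ℝ} (hu : MemLp u 2 (volOmega n))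
    (hv : AEStronglyMeasurable v (surf n)) (h : IsTrace u v) :
    Tendsto (fun ε : Param => eLpNorm (fun x => bdryAvg ε u x - v x) 2 (surf n)) toZero
      (𝓝 0) := by
  obtain ⟨G, ψ, hG, hψ, hψu, hψG, hψv⟩ := h
  obtain ⟨hv0, hv1⟩ := aestronglyMeasurable_surf hv
  obtain ⟨hψ0, hψ1⟩ := tendsto_eLpNorm_surf_iff.1 hψv
  obtain ⟨M, hM, hψM, hψMr⟩ := exists_pderiv_bound hψ hG.aestronglyMeasurable hψG
  have key : ∀ {u : Cyl n → ℝ} {ψ : ℕ → Cyl n → ℝ} {v : UnitAddTorus (Fin n) → ℝ},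
      MemLp u 2 (volOmega n) → (∀ k, ContDiff ℝ 1 (ψ k ∘ cover n)) →
      AEStronglyMeasurable v (volume : Measure (UnitAddTorus (Fin n))) →
      Tendsto (fun k => eLpNorm (fun x => ψ k x - u x) 2 (volOmega n)) atTop (𝓝 0) →
      Tendsto (fun k => eLpNorm (fun y => ψ k (y, 0) - v y) 2
        (volume : Measure (UnitAddTorus (Fin n)))) atTop (𝓝 0) →
      (∀ᶠ k in atTop, eLpNorm (pderiv (Fin.last n) (ψ k)) 2 (volOmega n) ≤ M) →
      Tendsto (fun ε : Param => eLpNorm (fun y => avg 0 ε u y - v y) 2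
        (volume : Measure (UnitAddTorus (Fin n)))) toZero (𝓝 0) := by
    intro u ψ v hu hψ hv hψu hψv hψM
    have hbound : ∀ ε : Param, eLpNorm (fun y => avg 0 ε u y - v y) 2
        (volume : Measure (UnitAddTorus (Fin n))) ≤ ENNReal.ofReal ε ^ (1 / 2 : ℝ) * M := by
      intro ε
      have hε1 : ε.1 ≤ 1 := by linarith [ε.2.2]
      have ht : Tendsto (fun k => ENNReal.ofReal (1 / √(ε - 0)) *
          eLpNorm (fun x => ψ k x - u x) 2 (volOmega n) + ENNReal.ofReal ε ^ (1 / 2 : ℝ) * M +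
          eLpNorm (fun y => ψ k (y, 0) - v y) 2 (volume : Measure (UnitAddTorus (Fin n)))) atTop
          (𝓝 (ENNReal.ofReal (1 / √(ε - 0)) * 0 + ENNReal.ofReal ε ^ (1 / 2 : ℝ) * M + 0)) :=
        ((ENNReal.Tendsto.const_mul hψu (Or.inr ENNReal.ofReal_ne_top)).add
          tendsto_const_nhds).add hψv
      rw [mul_zero, zero_add, add_zero] at ht
      refine ge_of_tendsto ht ?_
      filter_upwards [hψM] with k hk
      have hmu := aestronglyMeasurable_avg_of_memLp hu le_rfl ε.2.1 hε1
      have hmψ := aestronglyMeasurable_avg_of_memLp (memLp_of_contDiff (hψ k)) le_rfl ε.2.1 hε1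
      have hm0 : AEStronglyMeasurable (fun y => ψ k (y, 0))
          (volume : Measure (UnitAddTorus (Fin n))) :=
        ((continuous_of_contDiff (hψ k)).comp (Continuous.prodMk_left 0)).aestronglyMeasurable
      refine (eLpNorm_sub_triangle hmu hmψ hv).trans ?_
      rw [add_assoc]
      refine add_le_add ?_ ((eLpNorm_sub_triangle hmψ hm0 hv).trans (add_le_add ?_ le_rfl))
      · refine (eLpNorm_avg_sub_avg_le hu (memLp_of_contDiff (hψ k)) le_rfl ε.2.1 hε1).trans
          (le_of_eq ?_)
        rw [show (fun x => u x - ψ k x) = u - ψ k from rfl, eLpNorm_sub_comm]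
        rfl
      · refine (eLpNorm_avg_sub_le_one (hψ k) ε.2.1 ⟨le_rfl, ε.2.1.le⟩).trans ?_
        rw [sub_zero]
        gcongr
        exact (eLpNorm_mono_measure _ (slab_one_le_volOmega le_rfl hε1)).trans hk
    refine tendsto_of_tendsto_of_tendsto_of_le_of_le tendsto_const_nhds ?_
      (fun _ => zero_le) hbound
    have h1 : Tendsto (fun ε : Param => ENNReal.ofReal ε.1) toZero (𝓝 0) := by
      simpa using ENNReal.tendsto_ofReal (tendsto_val.mono_right nhdsWithin_le_nhds)
    have h2 := (ENNReal.continuous_rpow_const (y := (1 / 2 : ℝ))).tendsto 0 |>.comp h1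
    rw [ENNReal.zero_rpow_of_pos (by norm_num)] at h2
    simpa using ENNReal.Tendsto.mul_const h2 (Or.inr hM)
  refine tendsto_eLpNorm_surf_iff.2 ⟨?_, ?_⟩
  · simpa only [bdryAvg_zero] using key hu hψ hv0 hψu hψ0 hψM
  · simp only [bdryAvg_one]
    refine key (memLp_reflect hu) (fun k => contDiff_reflect (hψ k)) hv1 (hψu.congr fun k =>
      (eLpNorm_sub_reflect (memLp_of_contDiff (hψ k)).1 hu.1).symm) ?_ hψMr
    simpa [reflect] using hψ1

/-- Prescribing the boundary averages by a change in the layer. -/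
theorem exists_tendsto_bdryAvg {u₀ v : Cyl n → ℝ} (hu₀ : MemLp u₀ 2 (volOmega n))
    (hv : MemLp v 2 (surf n)) :
    ∃ u : Param → Cyl n → ℝ, (∀ ε, MemLp (u ε) 2 (volOmega n)) ∧
      Tendsto (fun ε => eLpNorm (fun x => u ε x - u₀ x) 2 (volOmega n)) toZero (𝓝 0) ∧
      Tendsto (fun ε : Param => eLpNorm (fun x => bdryAvg ε (u ε) x - v x) 2 (surf n))
        toZero (𝓝 0) := by
  classical
  obtain ⟨hm0, hm1⟩ := aestronglyMeasurable_surf hv.1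
  have hsq := eLpNorm_surf_sq v
  have hfin : eLpNorm v 2 (surf n) ^ 2 < ⊤ := ENNReal.pow_lt_top hv.2
  rw [hsq, ENNReal.add_lt_top] at hfin
  have hv0 : MemLp (fun y => v (y, 0)) 2 (volume : Measure (UnitAddTorus (Fin n))) :=
    ⟨hm0, (ENNReal.pow_lt_top_iff.1 hfin.1).resolve_right (by norm_num)⟩
  have hv1 : MemLp (fun y => v (y, 1)) 2 (volume : Measure (UnitAddTorus (Fin n))) :=
    ⟨hm1, (ENNReal.pow_lt_top_iff.1 hfin.2).resolve_right (by norm_num)⟩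
  set T : Set (Cyl n) := {x | x.2 < 1 / 2} with hT
  have hTm : MeasurableSet T := measurableSet_lt measurable_snd measurable_const
  -- Adding `D` to `u₀` replaces it by the boundary datum of the nearer component, extended
  -- constantly along vertical lines. Done only in the layer, this gives averages exactly `v`, while
  -- the change in `L²` vanishes because the layer shrinks to nothing.
  set D : Cyl n → ℝ := fun x => T.indicator (fun x => v (x.1, 0)) x +
    Tᶜ.indicator (fun x => v (x.1, 1)) x - u₀ x with hDdef
  have hD : MemLp D 2 (volOmega n) :=
    ((MemLp.indicator hTm (hv0.comp_fst _)).add (MemLp.indicator hTm.compl (hv1.comp_fst _))).sub hu₀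
  set S : ℝ → Set (Cyl n) := fun ε => {x | bdryDist x < ε} with hS
  have hSm : ∀ ε, MeasurableSet (S ε) := fun ε =>
    measurableSet_lt measurable_bdryDist measurable_const
  refine ⟨fun ε x => u₀ x + (S ε).indicator D x, fun ε => hu₀.add (hD.indicator (hSm ε)), ?_, ?_⟩
  · simp only [add_sub_cancel_left]
    apply tendsto_zero_of_sq
    simp only [eLpNorm_two_sq]
    refine tendsto_of_seq_tendsto fun e he => ?_
    rw [← lintegral_zero (μ := volOmega n)]
    refine tendsto_lintegral_of_dominated_convergence' (fun x => ‖D x‖ₑ ^ 2) (fun k => ?_)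
      (fun k => ?_) ?_ ?_
    · exact (hD.indicator (hSm (e k))).1.enorm.pow_const 2
    · refine Eventually.of_forall fun x => ?_
      simp only
      gcongr
      exact enorm_indicator_le_enorm_self _ _
    · rw [← eLpNorm_two_sq]
      exact ENNReal.pow_ne_top hD.2.ne
    · filter_upwards [ae_mem_Omega n] with x hx
      have hev : ∀ᶠ k in atTop, (e k).1 < bdryDist x :=
        ((tendsto_val.mono_right nhdsWithin_le_nhds).comp he).eventually_lt_const (bdryDist_pos hx)
      refine tendsto_const_nhds.congr' ?_
      filter_upwards [hev] with k hk
      rw [indicator_of_notMem (by simpa [hS] using hk.le)]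
      simp
  · have hz : ∀ ε : Param, ∀ s ∈ Ioo 0 ε.1, ∀ y : UnitAddTorus (Fin n),
        u₀ (y, s) + (S ε).indicator D (y, s) = v (y, 0) := by
      intro ε s hs y
      have h1 : ((y, s) : Cyl n) ∈ S ε := (min_le_left _ _).trans_lt hs.2
      have h2 : ((y, s) : Cyl n) ∈ T := hs.2.trans ε.2.2
      simp [indicator_of_mem h1, hDdef, h2]
    have ho : ∀ ε : Param, ∀ s ∈ Ioo 0 ε.1, ∀ y : UnitAddTorus (Fin n),
        u₀ (y, 1 - s) + (S ε).indicator D (y, 1 - s) = v (y, 1) := by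
      intro ε s hs y
      have h1 : ((y, 1 - s) : Cyl n) ∈ S ε :=
        (min_le_right _ _).trans_lt (by simpa using hs.2 : 1 - (1 - s) < ε.1)
      have h2 : ((y, 1 - s) : Cyl n) ∉ T := by
        refine not_lt.2 (?_ : 1 / 2 ≤ 1 - s)
        linarith [hs.2, ε.2.2]
      simp [indicator_of_mem h1, hDdef, h2]
    have hc : ∀ (ε : Param) (f : ℝ → ℝ) (c : ℝ), (∀ s ∈ Ioo 0 ε.1, f s = c) →
        (ε.1 - 0)⁻¹ * ∫ s in (0 : ℝ)..ε.1, f s = c := by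
      intro ε f c hf
      rw [intervalIntegral.integral_of_le ε.2.1.le, integral_Ioc_eq_integral_Ioo,
        setIntegral_congr_fun measurableSet_Ioo hf]
      have := ε.2.1.ne'
      simp [ε.2.1.le]
      field_simp
    refine tendsto_eLpNorm_surf_iff.2 ⟨?_, ?_⟩
    · simp only [bdryAvg_zero, avg]
      refine tendsto_const_nhds.congr fun ε => ?_
      simp_rw [fun y => hc ε _ _ fun s hs => hz ε s hs y]
      simp
    · simp only [bdryAvg_one, avg, Function.comp_apply, reflect]
      refine tendsto_const_nhds.congr fun ε => ?_
      simp_rw [fun y => hc ε _ _ fun s hs => ho ε s hs y]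
      simp

/-- In the domain of the limit energy the constant sequence recovers it. Outside, the limit energy
is `⊤`, and the lower bound makes the energies of any admissible sequence tend to it. -/
theorem Admissible.exists_recovery (h : Admissible p a) (hp : p = 1 / 2 ∨ p = 1)
    {u₀ v : Cyl n → ℝ} (hu₀ : MemLp u₀ 2 (volOmega n)) (hv : MemLp v 2 (surf n)) :
    ∃ u : Param → Cyl n → ℝ, (∀ ε, MemLp (u ε) 2 (volOmega n)) ∧
      Tendsto (fun ε => eLpNorm (fun x => u ε x - u₀ x) 2 (volOmega n)) toZero (𝓝 0) ∧
      Tendsto (fun ε : Param => eLpNorm (fun x => bdryAvg ε (u ε) x - v x) 2 (surf n))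
        toZero (𝓝 0) ∧
      Tendsto (fun ε : Param => energy a ε (u ε)) toZero (𝓝 (energy₀ u₀ v)) := by
  by_cases hdom : MemH1 u₀ ∧ IsTrace u₀ v
  · have h1 : Tendsto (fun _ : Param => eLpNorm (fun x => u₀ x - u₀ x) 2 (volOmega n)) toZero
        (𝓝 0) := by simp
    have h2 := hdom.2.tendsto_bdryAvg hu₀ hv.1
    refine ⟨fun _ => u₀, fun _ => hu₀, h1, h2, tendsto_of_le_liminf_of_limsup_le
      (h.energy₀_le_liminf hp (fun _ => hu₀) hu₀ hv.1 h1 h2) ?_⟩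
    rw [energy₀, if_pos hdom]
    exact h.limsup_energy_le hdom.1
  · obtain ⟨u, hu, h1, h2⟩ := exists_tendsto_bdryAvg hu₀ hv
    refine ⟨u, hu, h1, h2, tendsto_of_le_liminf_of_limsup_le
      (h.energy₀_le_liminf hp hu hu₀ hv.1 h1 h2) ?_⟩
    rw [energy₀, if_neg hdom]
    exact le_top

end Recovery

/-! ### Functions and their classes -/

section Classes

variable {κ : ℝ} {φ : ℝ → ℝ} {a : ℝ → ℝ → ℝ}

/-- The topology of the Hilbert sum is the product topology, and the weight `κ` only multiplies the
boundary norm by the positive constant `κ^(1/2)`. -/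
theorem tendsto_immersion_iff (hκ : 0 < κ) {hφ : ∀ ε ∈ Ioo (0 : ℝ) (1 / 2), 0 < φ ε}
    {u : ∀ ε : Param, L2cap n φ ε} {w : X₀ n κ} {l : Filter Param} :
    Tendsto (fun ε => immersion n κ φ hφ ε (u ε)) l (𝓝 w) ↔
      Tendsto (fun ε => eLpNorm (fun x => u ε x - w.fst x) 2 (volOmega n)) l (𝓝 0) ∧
      Tendsto (fun ε : Param => eLpNorm (fun x => bdryAvg ε (u ε) x - w.snd x) 2 (surf n)) l
        (𝓝 0) := by
  rw [(WithLp.homeomorphProd 2 (Lp ℝ 2 (volOmega n))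
    (Lp ℝ 2 (ENNReal.ofReal κ • surf n))).isInducing.tendsto_nhds_iff, nhds_prod_eq,
    tendsto_prod_iff']
  refine and_congr ?_ ?_
  · rw [Lp.tendsto_Lp_iff_tendsto_eLpNorm']
    refine tendsto_congr fun ε => eLpNorm_congr_ae ?_
    have hu := (memLp_capMeasure_iff (hφ ε ε.2) _).1 (Lp.memLp (u ε))
    exact hu.coeFn_toLp.sub (ae_eq_refl _)
  · rw [Lp.tendsto_Lp_iff_tendsto_eLpNorm']
    have hc : ENNReal.ofReal κ ≠ 0 := by simpa using hκ
    set c : ℝ≥0∞ := ENNReal.ofReal κ ^ (1 / 2 : ℝ)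
    have hc0 : c ≠ 0 := by simp [c, hκ]
    have hct : c ≠ ⊤ := ENNReal.rpow_ne_top_of_nonneg (by norm_num) ENNReal.ofReal_ne_top
    have e : ∀ ε, eLpNorm (⇑(immersion n κ φ hφ ε (u ε)).snd - ⇑w.snd) 2
        (ENNReal.ofReal κ • surf n) =
        c * eLpNorm (fun x => bdryAvg ε (u ε) x - w.snd x) 2 (surf n) := by
      intro ε
      have hu := (memLp_capMeasure_iff (hφ ε ε.2) _).1 (Lp.memLp (u ε))
      have hb := memLp_bdryAvg ε.2.1 (ε.2.2.trans (by norm_num)) hu κ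
      have h1 := eLpNorm_smul_measure_of_ne_zero hc
        (fun x => bdryAvg ε (u ε) x - w.snd x) 2 (surf n)
      rw [smul_eq_mul, show (1 / (2 : ℝ≥0∞)).toReal = 1 / 2 by norm_num] at h1
      rw [← h1]
      exact eLpNorm_congr_ae (hb.coeFn_toLp.sub (ae_eq_refl _))
    refine (tendsto_congr e).trans ⟨fun h => ?_, fun h => ?_⟩
    · have := ENNReal.Tendsto.const_mul (a := c⁻¹) h (Or.inr (ENNReal.inv_ne_top.2 hc0))
      simpa only [← mul_assoc, ENNReal.inv_mul_cancel hc0 hct, one_mul, mul_zero] using this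
    · simpa using ENNReal.Tendsto.const_mul (a := c) h (Or.inr hct)

theorem volOmega_absolutelyContinuous {ε : ℝ} (hφ : 0 < φ ε) :
    volOmega n ≪ capMeasure n φ ε := by
  refine withDensity_absolutelyContinuous' (measurable_capacity φ ε).ennreal_ofReal.aemeasurable
    (Eventually.of_forall fun x => ?_)
  unfold capacity
  split_ifs <;> simp [hφ]

theorem isWeakGrad_congr {u u' : Cyl n → ℝ} (h : u =ᵐ[volOmega n] u')
    {G : Cyl n → EuclideanSpace ℝ (Fin (n + 1))} : IsWeakGrad u G ↔ IsWeakGrad u' G := by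
  have e : ∀ (i : Fin (n + 1)) (φ : Cyl n → ℝ), ∫ x, u x * pderiv i φ x ∂(volOmega n) =
      ∫ x, u' x * pderiv i φ x ∂(volOmega n) := by
    intro i φ
    refine integral_congr_ae ?_
    filter_upwards [h] with x hx
    rw [hx]
  simp only [IsWeakGrad, e]

theorem energy_congr {u u' : Cyl n → ℝ} (h : u =ᵐ[volOmega n] u') (ε : ℝ) :
    energy a ε u = energy a ε u' := by
  have e : MemH1loc u ↔ MemH1loc u' := by
    simp only [MemH1loc, isWeakGrad_congr h,
      fun δ => memLp_congr_ae (p := 2) (ae_restrict_of_ae (s := innerDomain n δ) h)]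
  have e2 : ∀ w : Cyl n → ℝ, dirichlet w u = dirichlet w u' := fun w => by
    simp only [dirichlet, isWeakGrad_congr h]
  unfold energy
  rw [e2]
  by_cases hm : MemH1loc u
  · rw [if_pos hm, if_pos (e.1 hm)]
  · rw [if_neg hm, if_neg (mt e.2 hm)]

/-- Averages are integrals over single fibres, so changing `u` on a null set changes them only on a
null set of fibres; the `L²` bound for averages shows this without slicing null sets. -/
theorem eLpNorm_bdryAvg_sub_congr {ε : ℝ} (hε : ε ∈ Ioo (0 : ℝ) (1 / 2)) {u u' : Cyl n → ℝ}
    (hu : MemLp u 2 (volOmega n)) (h : u =ᵐ[volOmega n] u') (v : Cyl n → ℝ) :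
    eLpNorm (fun x => bdryAvg ε u x - v x) 2 (surf n) =
      eLpNorm (fun x => bdryAvg ε u' x - v x) 2 (surf n) := by
  have hε1 : ε ≤ 1 := by linarith [hε.2]
  have key : ∀ {u u' : Cyl n → ℝ}, MemLp u 2 (volOmega n) → u =ᵐ[volOmega n] u' →
      avg 0 ε u =ᵐ[(volume : Measure (UnitAddTorus (Fin n)))] avg 0 ε u' := by
    intro u u' hu h
    have hu' : MemLp u' 2 (volOmega n) := (memLp_congr_ae h).1 hu
    have h1 := eLpNorm_avg_sub_avg_le hu hu' le_rfl hε.1 hε1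
    have h2 : eLpNorm (fun x => u x - u' x) 2 (volOmega n) = 0 := by
      rw [eLpNorm_congr_ae (g := 0)]
      · simp
      · filter_upwards [h] with x hx
        simp [hx]
    rw [h2, mul_zero, nonpos_iff_eq_zero] at h1
    have h3 := (eLpNorm_eq_zero_iff
      ((aestronglyMeasurable_avg_of_memLp hu le_rfl hε.1 hε1).sub
        (aestronglyMeasurable_avg_of_memLp hu' le_rfl hε.1 hε1)) two_ne_zero).1 h1
    filter_upwards [h3] with y hy
    exact sub_eq_zero.1 hy
  have hr : u ∘ reflect =ᵐ[volOmega n] u' ∘ reflect :=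
    (measurePreserving_reflect n).quasiMeasurePreserving.ae_eq_comp h
  have hsq : eLpNorm (fun x => bdryAvg ε u x - v x) 2 (surf n) ^ 2 =
      eLpNorm (fun x => bdryAvg ε u' x - v x) 2 (surf n) ^ 2 := by
    rw [eLpNorm_surf_sq, eLpNorm_surf_sq]
    simp only [bdryAvg_zero, bdryAvg_one]
    congr 2
    · refine eLpNorm_congr_ae ?_
      filter_upwards [key hu h] with y hy
      rw [hy]
    · refine eLpNorm_congr_ae ?_
      filter_upwards [key (memLp_reflect hu) hr] with y hy
      rw [hy]
  exact le_antisymm (le_of_sq_le_sq hsq.le) (le_of_sq_le_sq hsq.ge)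

theorem Admissible.gammaConverges {p : ℝ} (h : Admissible p a) (hp : p = 1 / 2 ∨ p = 1)
    (hκ : 0 < κ) (hφ : ∀ ε ∈ Ioo (0 : ℝ) (1 / 2), 0 < φ ε) :
    GammaConverges (fun (ε : Param) (u : L2cap n φ ε) => energy a ε u)
      (fun w : X₀ n κ => energy₀ w.fst w.snd) (immersion n κ φ hφ) := by
  have hw : ∀ w : X₀ n κ, MemLp w.snd 2 (surf n) := fun w =>
    (Lp.memLp w.snd).of_measure_le_smul (c := (ENNReal.ofReal κ)⁻¹)
      (ENNReal.inv_ne_top.2 (by simpa using hκ)) (by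
        rw [smul_smul, ENNReal.inv_mul_cancel (by simpa using hκ) ENNReal.ofReal_ne_top, one_smul])
  refine ⟨fun u w huw => ?_, fun w => ?_⟩
  · obtain ⟨h1, h2⟩ := (tendsto_immersion_iff hκ).1 huw
    exact h.energy₀_le_liminf hp
      (fun ε => (memLp_capMeasure_iff (hφ ε ε.2) _).1 (Lp.memLp (u ε))) (Lp.memLp w.fst)
      (hw w).1 h1 h2
  · obtain ⟨u, hu, h1, h2, h3⟩ := h.exists_recovery hp (Lp.memLp w.fst) (hw w)
    have hc := fun ε : Param => (memLp_capMeasure_iff (hφ ε ε.2) (u ε)).2 (hu ε)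
    have hae : ∀ ε : Param, u ε =ᵐ[volOmega n] (hc ε).toLp (u ε) := fun ε =>
      (volOmega_absolutelyContinuous (hφ ε ε.2)).ae_le (hc ε).coeFn_toLp.symm
    refine ⟨fun ε => (hc ε).toLp (u ε), h3.congr fun ε => energy_congr (hae ε) ε,
      (tendsto_immersion_iff hκ).2 ⟨h1.congr fun ε => eLpNorm_congr_ae ?_, h2.congr fun ε =>
        eLpNorm_bdryAvg_sub_congr ε.2 (hu ε) (hae ε) _⟩⟩
    exact (hae ε).sub (ae_eq_refl _)

end Classes

/-! ### The example -/

/-- On `(s, ε)` the resistance density is `ε / σ ≤ ε / s`, so the resistance is at most `ε² / s`.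
Its root `ε s^(-1/2)` is integrable, and the mean over `(0, ε)` is `2 ε^(1/2)`. This crude bound
suits `p = 1/2`, since `1 / s` itself is not integrable at `0`. -/
theorem admissible_min : Admissible (1 / 2) fun ε d => min (d / ε) 1 where
  continuousOn ε _ := by fun_prop
  ne_zero ε hε d hd := (lt_min (div_pos hd.1 hε.1) one_pos).ne'
  tendsto_one := by
    rw [Metric.tendstoLocallyUniformlyOn_iff]
    intro r hr x hx
    refine ⟨Ioi (x / 2), mem_nhdsWithin_of_mem_nhds (Ioi_mem_nhds (by linarith [hx.1])), ?_⟩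
    filter_upwards [Ioo_mem_nhdsGT (show (0 : ℝ) < x / 2 by linarith [hx.1])] with ε hε y hy
    rw [min_eq_right]
    · simpa using hr
    · rw [one_le_div hε.1]
      exact (hε.2.trans hy).le
  lower := ⟨1, one_pos, fun ε hε d hd => le_min ((one_le_div hε.1).2 hd.1) le_rfl⟩
  upper := ⟨1, fun _ _ _ _ => min_le_right _ _⟩
  nondegenerate := by
    have hbound : ∀ ε ∈ Ioo (0 : ℝ) (1 / 2), (ENNReal.ofReal ε)⁻¹ *
        ∫⁻ s in Ioo 0 ε, (∫⁻ σ in Ioo s ε, ENNReal.ofReal (1 / min (σ / ε) 1)) ^ (1 / 2 : ℝ) ≤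
        ENNReal.ofReal (2 * ε ^ (1 / 2 : ℝ)) := by
      intro ε hε
      have h0 : ENNReal.ofReal ε ≠ 0 := by simpa using hε.1
      have hpt : ∀ s ∈ Ioo 0 ε,
          (∫⁻ σ in Ioo s ε, ENNReal.ofReal (1 / min (σ / ε) 1)) ^ (1 / 2 : ℝ) ≤
            ENNReal.ofReal (ε * s ^ (-(1 / 2) : ℝ)) := by
        intro s hs
        have h1 : ∫⁻ σ in Ioo s ε, ENNReal.ofReal (1 / min (σ / ε) 1) ≤
            ENNReal.ofReal (ε ^ 2 / s) := by
          calc _ ≤ ∫⁻ _ in Ioo s ε, ENNReal.ofReal (ε / s) := by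
                refine setLIntegral_mono' measurableSet_Ioo fun σ hσ => ENNReal.ofReal_le_ofReal ?_
                rw [min_eq_left ((div_le_one hε.1).2 hσ.2.le), one_div_div]
                exact div_le_div_of_nonneg_left hε.1.le hs.1 hσ.1.le
            _ ≤ _ := by
                rw [setLIntegral_const, Real.volume_Ioo, ← ENNReal.ofReal_mul
                  (div_nonneg hε.1.le hs.1.le)]
                refine ENNReal.ofReal_le_ofReal ?_
                rw [div_mul_eq_mul_div]
                have := hs.1
                have := hε.1
                gcongr
                nlinarith
        refine (ENNReal.rpow_le_rpow h1 (by norm_num)).trans (le_of_eq ?_)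
        rw [ENNReal.ofReal_rpow_of_nonneg (div_nonneg (sq_nonneg _) hs.1.le) (by norm_num),
          Real.div_rpow (sq_nonneg _) hs.1.le, ← Real.sqrt_eq_rpow, Real.sqrt_sq hε.1.le,
          Real.rpow_neg hs.1.le, div_eq_mul_inv]
      have hint : ∫⁻ s in Ioo 0 ε, ENNReal.ofReal (ε * s ^ (-(1 / 2) : ℝ)) =
          ENNReal.ofReal (ε * (2 * ε ^ (1 / 2 : ℝ))) := by
        have hI : IntervalIntegrable (fun s : ℝ => ε * s ^ (-(1 / 2) : ℝ)) volume 0 ε :=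
          (intervalIntegral.intervalIntegrable_rpow' (by norm_num)).const_mul ε
        have hI' : IntegrableOn (fun s : ℝ => ε * s ^ (-(1 / 2) : ℝ)) (Ioo 0 ε) :=
          (integrableOn_Ioc_iff_integrableOn_Ioo).1 hI.1
        rw [← ofReal_integral_eq_lintegral_ofReal hI' ((ae_restrict_mem measurableSet_Ioo).mono
          fun s hs => mul_nonneg hε.1.le (Real.rpow_nonneg hs.1.le _)),
          ← integral_Ioc_eq_integral_Ioo, ← intervalIntegral.integral_of_le hε.1.le,
          intervalIntegral.integral_const_mul, integral_rpow (Or.inl (by norm_num)),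
          Real.zero_rpow (by norm_num)]
        norm_num
        ring_nf
      calc _ ≤ (ENNReal.ofReal ε)⁻¹ * ENNReal.ofReal (ε * (2 * ε ^ (1 / 2 : ℝ))) := by
            rw [← hint]
            gcongr _ * ?_
            exact setLIntegral_mono' measurableSet_Ioo hpt
        _ = _ := by
            rw [ENNReal.ofReal_mul hε.1.le, ← mul_assoc,
              ENNReal.inv_mul_cancel h0 ENNReal.ofReal_ne_top, one_mul]
    have hlim : Tendsto (fun ε : ℝ => ENNReal.ofReal (2 * ε ^ (1 / 2 : ℝ))) (𝓝[>] 0) (𝓝 0) := by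
      have h1 : Tendsto (fun ε : ℝ => 2 * ε ^ (1 / 2 : ℝ)) (𝓝 0) (𝓝 (2 * 0 ^ (1 / 2 : ℝ))) :=
        ((Real.continuous_rpow_const (by norm_num)).tendsto 0).const_mul 2
      rw [Real.zero_rpow (by norm_num), mul_zero] at h1
      simpa using ENNReal.tendsto_ofReal (h1.mono_left nhdsWithin_le_nhds)
    refine tendsto_of_tendsto_of_tendsto_of_le_of_le' tendsto_const_nhds hlim
      (Eventually.of_forall fun _ => zero_le) ?_
    filter_upwards [Ioo_mem_nhdsGT (show (0 : ℝ) < 1 / 2 by norm_num)] with ε hε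
    exact hbound ε hε

end ThinLayer

end

theorem mainTheorem8 (n : ℕ) (κ : ℝ) (hκ : 0 < κ) (φ : ℝ → ℝ)
    (hφ : ∀ ε ∈ Set.Ioo (0 : ℝ) (1 / 2), 0 < φ ε)
    (hφκ : Filter.Tendsto (fun ε : ℝ => φ ε * ε) (nhdsWithin 0 (Set.Ioi 0)) (nhds κ)) :
    (∀ (p : ℝ) (a : ℝ → ℝ → ℝ), (p = 1 / 2 ∨ p = 1) → ThinLayer.Admissible p a →
      ThinLayer.GammaConverges
        (fun (ε : ThinLayer.Param) (u : ThinLayer.L2cap n φ ε) => ThinLayer.energy a ε u)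
        (fun w : ThinLayer.X₀ n κ => ThinLayer.energy₀ w.fst w.snd)
        (ThinLayer.immersion n κ φ hφ)) ∧
    ThinLayer.GammaConverges
      (fun (ε : ThinLayer.Param) (u : ThinLayer.L2cap n φ ε) =>
        ThinLayer.energy (fun ε d => min (d / ε) 1) ε u)
      (fun w : ThinLayer.X₀ n κ => ThinLayer.energy₀ w.fst w.snd)
      (ThinLayer.immersion n κ φ hφ) := by
  exact ⟨fun p a hp h => h.gammaConverges hp hκ hφ,
    ThinLayer.admissible_min.gammaConverges (Or.inl rfl) hκ hφ⟩
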